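/- Let $\mathbb{T}=\mathbb{R}/2\pi\mathbb{Z}$, write $\langle f\rangle=\frac1{2\pi}\int_{\mathbb{T}}f\,dx$, and for $g,b>0$ let $L$ be the Fourier multiplier on $\mathbb{T}$ with symbol $\ell(\xi)=\big((g+\xi^2)\,|\xi|\tanh(b|\xi|)\big)^{1/2}$. There is a universal constant $r>0$ such that the following holds. Let $g,b>0$, $T>0$, let $\omega\subset\mathbb{T}$ be a non-empty open set and let $0<c\le 1$. Then there exist positive constants $\varepsilon_2,\varepsilon_3,K$ such that, whenever $W\in C^3([0,T];H^1(\mathbb{T}))$ is real-valued, $\mathcal{R}\in C^0([0,T];\mathcal{L}(L^2(\mathbb{T};\mathbb{C})))$ (bounded, real-linear operators; in particular complex-linear ones are allowed), $\langle W(t)\rangle=0$ for all $t\in[0,T]$ and $$\sup_{t\in[0,T]}\sum_{1\le k\le 3}\|\partial_t^kW(t)\|_{H^1}+\sup_{t\in[0,T]}\|W(t)\|_{H^r}+\sup_{t\in[0,T]}\|\mathcal{R}(t)\|_{\mathcal{L}(L^2)}\le\varepsilon_2,$$ and whenever $w_0\in L^2(\mathbb{T};\mathbb{C})$ satisfies $$|\mathrm{Re}\,\langle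 w_0\rangle|\ge c\,|\langle w_0\rangle|-\varepsilon_3\|w_0\|_{L^2},$$ the solution $w\in C^0([0,T];L^2(\mathbb{T};\mathbb{C}))$ (in the sense of distributions) of $$\partial_tw+W\partial_xw+iLw+\mathcal{R}w=0,\qquad w(0)=w_0,$$ satisfies $$\int_0^T\!\!\int_\omega|\mathrm{Re}\,w(t,x)|^2\,dx\,dt\ \ge\ K\int_0^{2\pi}|w_0(x)|^2\,dx.$$ With the same constants, the same inequality holds for the solution $w\in C^0([0,T];L^2(\mathbb{T};\mathbb{C}))$ of $\partial_tw+W\partial_xw+iLw+\mathcal{R}w=0$ with datum $w(T)=w_0$ prescribed at time $T$. -/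

import Mathlib

open MeasureTheory Set Real

noncomputable section

namespace WaveObs

/-- The torus `𝕋 = ℝ / 2πℤ`. -/
abbrev Torus : Type := AddCircle (2 * π)

instance factTwoPi : Fact (0 < 2 * π) := ⟨Real.two_pi_pos⟩

/-- `L²(𝕋; ℂ)` for the Lebesgue measure `dx` of total mass `2π`. -/
abbrev LTwo : Type := Lp ℂ 2 (volume : Measure Torus)

/-- The mean value `⟨f⟩ = (1 / 2π) ∫_𝕋 f dx`. -/
def mean (f : Torus → ℂ) : ℂ := ((2 * π : ℝ) : ℂ)⁻¹ * ∫ x, f x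

/-- The symbol `ℓ(ξ) = ((g + ξ²) |ξ| tanh (b |ξ|))^{1/2}` of the Fourier multiplier `L`. -/
def ell (g b ξ : ℝ) : ℝ := √((g + ξ ^ 2) * (|ξ| * Real.tanh (b * |ξ|)))

/-- The Sobolev weight `⟨n⟩^s = (1 + n²)^{s/2}`. -/
def weight (s : ℝ) (n : ℤ) : ℝ := (1 + (n : ℝ) ^ 2) ^ (s / 2)

/-- The `H^s(𝕋)` norm of an `L²` function as an extended real
(it is `∞` exactly when the function is not in `H^s`). -/
def sobolevENorm (s : ℝ) (f : LTwo) : ENNReal :=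
  (∑' n : ℤ, ENNReal.ofReal ((weight s n * ‖fourierCoeff f n‖) ^ 2)) ^ (1 / 2 : ℝ)

theorem memLp_haar (f : LTwo) : MemLp f 2 (AddCircle.haarAddCircle (T := 2 * π)) :=
  memLp_haarAddCircle_iff.2 (Lp.memLp f)

theorem integrable_haar (f : LTwo) :
    Integrable f (AddCircle.haarAddCircle (T := 2 * π)) :=
  (memLp_haar f).integrable (by norm_num)

theorem haar_absolutelyContinuous :
    (AddCircle.haarAddCircle (T := 2 * π)) ≪ (volume : Measure Torus) := by
  intro s hs
  rw [AddCircle.volume_eq_smul_haarAddCircle] at hs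
  rw [Measure.smul_apply, smul_eq_mul, mul_eq_zero] at hs
  refine hs.resolve_left ?_
  simp [Real.pi_pos]

theorem volume_absolutelyContinuous :
    (volume : Measure Torus) ≪ (AddCircle.haarAddCircle (T := 2 * π)) := by
  rw [AddCircle.volume_eq_smul_haarAddCircle]
  exact Measure.smul_absolutelyContinuous

theorem fourierCoeff_add (f h : LTwo) (n : ℤ) :
    fourierCoeff (f + h : LTwo) n = fourierCoeff f n + fourierCoeff h n := by
  have e : ((f + h : LTwo) : Torus → ℂ) =ᵐ[AddCircle.haarAddCircle] (f : Torus → ℂ) + h :=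
    haar_absolutelyContinuous.ae_eq (Lp.coeFn_add f h)
  rw [fourierCoeff_congr_ae e, fourierCoeff.add (integrable_haar f) (integrable_haar h)]
  rfl

theorem fourierCoeff_smul (c : ℂ) (f : LTwo) (n : ℤ) :
    fourierCoeff (c • f : LTwo) n = c * fourierCoeff f n := by
  have e : ((c • f : LTwo) : Torus → ℂ) =ᵐ[AddCircle.haarAddCircle] c • (f : Torus → ℂ) :=
    haar_absolutelyContinuous.ae_eq (Lp.coeFn_smul c f)
  rw [fourierCoeff_congr_ae e, fourierCoeff.const_smul]
  rfl

/-- The sequence of all Fourier coefficients, as a linear map on `L²(𝕋)`. -/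
def fourierSeq : LTwo →ₗ[ℂ] (ℤ → ℂ) where
  toFun f := fourierCoeff f
  map_add' f h := funext (fourierCoeff_add f h)
  map_smul' c f := funext (fourierCoeff_smul c f)

theorem fourierSeq_injective : Function.Injective fourierSeq := by
  rw [injective_iff_map_eq_zero]
  intro f hf
  have hz : (memLp_haar f).toLp f = 0 := by
    apply (fourierBasis (T := 2 * π)).repr.injective
    ext n
    rw [fourierBasis_repr, fourierCoeff_congr_ae (memLp_haar f).coeFn_toLp]
    have h0 : fourierCoeff f n = 0 := congrFun hf n
    simp [h0]
  have h1 : (f : Torus → ℂ) =ᵐ[AddCircle.haarAddCircle] 0 := by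
    have h2 := (memLp_haar f).coeFn_toLp
    rw [hz] at h2
    exact h2.symm.trans (Lp.coeFn_zero ℂ 2 _)
  exact (Lp.eq_zero_iff_ae_eq_zero).2 (volume_absolutelyContinuous.ae_eq h1)

/-- The sequence `⟨n⟩^s f̂(n)`. -/
def weightedSeq (s : ℝ) : LTwo →ₗ[ℂ] (ℤ → ℂ) where
  toFun f := fun n => (weight s n : ℂ) * fourierSeq f n
  map_add' f h := by ext n; simp [mul_add]
  map_smul' c f := by ext n; simp [mul_left_comm]

/-- `H^s(𝕋; ℂ)`, `s ≥ 0`, as a subspace of `L²`: those `f` with `(⟨n⟩^s f̂(n))` in `ℓ²(ℤ)`. -/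
def sobolevSubmodule (s : ℝ) : Submodule ℂ LTwo where
  carrier := {f | Memℓp (weightedSeq s f) 2}
  zero_mem' := by
    change Memℓp (weightedSeq s 0) 2
    rw [map_zero]
    exact zero_memℓp
  add_mem' {f h} hf hh := by
    change Memℓp (weightedSeq s (f + h)) 2
    rw [map_add]
    exact hf.add hh
  smul_mem' c f hf := by
    change Memℓp (weightedSeq s (c • f)) 2
    rw [map_smul]
    exact hf.const_smul c

/-- The Sobolev space `H^s(𝕋; ℂ)`, carrying its own norm (not the one of `L²`):
`‖f‖_{H^s} = ‖(⟨n⟩^s f̂(n))‖_{ℓ²}`. -/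
def Sobolev (s : ℝ) : Type := sobolevSubmodule s

instance (s : ℝ) : AddCommGroup (Sobolev s) :=
  inferInstanceAs (AddCommGroup (sobolevSubmodule s))

instance (s : ℝ) : Module ℂ (Sobolev s) :=
  inferInstanceAs (Module ℂ (sobolevSubmodule s))

/-- The inclusion of `H^s` in `L²`. -/
def Sobolev.toLTwo {s : ℝ} : Sobolev s →ₗ[ℂ] LTwo := (sobolevSubmodule s).subtype

/-- The map `f ↦ (⟨n⟩^s f̂(n))` from `H^s` to `ℓ²(ℤ)`. -/
def Sobolev.toEllTwo (s : ℝ) : Sobolev s →ₗ[ℂ] lp (fun _ : ℤ => ℂ) 2 where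
  toFun f := ⟨weightedSeq s f.toLTwo, f.2⟩
  map_add' f h := by
    apply Subtype.ext
    change weightedSeq s (Sobolev.toLTwo (f + h)) = _
    rw [map_add, map_add]
    rfl
  map_smul' c f := by
    apply Subtype.ext
    change weightedSeq s (Sobolev.toLTwo (c • f)) = _
    rw [map_smul, map_smul]
    rfl

theorem weight_pos (s : ℝ) (n : ℤ) : 0 < weight s n := by
  unfold weight
  positivity

theorem Sobolev.toEllTwo_injective (s : ℝ) : Function.Injective (Sobolev.toEllTwo s) := by
  rw [injective_iff_map_eq_zero]
  intro f hf
  have h0 : weightedSeq s f.toLTwo = 0 := congrArg Subtype.val hf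
  have h1 : fourierSeq f.toLTwo = 0 := by
    ext n
    have h2 := congrFun h0 n
    have h3 : (weight s n : ℂ) ≠ 0 := by exact_mod_cast (weight_pos s n).ne'
    exact (mul_eq_zero.1 h2).resolve_left h3
  have h4 : f.toLTwo = 0 := fourierSeq_injective (by rw [h1, map_zero])
  exact Subtype.ext h4

instance (s : ℝ) : NormedAddCommGroup (Sobolev s) :=
  NormedAddCommGroup.induced (Sobolev s) (lp (fun _ : ℤ => ℂ) 2) (Sobolev.toEllTwo s)
    (Sobolev.toEllTwo_injective s)

instance (s : ℝ) : NormedSpace ℂ (Sobolev s) :=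
  NormedSpace.induced ℂ (Sobolev s) (lp (fun _ : ℤ => ℂ) 2) (Sobolev.toEllTwo s)

/-- The `n`-th Fourier coefficient of the distribution `W ∂ₓv`, for `W ∈ H¹` and `v ∈ L²`:
`∑ₖ Ŵ(n - k) · i k v̂(k)`. The series converges absolutely. -/
def transportCoeff (W v : LTwo) (n : ℤ) : ℂ :=
  ∑' k : ℤ, fourierCoeff W (n - k) * (Complex.I * k * fourierCoeff v k)

/-- `w ∈ C⁰([0,T]; L²(𝕋))` solves `∂ₜw + W ∂ₓw + i L w + 𝓡 w = 0` on `[0,T]` in the sense of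
periodic distributions in `x`: each Fourier coefficient of `w` is differentiable in time
(one-sidedly at `0` and `T`) and satisfies the corresponding coefficient of the equation. -/
structure IsSolution (g b T : ℝ) (W : ℝ → LTwo) (R : ℝ → LTwo →L[ℝ] LTwo)
    (w : ℝ → LTwo) : Prop where
  continuousOn : ContinuousOn w (Icc 0 T)
  equation : ∀ n : ℤ, ∀ t ∈ Icc (0 : ℝ) T,
    HasDerivWithinAt (fun τ => fourierCoeff (w τ) n)
      (-(transportCoeff (W t) (w t) n
        + Complex.I * (ell g b n : ℂ) * fourierCoeff (w t) n
        + fourierCoeff (R t (w t)) n)) (Icc 0 T) t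

end WaveObs

end

/-!
Write `aₙ(t)` for the Fourier coefficients of a solution `w` on `[0, T]`, `X(t) = ∑ₙ |aₙ(t)|²`,
`M = max X` and `Obs = ∫₀ᵀ∫_ω |Re w|²`. When `W` and `R` have size `ε`, the solution differs from a
free wave `e^{-itℓ(D)}w₀` by a term which loses one derivative in `L²`, so it cannot be treated as a
perturbation of the free wave as a whole. High and low frequencies are therefore handled
differently.

High frequencies (`exists_integral_tsum_sq_le`). Choose a trigonometric polynomial `χ` whose real
part is bounded, non-positive off `ω` and of positive mean (`exists_trig_polynomial`), so that `∫₀ᵀ∫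
Re χ (Re w)² ≤ 2 Obs`. In Fourier variables the left side is a finite combination of the diagonals
`∑ₖ aₖ conj a_{k+q}` and `∑ₖ aₖ a_{-k-q}`. Away from resonances each diagonal is, up to a factor
`±i` and `O(εM)`, the time derivative of the same diagonal weighted by `1 / (ℓ(k+q) - ℓ(k))`,
respectively `1 / (ℓ(k+q) + ℓ(k))` (`norm_diagForm_sub_le`). As `ℓ` grows like `|ξ|^{3/2}`, faster
than linearly, these weights tend to `0` at infinity, and their commutators with `W ∂ₓ` are bounded
(`exists_abs_bracket_invDiff_le`, `abs_bracket_invSum_le`). After integration in time only the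
diagonal `q = 0` survives, and it produces `∫₀ᵀ X`; the errors are a small multiple of `M` and a
finite number of low frequencies. The commutator estimate with weight `1` gives near-conservation of
`X` (`abs_tsum_sq_sub_le`), whence `∫₀ᵀ X ≥ T M / 2`.

Low frequencies (`exists_sq_norm_coeff_le`, `exists_sq_re_coeff_zero_le`). Each coefficient taken
separately is `O(ε √M)`-close to that of the free wave (`norm_sub_free_le`), and so is the pairing
of `Re w` with a smooth function `φ` supported in `ω`. For the free wave this pairing is an almost
periodic function with frequencies `±ℓ(n)`, whose gaps tend to infinity, so each of its coefficients
is controlled by its `L¹` norm on `[0, T]` (`exists_norm_coeff_le`): far apart frequencies make the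
Gram matrix for a suitable weight diagonally dominant, and the remaining finitely many frequencies
are removed one after the other by difference operators. Choosing `φ` which sees `e^{imx}` but not
`e^{-imx}` (`exists_test_function`) isolates `aₘ(0)` for `m ≠ 0`; for `m = 0` only `Re a₀(0)` is
obtained.

The imaginary part of `a₀` is recovered from the condition on the mean; as `ℓ(0) = 0`, the
coefficient `a₀` is almost constant in time, so it does not matter at which time the condition is
imposed (`exists_observability`).
-/

noncomputable section

namespace WaveObs

open scoped ComplexConjugate

/-! ### The dispersion relation -/

theorem tanh_eq_one_sub (x : ℝ) : Real.tanh x = 1 - 2 / (exp (2 * x) + 1) := by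
  have h1 : exp (2 * x) = exp x * exp x := by rw [← exp_add]; ring_nf
  have h2 : exp (-x) * exp x = 1 := by rw [← exp_add]; simp
  have hx := exp_pos x
  have hy := exp_pos (-x)
  rw [Real.tanh_eq_sinh_div_cosh, Real.sinh_eq, Real.cosh_eq, h1]
  field_simp
  nlinarith [h2]

theorem tanh_mono : Monotone Real.tanh := by
  intro x y h
  rw [tanh_eq_one_sub, tanh_eq_one_sub]
  have := exp_pos (2 * x)
  gcongr

theorem tanh_nonneg {x : ℝ} (hx : 0 ≤ x) : 0 ≤ Real.tanh x := by
  simpa using tanh_mono hx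

theorem tanh_pos {x : ℝ} (hx : 0 < x) : 0 < Real.tanh x := by
  rw [tanh_eq_one_sub]
  have h := Real.add_one_le_exp (2 * x)
  have : 2 / (exp (2 * x) + 1) < 1 := by
    rw [div_lt_one (by linarith)]; linarith
  linarith

theorem tanh_le_one (x : ℝ) : Real.tanh x ≤ 1 := by
  rw [tanh_eq_one_sub]
  have := exp_pos (2 * x)
  have : 0 ≤ 2 / (exp (2 * x) + 1) := by positivity
  linarith

theorem one_sub_tanh_le {x : ℝ} (hx : 0 < x) : 1 - Real.tanh x ≤ 1 / x ^ 2 := by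
  have h := Real.quadratic_le_exp_of_nonneg (x := 2 * x) (by linarith)
  rw [tanh_eq_one_sub, sub_sub_cancel, div_le_div_iff₀ (by positivity) (by positivity)]
  nlinarith

theorem ell_nonneg (g b x : ℝ) : 0 ≤ ell g b x := sqrt_nonneg _

theorem ell_neg (g b x : ℝ) : ell g b (-x) = ell g b x := by simp [ell]

theorem ell_abs (g b x : ℝ) : ell g b |x| = ell g b x := by simp [ell]

theorem ell_zero (g b : ℝ) : ell g b 0 = 0 := by simp [ell]

theorem ell_sq {g b x : ℝ} (hg : 0 < g) (hb : 0 < b) (hx : 0 ≤ x) :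
    ell g b x ^ 2 = (g + x ^ 2) * (x * Real.tanh (b * x)) := by
  have := tanh_nonneg (mul_nonneg hb.le hx)
  rw [ell, abs_of_nonneg hx, Real.sq_sqrt (by positivity)]

/-- The constant in the lower bound for the gaps of the dispersion relation. -/
def gapConst (g b : ℝ) : ℝ := Real.tanh b / (2 * √(g + 1))

theorem gapConst_pos {g b : ℝ} (hg : 0 < g) (hb : 0 < b) : 0 < gapConst g b := by
  have := tanh_pos hb
  unfold gapConst
  positivity

/-- Gaps of the dispersion relation grow like `√x`. The tanh factor is increasing, so the squares of
the two values can be compared. -/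
theorem gapConst_mul_le_ell_sub {g b x y : ℝ} (hg : 0 < g) (hb : 0 < b) (hx : 1 ≤ x)
    (hy : 0 ≤ y) (hyx : y ≤ x) :
    gapConst g b * ((x - y) * √x) ≤ ell g b x - ell g b y := by
  have hx0 : 0 < x := by linarith
  have htx := tanh_le_one (b * x)
  have htx0 : Real.tanh b ≤ Real.tanh (b * x) := tanh_mono (by nlinarith)
  have hb0 := tanh_pos hb
  have hty : Real.tanh (b * y) ≤ Real.tanh (b * x) := tanh_mono (by gcongr)
  have hty0 := tanh_nonneg (mul_nonneg hb.le hy)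
  have hsx := ell_sq hg hb hx0.le
  have hsy := ell_sq hg hb hy
  -- `key` bounds the difference of the squares from below, `upper` their sum from above
  have key : Real.tanh b * ((x - y) * x ^ 2) ≤ ell g b x ^ 2 - ell g b y ^ 2 := by
    rw [hsx, hsy]
    have h1 : (g + y ^ 2) * (y * Real.tanh (b * y)) ≤ (g + y ^ 2) * (y * Real.tanh (b * x)) := by
      gcongr
    have h2 : Real.tanh (b * x) * ((x - y) * x ^ 2) ≤
        Real.tanh (b * x) * ((g + x ^ 2) * x - (g + y ^ 2) * y) := by
      apply mul_le_mul_of_nonneg_left _ (by linarith)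
      have : 0 ≤ (x - y) * (g + x * y + y ^ 2) := by
        apply mul_nonneg (by linarith); positivity
      nlinarith
    have h3 : Real.tanh b * ((x - y) * x ^ 2) ≤ Real.tanh (b * x) * ((x - y) * x ^ 2) := by
      apply mul_le_mul_of_nonneg_right htx0
      apply mul_nonneg (by linarith); positivity
    nlinarith
  have hs := Real.sq_sqrt hx0.le
  have hspos : 0 < √x := sqrt_pos.2 hx0
  have hG := Real.sq_sqrt (show 0 ≤ g + 1 by linarith)
  have hGpos : 0 < √(g + 1) := sqrt_pos.2 (by linarith)
  have upper : ell g b x ≤ √(g + 1) * (x * √x) := by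
    apply le_of_sq_le_sq _ (by positivity)
    rw [hsx, mul_pow, mul_pow, hG, hs]
    calc (g + x ^ 2) * (x * Real.tanh (b * x)) ≤ (g + x ^ 2) * (x * 1) := by gcongr
      _ ≤ (g + 1) * (x ^ 2 * x) := by
          have : g * x * 1 ≤ g * x * x ^ 2 := by gcongr; nlinarith
          nlinarith
  have hle : 0 ≤ ell g b x - ell g b y := by
    have : ell g b y ≤ ell g b x := by
      apply le_of_sq_le_sq _ (ell_nonneg _ _ _)
      have : 0 ≤ Real.tanh b * ((x - y) * x ^ 2) := by
        apply mul_nonneg hb0.le; apply mul_nonneg (by linarith); positivity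
      linarith
    linarith
  have h4 : ell g b x ^ 2 - ell g b y ^ 2 ≤
      (ell g b x - ell g b y) * (2 * √(g + 1) * (x * √x)) := by
    have : ell g b x ^ 2 - ell g b y ^ 2 =
      (ell g b x - ell g b y) * (ell g b x + ell g b y) := by ring
    rw [this]
    apply mul_le_mul_of_nonneg_left _ hle
    linarith
  have h5 : gapConst g b * ((x - y) * √x) * (2 * √(g + 1) * (x * √x)) =
      Real.tanh b * ((x - y) * x ^ 2) := by
    unfold gapConst
    field_simp
    rw [hs]
    ring
  have h6 : 0 < 2 * √(g + 1) * (x * √x) := by positivity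
  exact le_of_mul_le_mul_right (h5.trans_le (key.trans h4)) h6

/-- `ℓ(x) = x^{3/2} + O(1)`, so that second differences of `ℓ` are those of `x^{3/2}` up to a
constant. -/
theorem abs_ell_sub_le {g b : ℝ} (hg : 0 < g) (hb : 0 < b) :
    ∀ x : ℝ, 1 ≤ x → |ell g b x - x * √x| ≤ g + 1 / b ^ 2 := by
  intro x hx
  have hx0 : 0 < x := by linarith
  have hs := Real.sq_sqrt hx0.le
  have hs1 : 1 ≤ √x := by rw [Real.one_le_sqrt]; exact hx
  have h1 := one_sub_tanh_le (mul_pos hb hx0)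
  have h2 := tanh_le_one (b * x)
  have h3 := tanh_nonneg (mul_pos hb hx0).le
  have h0 := ell_nonneg g b x
  have hfac : (ell g b x - x * √x) * (ell g b x + x * √x) =
      g * x * Real.tanh (b * x) - x ^ 3 * (1 - Real.tanh (b * x)) := by
    have : (x * √x) ^ 2 = x ^ 3 := by rw [mul_pow, hs]; ring
    have := ell_sq hg hb hx0.le
    nlinarith
  have h4 : x ^ 3 * (1 - Real.tanh (b * x)) ≤ 1 / b ^ 2 * x := by
    calc x ^ 3 * (1 - Real.tanh (b * x)) ≤ x ^ 3 * (1 / (b * x) ^ 2) := by gcongr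
      _ = 1 / b ^ 2 * x := by field_simp
  have h5 : 0 ≤ x ^ 3 * (1 - Real.tanh (b * x)) := by
    apply mul_nonneg (by positivity); linarith
  have h6 : 0 ≤ g * x * Real.tanh (b * x) := by positivity
  have h7 : g * x * Real.tanh (b * x) ≤ g * x := by
    have : 0 < g * x := by positivity
    nlinarith
  have hC : 0 < 1 / b ^ 2 := by positivity
  have hxs : x ≤ ell g b x + x * √x := by nlinarith
  have hprod : |ell g b x - x * √x| * (ell g b x + x * √x) ≤ (g + 1 / b ^ 2) * x := by
    rw [← abs_of_nonneg (show 0 ≤ ell g b x + x * √x by linarith), ← abs_mul, hfac, abs_le]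
    constructor <;> nlinarith [mul_pos hg hx0]
  by_contra hcon
  push Not at hcon
  have : (g + 1 / b ^ 2) * x < |ell g b x - x * √x| * (ell g b x + x * √x) := by
    apply mul_lt_mul hcon hxs hx0 (abs_nonneg _)
  linarith

theorem abs_sqrt_sub_sqrt_le {x y : ℝ} (hx : 1 ≤ x) (hy : 1 ≤ y) : |√x - √y| ≤ |x - y| := by
  have h1 : 1 ≤ √x := by rw [Real.one_le_sqrt]; exact hx
  have h2 : 1 ≤ √y := by rw [Real.one_le_sqrt]; exact hy
  have h3 := Real.sq_sqrt (show 0 ≤ x by linarith)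
  have h4 := Real.sq_sqrt (show 0 ≤ y by linarith)
  have : x - y = (√x - √y) * (√x + √y) := by ring_nf; rw [h3, h4]
  rw [this, abs_mul, abs_of_nonneg (show 0 ≤ √x + √y by linarith)]
  have := abs_nonneg (√x - √y)
  nlinarith

/-- Second differences of `x ↦ x^{3/2}` are bounded by the product of the two steps. -/
theorem abs_second_diff_mul_sqrt_le {j p q : ℝ} (h0 : 1 ≤ j) (hp : 1 ≤ j + p) (hq : 1 ≤ j + q)
    (hpq : 1 ≤ j + p + q) :
    |((j + p + q) * √(j + p + q) - (j + p) * √(j + p)) - ((j + q) * √(j + q) - j * √j)| ≤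
      3 / 2 * |p| * |q| := by
  have hder : ∀ x : ℝ, 1 ≤ x → HasDerivAt (fun y => y * √y) (3 / 2 * √x) x := by
    intro x hx
    have hx0 : 0 < x := by linarith
    have h := (hasDerivAt_id x).mul (Real.hasDerivAt_sqrt hx0.ne')
    have hs := Real.sq_sqrt hx0.le
    have hpos : 0 < √x := sqrt_pos.2 hx0
    refine h.congr_deriv ?_
    change 1 * √x + x * (1 / (2 * √x)) = 3 / 2 * √x
    have e : x * (1 / (2 * √x)) = √x / 2 := by
      field_simp
      exact hs.symm
    rw [e]
    ring
  have hmem : ∀ y ∈ uIcc (0 : ℝ) q, 1 ≤ j + y ∧ 1 ≤ j + p + y := by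
    intro y hy
    rcases mem_uIcc.1 hy with h | h <;> constructor <;> linarith [h.1, h.2]
  have hF : ∀ y ∈ uIcc (0 : ℝ) q, HasDerivWithinAt
      (fun y => (j + p + y) * √(j + p + y) - (j + y) * √(j + y))
      (3 / 2 * √(j + p + y) - 3 / 2 * √(j + y)) (uIcc (0 : ℝ) q) y := by
    intro y hy
    obtain ⟨h1, h2⟩ := hmem y hy
    have e1 := (hder _ h2).comp_const_add (j + p) y
    have e2 := (hder _ h1).comp_const_add j y
    exact (e1.sub e2).hasDerivWithinAt
  have hb : ∀ y ∈ uIcc (0 : ℝ) q, ‖3 / 2 * √(j + p + y) - 3 / 2 * √(j + y)‖ ≤ 3 / 2 * |p| := by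
    intro y hy
    obtain ⟨h1, h2⟩ := hmem y hy
    have := abs_sqrt_sub_sqrt_le h2 h1
    rw [← mul_sub, norm_mul, Real.norm_eq_abs, Real.norm_eq_abs, abs_of_pos (by norm_num)]
    have e : j + p + y - (j + y) = p := by ring
    rw [e] at this
    gcongr
  have := (convex_uIcc (0 : ℝ) q).norm_image_sub_le_of_norm_hasDerivWithin_le hF hb
    left_mem_uIcc right_mem_uIcc
  simp only [add_zero, sub_zero, Real.norm_eq_abs] at this
  rw [show ((j + p + q) * √(j + p + q) - (j + p) * √(j + p)) - ((j + q) * √(j + q) - j * √j) =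
    (j + p + q) * √(j + p + q) - (j + q) * √(j + q) - ((j + p) * √(j + p) - j * √j) by ring]
  exact this

/-- The dispersion relation at integer frequencies. -/
def disp (g b : ℝ) (n : ℤ) : ℝ := ell g b n

theorem disp_neg (g b : ℝ) (n : ℤ) : disp g b (-n) = disp g b n := by
  simp [disp, ell_neg]

theorem disp_abs (g b : ℝ) (n : ℤ) : disp g b |n| = disp g b n := by
  simp [disp, ell_abs]

theorem disp_zero (g b : ℝ) : disp g b 0 = 0 := by simp [disp, ell_zero]

theorem disp_nonneg (g b : ℝ) (n : ℤ) : 0 ≤ disp g b n := ell_nonneg _ _ _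

theorem gapConst_mul_le_disp_sub {g b : ℝ} (hg : 0 < g) (hb : 0 < b) {n k : ℤ} (hk : 0 ≤ k)
    (hkn : k < n) : gapConst g b * (((n : ℝ) - k) * √n) ≤ disp g b n - disp g b k := by
  have h1 : (1 : ℝ) ≤ n := by exact_mod_cast (by omega : (1 : ℤ) ≤ n)
  have h2 : (0 : ℝ) ≤ k := by exact_mod_cast hk
  have h3 : (k : ℝ) ≤ n := by exact_mod_cast hkn.le
  exact gapConst_mul_le_ell_sub hg hb h1 h2 h3

/-- The frequencies `± ℓ(n)` of the real part of a free wave, listed in increasing order. -/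
def freq (g b : ℝ) (n : ℤ) : ℝ := n.sign * disp g b n

theorem freq_neg (g b : ℝ) (n : ℤ) : freq g b (-n) = -freq g b n := by
  simp [freq, disp_neg]

theorem freq_of_nonneg (g b : ℝ) {n : ℤ} (hn : 0 ≤ n) : freq g b n = disp g b n := by
  rcases hn.eq_or_lt with h | h
  · subst h; simp [freq, disp_zero]
  · simp [freq, Int.sign_eq_one_of_pos h]

/-- The signed frequencies are separated by gaps which tend to infinity. -/
theorem gapConst_mul_le_freq_sub {g b : ℝ} (hg : 0 < g) (hb : 0 < b) {n k : ℤ} (hkn : k < n) :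
    gapConst g b / 2 * (((n : ℝ) - k) * √(max |(n : ℝ)| |(k : ℝ)|)) ≤
      freq g b n - freq g b k := by
  have hc := gapConst_pos hg hb
  -- both frequencies nonnegative
  have pos : ∀ n k : ℤ, 0 ≤ k → k < n →
      gapConst g b / 2 * (((n : ℝ) - k) * √(max |(n : ℝ)| |(k : ℝ)|)) ≤
      freq g b n - freq g b k := by
    intro n k hk hkn
    have h2 : (0 : ℝ) ≤ k := by exact_mod_cast hk
    have h3 : (k : ℝ) < n := by exact_mod_cast hkn
    rw [freq_of_nonneg _ _ hk, freq_of_nonneg _ _ (by omega), abs_of_nonneg h2,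
      abs_of_nonneg (by linarith), max_eq_left h3.le]
    refine le_trans ?_ (gapConst_mul_le_disp_sub hg hb hk hkn)
    have : 0 ≤ ((n : ℝ) - k) * √n := mul_nonneg (by linarith) (sqrt_nonneg _)
    nlinarith
  rcases le_or_gt 0 k with hk | hk
  · exact pos n k hk hkn
  rcases le_or_gt n 0 with hn | hn
  · have := pos (-k) (-n) (by omega) (by omega)
    rw [freq_neg, freq_neg] at this
    push_cast at this
    rw [abs_neg, abs_neg, max_comm] at this
    convert this using 1 <;> ring
  · -- opposite signs
    have hn' : (0 : ℝ) < n := by exact_mod_cast hn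
    have hk' : (k : ℝ) < 0 := by exact_mod_cast hk
    have e1 := gapConst_mul_le_disp_sub hg hb le_rfl hn
    have e2 := gapConst_mul_le_disp_sub hg hb le_rfl (show (0 : ℤ) < -k by omega)
    rw [disp_zero] at e1 e2
    have e3 : freq g b k = -disp g b (-k) := by
      rw [← freq_of_nonneg g b (show 0 ≤ -k by omega), freq_neg, neg_neg]
    rw [freq_of_nonneg _ _ hn.le, e3, abs_of_pos hn', abs_of_neg hk']
    push_cast at e1 e2 ⊢
    simp only [sub_zero] at e1 e2
    have s1 := sqrt_nonneg (n : ℝ)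
    have s2 := sqrt_nonneg (-k : ℝ)
    rcases le_total (n : ℝ) (-k) with h | h
    · rw [max_eq_right h]
      have : ((n : ℝ) - k) * √(-k) ≤ 2 * (-k * √(-k)) := by nlinarith
      have : 0 ≤ gapConst g b * ((n : ℝ) * √n) := by positivity
      nlinarith
    · rw [max_eq_left h]
      have : ((n : ℝ) - k) * √n ≤ 2 * (n * √n) := by nlinarith
      have : 0 ≤ gapConst g b * ((-k : ℝ) * √(-k)) :=
        mul_nonneg hc.le (mul_nonneg (by linarith) s2)
      nlinarith

/-! ### Denominators of the normal form -/

theorem one_le_max_abs {n k : ℤ} (h : n ≠ 0 ∨ k ≠ 0) : (1 : ℝ) ≤ max |(n : ℝ)| |(k : ℝ)| := by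
  rcases h with h | h
  · exact le_max_of_le_left (by exact_mod_cast Int.one_le_abs h)
  · exact le_max_of_le_right (by exact_mod_cast Int.one_le_abs h)

theorem gapConst_mul_sqrt_le_abs_disp_sub {g b : ℝ} (hg : 0 < g) (hb : 0 < b) {n k : ℤ}
    (h : |n| ≠ |k|) :
    gapConst g b * √(max |(n : ℝ)| |(k : ℝ)|) ≤ |disp g b n - disp g b k| := by
  have hc := gapConst_pos hg hb
  have main : ∀ n k : ℤ, |k| < |n| →
      gapConst g b * √(max |(n : ℝ)| |(k : ℝ)|) ≤ |disp g b n - disp g b k| := by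
    intro n k h
    have h1 := gapConst_mul_le_disp_sub hg hb (abs_nonneg k) h
    have h2 : |(k : ℝ)| + 1 ≤ |(n : ℝ)| := by exact_mod_cast h
    rw [disp_abs, disp_abs] at h1
    push_cast at h1
    rw [max_eq_left (by linarith)]
    refine le_trans ?_ (h1.trans (le_abs_self _))
    have : √|(n : ℝ)| ≤ (|(n : ℝ)| - |(k : ℝ)|) * √|(n : ℝ)| := by
      have := sqrt_nonneg |(n : ℝ)|
      nlinarith
    gcongr
  rcases lt_or_gt_of_ne h with h | h
  · rw [max_comm, abs_sub_comm]; exact main k n h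
  · exact main n k h

theorem disp_eq_disp_iff {g b : ℝ} (hg : 0 < g) (hb : 0 < b) {n k : ℤ} :
    disp g b n = disp g b k ↔ |n| = |k| := by
  constructor
  · intro h
    by_contra hne
    have h1 := gapConst_mul_sqrt_le_abs_disp_sub hg hb hne
    rw [h, sub_self, abs_zero] at h1
    have h2 : (1 : ℝ) ≤ max |(n : ℝ)| |(k : ℝ)| := by
      apply one_le_max_abs
      by_contra hcon
      push Not at hcon
      simp [hcon.1, hcon.2] at hne
    have h3 : 0 < √(max |(n : ℝ)| |(k : ℝ)|) := sqrt_pos.2 (by linarith)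
    have := mul_pos (gapConst_pos hg hb) h3
    linarith
  · intro h
    rw [← disp_abs g b n, h, disp_abs]

theorem gapConst_mul_max_le_disp_add {g b : ℝ} (hg : 0 < g) (hb : 0 < b) (n k : ℤ) :
    gapConst g b * (max |(n : ℝ)| |(k : ℝ)| * √(max |(n : ℝ)| |(k : ℝ)|)) ≤
      disp g b n + disp g b k := by
  have single : ∀ n : ℤ, gapConst g b * (|(n : ℝ)| * √|(n : ℝ)|) ≤ disp g b n := by
    intro n
    rcases eq_or_ne n 0 with rfl | hn
    · simp [disp_zero]
    · have := gapConst_mul_le_disp_sub hg hb le_rfl (abs_pos.2 hn)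
      rw [disp_zero, disp_abs] at this
      push_cast at this
      simpa using this
  rcases max_choice |(n : ℝ)| |(k : ℝ)| with h | h <;> rw [h]
  · linarith [single n, disp_nonneg g b k]
  · linarith [single k, disp_nonneg g b n]

/-- The inverse of `ℓ(n) - ℓ(k)`, read as `0` on the resonant set `|n| = |k|`. -/
def invDiff (g b : ℝ) (n k : ℤ) : ℝ := (disp g b n - disp g b k)⁻¹

/-- The inverse of `ℓ(n) + ℓ(k)`, read as `0` at `n = k = 0`. -/
def invSum (g b : ℝ) (n k : ℤ) : ℝ := (disp g b n + disp g b k)⁻¹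

theorem abs_invDiff_mul_le {g b : ℝ} (hg : 0 < g) (hb : 0 < b) (n k : ℤ) :
    |invDiff g b n k| * √(max |(n : ℝ)| |(k : ℝ)|) ≤ (gapConst g b)⁻¹ := by
  have hc := gapConst_pos hg hb
  by_cases h : |n| = |k|
  · rw [invDiff, (disp_eq_disp_iff hg hb).2 h]
    simp [hc.le]
  · have h1 := gapConst_mul_sqrt_le_abs_disp_sub hg hb h
    have h2 : 0 < |disp g b n - disp g b k| := by
      rw [abs_pos, sub_ne_zero, Ne, disp_eq_disp_iff hg hb]; exact h
    rw [invDiff, abs_inv, inv_mul_le_iff₀ h2, le_mul_inv_iff₀ hc]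
    linarith

theorem abs_invSum_mul_le {g b : ℝ} (hg : 0 < g) (hb : 0 < b) (n k : ℤ) :
    |invSum g b n k| * (max |(n : ℝ)| |(k : ℝ)| * √(max |(n : ℝ)| |(k : ℝ)|)) ≤
      (gapConst g b)⁻¹ := by
  have hc := gapConst_pos hg hb
  have h1 := gapConst_mul_max_le_disp_add hg hb n k
  rcases (add_nonneg (disp_nonneg g b n) (disp_nonneg g b k)).eq_or_lt with h | h
  · rw [invSum, ← h]; simp [hc.le]
  · rw [invSum, abs_inv, abs_of_pos h, inv_mul_le_iff₀ h]
    rw [le_mul_inv_iff₀ hc]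
    linarith

theorem abs_invDiff_le {g b : ℝ} (hg : 0 < g) (hb : 0 < b) (n k : ℤ) :
    |invDiff g b n k| ≤ (gapConst g b)⁻¹ := by
  have hc := gapConst_pos hg hb
  by_cases h : n ≠ 0 ∨ k ≠ 0
  · have h1 := abs_invDiff_mul_le hg hb n k
    have h2 : 1 ≤ √(max |(n : ℝ)| |(k : ℝ)|) := by
      rw [Real.one_le_sqrt]; exact one_le_max_abs h
    nlinarith [abs_nonneg (invDiff g b n k)]
  · push Not at h
    simp [invDiff, h.1, h.2, hc.le]

theorem abs_invSum_mul_max_le {g b : ℝ} (hg : 0 < g) (hb : 0 < b) (n k : ℤ) :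
    |invSum g b n k| * max 1 (max |(n : ℝ)| |(k : ℝ)|) ≤ (gapConst g b)⁻¹ := by
  have hc := gapConst_pos hg hb
  by_cases h : n ≠ 0 ∨ k ≠ 0
  · have h1 := abs_invSum_mul_le hg hb n k
    have h3 := one_le_max_abs h
    have h2 : 1 ≤ √(max |(n : ℝ)| |(k : ℝ)|) := by
      rw [Real.one_le_sqrt]; exact h3
    rw [max_eq_right h3]
    have : 0 ≤ |invSum g b n k| * max |(n : ℝ)| |(k : ℝ)| := by positivity
    nlinarith
  · push Not at h
    simp [invSum, h.1, h.2, hc.le, disp_zero]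

theorem abs_invSum_le {g b : ℝ} (hg : 0 < g) (hb : 0 < b) (n k : ℤ) :
    |invSum g b n k| ≤ (gapConst g b)⁻¹ := by
  have h1 := abs_invSum_mul_max_le hg hb n k
  have h2 := le_max_left 1 (max |(n : ℝ)| |(k : ℝ)|)
  nlinarith [abs_nonneg (invSum g b n k)]

/-- The commutator of `W ∂ₓ` with the Fourier kernel `1 / (ℓ(n) + ℓ(k))` is bounded, as the
kernel gains more than one derivative. -/
theorem abs_bracket_invSum_le {g b : ℝ} (hg : 0 < g) (hb : 0 < b) (q k p : ℤ) :
    |((k : ℝ) + p + q) * invSum g b (k + q) k - k * invSum g b (k + p + q) (k + p)| ≤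
      2 * (gapConst g b)⁻¹ * (1 + |(p : ℝ)|) := by
  have h1 := abs_invSum_mul_max_le hg hb (k + q) k
  have h2 := abs_invSum_mul_max_le hg hb (k + p + q) (k + p)
  set A := |invSum g b (k + q) k| with hA
  set B := |invSum g b (k + p + q) (k + p)| with hB
  have hA0 : 0 ≤ A := abs_nonneg _
  have hB0 : 0 ≤ B := abs_nonneg _
  have e1 : A * 1 ≤ (gapConst g b)⁻¹ :=
    le_trans (mul_le_mul_of_nonneg_left (le_max_left _ _) hA0) h1
  have e2 : A * |(k : ℝ) + q| ≤ (gapConst g b)⁻¹ := by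
    refine le_trans (mul_le_mul_of_nonneg_left ?_ hA0) h1
    push_cast
    exact le_max_of_le_right (le_max_left _ _)
  have e3 : B * 1 ≤ (gapConst g b)⁻¹ :=
    le_trans (mul_le_mul_of_nonneg_left (le_max_left _ _) hB0) h2
  have e4 : B * |(k : ℝ) + p| ≤ (gapConst g b)⁻¹ := by
    refine le_trans (mul_le_mul_of_nonneg_left ?_ hB0) h2
    push_cast
    exact le_max_of_le_right (le_max_right _ _)
  have t1 : |(k : ℝ) + p + q| ≤ |(k : ℝ) + q| + |(p : ℝ)| := by
    have := abs_add_le ((k : ℝ) + q) p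
    rwa [show (k : ℝ) + q + p = k + p + q by ring] at this
  have t2 : |(k : ℝ)| ≤ |(k : ℝ) + p| + |(p : ℝ)| := by
    have := abs_sub ((k : ℝ) + p) p
    simpa using this
  have p0 := abs_nonneg (p : ℝ)
  calc _ ≤ |((k : ℝ) + p + q) * invSum g b (k + q) k| + |k * invSum g b (k + p + q) (k + p)| :=
        abs_sub _ _
    _ = |(k : ℝ) + p + q| * A + |(k : ℝ)| * B := by rw [abs_mul, abs_mul]
    _ ≤ (|(k : ℝ) + q| + |(p : ℝ)|) * A + (|(k : ℝ) + p| + |(p : ℝ)|) * B := by gcongr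
    _ ≤ _ := by nlinarith

set_option maxHeartbeats 800000 in
/-- The commutator of `W ∂ₓ` with the Fourier kernel `1 / (ℓ(n) - ℓ(k))`, restricted to a band
`|n - k| ≤ D`, is bounded: the kernel has order `-1/2`, and its variation along the diagonal is
a second difference of `ℓ`. -/
theorem exists_abs_bracket_invDiff_le {g b : ℝ} (hg : 0 < g) (hb : 0 < b) (D : ℕ) :
    ∃ C : ℝ, 0 ≤ C ∧ ∀ q k p : ℤ, |q| ≤ D →
    |((k : ℝ) + p + q) * invDiff g b (k + q) k - k * invDiff g b (k + p + q) (k + p)| ≤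
      C * (1 + |(p : ℝ)|) := by
  have hc := gapConst_pos hg hb
  set c := gapConst g b with hcdef
  set C₁ : ℝ := g + 1 / b ^ 2 with hC₁
  have hC₁0 : 0 ≤ C₁ := by positivity
  set C : ℝ := c⁻¹ * (5 * (D + 1)) + 2 * (c ^ 2)⁻¹ * (3 / 2 * D + 4 * C₁) with hC
  have hC0 : 0 ≤ C := by positivity
  have hD0 : (0 : ℝ) ≤ D := by positivity
  have pos : ∀ q k p : ℤ, |q| ≤ D → 0 ≤ k →
      |((k : ℝ) + p + q) * invDiff g b (k + q) k - k * invDiff g b (k + p + q) (k + p)| ≤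
      C * (1 + |(p : ℝ)|) := by
    intro q k p hq hk
    have p0 := abs_nonneg (p : ℝ)
    have hqD : |(q : ℝ)| ≤ D := by exact_mod_cast hq
    have hk0 : (0 : ℝ) ≤ k := by exact_mod_cast hk
    have hcinv : 0 < c⁻¹ := by positivity
    have b1 := abs_invDiff_le hg hb (k + q) k
    have b2 := abs_invDiff_le hg hb (k + p + q) (k + p)
    rw [← hcdef] at b1 b2
    -- when `k` is at most of the size of `p`, the boundedness of the kernel suffices
    rcases lt_or_ge (k : ℝ) (2 * (D + |(p : ℝ)| + 1)) with hlow | hhigh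
    · have t1 : |(k : ℝ) + p + q| ≤ k + |(p : ℝ)| + D := by
        calc _ ≤ |(k : ℝ)| + |(p : ℝ)| + |(q : ℝ)| := abs_add_three _ _ _
          _ ≤ _ := by rw [abs_of_nonneg hk0]; gcongr
      calc _ ≤ |((k : ℝ) + p + q) * invDiff g b (k + q) k| +
            |k * invDiff g b (k + p + q) (k + p)| := abs_sub _ _
        _ ≤ (k + |(p : ℝ)| + D) * c⁻¹ + k * c⁻¹ := by
            rw [abs_mul, abs_mul, abs_of_nonneg hk0]; gcongr
        _ = (2 * k + |(p : ℝ)| + D) * c⁻¹ := by ring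
        _ ≤ (5 * (D + 1) * (1 + |(p : ℝ)|)) * c⁻¹ := by
            apply mul_le_mul_of_nonneg_right _ hcinv.le
            nlinarith [mul_nonneg hD0 p0]
        _ = c⁻¹ * (5 * (D + 1)) * (1 + |(p : ℝ)|) := by ring
        _ ≤ C * (1 + |(p : ℝ)|) := by
            apply mul_le_mul_of_nonneg_right _ (by linarith)
            rw [hC]
            have : 0 ≤ 2 * (c ^ 2)⁻¹ * (3 / 2 * D + 4 * C₁) := by positivity
            linarith
    · -- for `q = 0` the kernel vanishes, by the convention `0⁻¹ = 0`
      rcases eq_or_ne q 0 with rfl | hq0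
      · simp only [add_zero, invDiff, sub_self, inv_zero, mul_zero, abs_zero]
        positivity
      have pl := (abs_le.1 (le_refl |(p : ℝ)|)).1
      have ql := (abs_le.1 hqD).1
      have pu := (abs_le.1 (le_refl |(p : ℝ)|)).2
      have qu := (abs_le.1 hqD).2
      have hk1 : (1 : ℝ) ≤ k := by linarith
      have hkp : (1 : ℝ) ≤ k + p := by linarith
      have hkq : (1 : ℝ) ≤ k + q := by linarith
      have hkpq : (1 : ℝ) ≤ k + p + q := by linarith
      have zk : (1 : ℤ) ≤ k := by exact_mod_cast hk1
      have zkp : (1 : ℤ) ≤ k + p := by exact_mod_cast hkp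
      have zkq : (1 : ℤ) ≤ k + q := by exact_mod_cast hkq
      have zkpq : (1 : ℤ) ≤ k + p + q := by exact_mod_cast hkpq
      have ne0 : |k + q| ≠ |k| := by
        rw [abs_of_pos (by omega), abs_of_pos (by omega)]; omega
      have nep : |k + p + q| ≠ |k + p| := by
        rw [abs_of_pos (by omega), abs_of_pos (by omega)]; omega
      have g0 := gapConst_mul_sqrt_le_abs_disp_sub hg hb ne0
      have gp := gapConst_mul_sqrt_le_abs_disp_sub hg hb nep
      set Δ₀ := disp g b (k + q) - disp g b k with hΔ₀
      set Δp := disp g b (k + p + q) - disp g b (k + p) with hΔp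
      rw [← hcdef] at g0 gp
      have g0' : c * √(k / 2) ≤ |Δ₀| := by
        refine le_trans ?_ g0
        gcongr
        exact le_trans (by linarith) (le_trans (le_abs_self _) (le_max_right _ _))
      have gp' : c * √(k / 2) ≤ |Δp| := by
        refine le_trans ?_ gp
        gcongr
        refine le_trans ?_ (le_trans (le_abs_self _) (le_max_right _ _))
        push_cast
        linarith
      have hs0 : 0 < √((k : ℝ) / 2) := sqrt_pos.2 (by linarith)
      have hΔ₀ne : Δ₀ ≠ 0 := by
        rw [← abs_pos]; exact lt_of_lt_of_le (by positivity) g0'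
      have hΔpne : Δp ≠ 0 := by
        rw [← abs_pos]; exact lt_of_lt_of_le (by positivity) gp'
      have hprod : c ^ 2 * (k / 2) ≤ |Δ₀| * |Δp| := by
        have e : c ^ 2 * ((k : ℝ) / 2) = (c * √(k / 2)) * (c * √(k / 2)) := by
          have := Real.mul_self_sqrt (show (0 : ℝ) ≤ k / 2 by linarith)
          linear_combination (-c ^ 2) * this
        rw [e]
        gcongr
      have hsec : |Δp - Δ₀| ≤ 3 / 2 * |(p : ℝ)| * D + 4 * C₁ := by
        have a1 := abs_le.1 (abs_ell_sub_le hg hb _ hk1)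
        have a2 := abs_le.1 (abs_ell_sub_le hg hb _ hkp)
        have a3 := abs_le.1 (abs_ell_sub_le hg hb _ hkq)
        have a4 := abs_le.1 (abs_ell_sub_le hg hb _ hkpq)
        have a5 := abs_le.1 (abs_second_diff_mul_sqrt_le hk1 hkp hkq hkpq)
        have a6 : 3 / 2 * |(p : ℝ)| * |(q : ℝ)| ≤ 3 / 2 * |(p : ℝ)| * D := by gcongr
        simp only [hΔ₀, hΔp, disp]
        push_cast
        rw [← hC₁] at a1 a2 a3 a4
        rw [abs_le]
        constructor <;> linarith [a1.1, a1.2, a2.1, a2.2, a3.1, a3.2, a4.1, a4.2, a5.1, a5.2]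
      -- the variation of the kernel is a second difference over the product of two gaps,
      -- and this product is of order `k`
      have hid : ((k : ℝ) + p + q) * invDiff g b (k + q) k -
          k * invDiff g b (k + p + q) (k + p) =
          (p + q) * invDiff g b (k + q) k + k * ((Δp - Δ₀) / (Δ₀ * Δp)) := by
        simp only [invDiff, ← hΔ₀, ← hΔp]
        field_simp
        ring
      rw [hid]
      have hfirst : |((p : ℝ) + q) * invDiff g b (k + q) k| ≤ (|(p : ℝ)| + D) * c⁻¹ := by
        rw [abs_mul]
        gcongr
        exact (abs_add_le _ _).trans (by linarith)
      have hsecond : |(k : ℝ) * ((Δp - Δ₀) / (Δ₀ * Δp))| ≤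
          2 * (c ^ 2)⁻¹ * (3 / 2 * |(p : ℝ)| * D + 4 * C₁) := by
        rw [abs_mul, abs_div, abs_mul, abs_of_nonneg hk0]
        have hpos : 0 < |Δ₀| * |Δp| := lt_of_lt_of_le (by positivity) hprod
        rw [← mul_div_assoc, div_le_iff₀ hpos]
        calc (k : ℝ) * |Δp - Δ₀| ≤ k * (3 / 2 * |(p : ℝ)| * D + 4 * C₁) := by gcongr
          _ = 2 * (c ^ 2)⁻¹ * (3 / 2 * |(p : ℝ)| * D + 4 * C₁) * (c ^ 2 * (k / 2)) := by
              field_simp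
          _ ≤ _ := by gcongr
      calc _ ≤ _ := abs_add_le _ _
        _ ≤ (|(p : ℝ)| + D) * c⁻¹ + 2 * (c ^ 2)⁻¹ * (3 / 2 * |(p : ℝ)| * D + 4 * C₁) :=
            add_le_add hfirst hsecond
        _ ≤ (5 * (D + 1) * (1 + |(p : ℝ)|)) * c⁻¹ +
            2 * (c ^ 2)⁻¹ * ((3 / 2 * D + 4 * C₁) * (1 + |(p : ℝ)|)) := by
            refine add_le_add (mul_le_mul_of_nonneg_right ?_ hcinv.le)
              (mul_le_mul_of_nonneg_left ?_ (by positivity))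
            · linarith [mul_nonneg hD0 p0]
            · linarith [mul_nonneg hC₁0 p0]
        _ = C * (1 + |(p : ℝ)|) := by rw [hC]; ring
  refine ⟨C, hC0, fun q k p hq => ?_⟩
  rcases le_total 0 k with hk | hk
  · exact pos q k p hq hk
  · have h := pos (-q) (-k) (-p) (by rwa [abs_neg]) (by omega)
    have sym : ∀ x y : ℤ, invDiff g b (-x) (-y) = invDiff g b x y := by
      intro x y; simp [invDiff, disp_neg]
    rw [show -k + -q = -(k + q) by ring, show -k + -p + -q = -(k + p + q) by ring,
      show -k + -p = -(k + p) by ring, sym, sym] at h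
    push_cast at h
    rw [abs_neg, ← abs_neg] at h
    convert h using 2
    ring

/-- The kernel `1 / (ℓ(n) - ℓ(k))` decays. -/
theorem exists_abs_invDiff_le {g b : ℝ} (hg : 0 < g) (hb : 0 < b) {η : ℝ} (hη : 0 < η) :
    ∃ N : ℕ, ∀ n k : ℤ, (N : ℤ) ≤ |k| → |invDiff g b n k| ≤ η := by
  have hc := gapConst_pos hg hb
  obtain ⟨N, hN⟩ := exists_nat_ge (((gapConst g b)⁻¹ / η) ^ 2 + 1)
  refine ⟨N, fun n k hk => ?_⟩
  have h1 := abs_invDiff_mul_le hg hb n k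
  have h2 : (N : ℝ) ≤ |(k : ℝ)| := by exact_mod_cast hk
  have h3 : (gapConst g b)⁻¹ / η ≤ √(max |(n : ℝ)| |(k : ℝ)|) := by
    apply Real.le_sqrt_of_sq_le
    exact le_trans (by linarith) (le_max_right _ _)
  have h5 : 0 < (gapConst g b)⁻¹ / η := by positivity
  have h4 : |invDiff g b n k| * ((gapConst g b)⁻¹ / η) ≤ η * ((gapConst g b)⁻¹ / η) := by
    calc _ ≤ |invDiff g b n k| * √(max |(n : ℝ)| |(k : ℝ)|) := by gcongr
      _ ≤ _ := h1
      _ = _ := by field_simp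
  exact le_of_mul_le_mul_right h4 h5

/-- The kernel `1 / (ℓ(n) + ℓ(k))` decays. -/
theorem exists_abs_invSum_le {g b : ℝ} (hg : 0 < g) (hb : 0 < b) {η : ℝ} (hη : 0 < η) :
    ∃ N : ℕ, ∀ n k : ℤ, (N : ℤ) ≤ |k| → |invSum g b n k| ≤ η := by
  have hc := gapConst_pos hg hb
  obtain ⟨N, hN⟩ := exists_nat_ge ((gapConst g b)⁻¹ / η)
  refine ⟨N, fun n k hk => ?_⟩
  have h1 := abs_invSum_mul_max_le hg hb n k
  have h2 : (N : ℝ) ≤ |(k : ℝ)| := by exact_mod_cast hk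
  have h3 : (gapConst g b)⁻¹ / η ≤ max 1 (max |(n : ℝ)| |(k : ℝ)|) :=
    le_trans (by linarith) (le_max_of_le_right (le_max_right _ _))
  have h5 : 0 < (gapConst g b)⁻¹ / η := by positivity
  have h4 : |invSum g b n k| * ((gapConst g b)⁻¹ / η) ≤ η * ((gapConst g b)⁻¹ / η) := by
    calc _ ≤ |invSum g b n k| * max 1 (max |(n : ℝ)| |(k : ℝ)|) := by gcongr
      _ ≤ _ := h1
      _ = _ := by field_simp
  exact le_of_mul_le_mul_right h4 h5

/-! ### Transport on the side of Fourier coefficients -/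

/-- The Fourier coefficients of `W ∂ₓ v`, where `W` and `v` have coefficients `u` and `v`. -/
def transport (u v : ℤ → ℂ) (n : ℤ) : ℂ := ∑' k : ℤ, u (n - k) * (Complex.I * k * v k)

theorem transport_eq_sum {u v : ℤ → ℂ} {F : Finset ℤ} (hv : ∀ n ∉ F, v n = 0) (n : ℤ) :
    transport u v n = ∑ k ∈ F, u (n - k) * (Complex.I * k * v k) := by
  apply tsum_eq_sum
  intro k hk
  simp [hv k hk]

theorem sum_shift_le_tsum {κ : ℤ → ℝ} (h0 : ∀ p, 0 ≤ κ p) (hs : Summable κ) (F : Finset ℤ)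
    (q : ℤ) : ∑ n ∈ F, κ (n - q) ≤ ∑' p, κ p := by
  have h := (Equiv.subRight q).summable_iff.2 hs
  have e := (Equiv.subRight q).tsum_eq κ
  rw [← e]
  exact h.sum_le_tsum F (fun i _ => h0 _)

theorem sum_const_sub_le_tsum {κ : ℤ → ℝ} (h0 : ∀ p, 0 ≤ κ p) (hs : Summable κ) (F : Finset ℤ)
    (q : ℤ) : ∑ n ∈ F, κ (q - n) ≤ ∑' p, κ p := by
  have h := (Equiv.subLeft q).summable_iff.2 hs
  have e := (Equiv.subLeft q).tsum_eq κ
  rw [← e]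
  exact h.sum_le_tsum F (fun i _ => h0 _)

/-- Schur's bound for a convolution kernel. -/
theorem schur_sum_le {κ : ℤ → ℝ} (h0 : ∀ p, 0 ≤ κ p) (hs : Summable κ) (F G : Finset ℤ)
    (x y : ℤ → ℝ) (q : ℤ) :
    ∑ n ∈ F, ∑ j ∈ G, κ (n - q - j) * (x n * y j) ≤
      (∑' p, κ p) / 2 * (∑ n ∈ F, x n ^ 2 + ∑ j ∈ G, y j ^ 2) := by
  have h1 : ∑ n ∈ F, ∑ j ∈ G, κ (n - q - j) * (x n * y j) ≤
      ∑ n ∈ F, ∑ j ∈ G, (κ (n - q - j) * (x n ^ 2 / 2) + κ (n - q - j) * (y j ^ 2 / 2)) := by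
    gcongr with n _ j _
    rw [← mul_add]
    apply mul_le_mul_of_nonneg_left _ (h0 _)
    nlinarith [sq_nonneg (x n - y j)]
  refine h1.trans ?_
  simp only [Finset.sum_add_distrib]
  have h2 : ∑ n ∈ F, ∑ j ∈ G, κ (n - q - j) * (x n ^ 2 / 2) ≤
      ∑ n ∈ F, (∑' p, κ p) * (x n ^ 2 / 2) := by
    gcongr with n _
    rw [← Finset.sum_mul]
    exact mul_le_mul_of_nonneg_right (sum_const_sub_le_tsum h0 hs G (n - q)) (by positivity)
  have h3 : ∑ n ∈ F, ∑ j ∈ G, κ (n - q - j) * (y j ^ 2 / 2) ≤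
      ∑ j ∈ G, (∑' p, κ p) * (y j ^ 2 / 2) := by
    rw [Finset.sum_comm]
    gcongr with j _
    rw [← Finset.sum_mul]
    refine mul_le_mul_of_nonneg_right ?_ (by positivity)
    have := sum_shift_le_tsum h0 hs F (q + j)
    simpa [sub_sub] using this
  rw [← Finset.mul_sum, ← Finset.sum_div] at h2 h3
  linarith

theorem sum_mul_shift {F : Finset ℤ} {a c : ℤ → ℂ} (ha : ∀ n ∉ F, a n = 0)
    (hc : ∀ n ∉ F, c n = 0) (q : ℤ) :
    ∑ k ∈ F, a k * c (k + q) = ∑ n ∈ F, a (n - q) * c n := by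
  have h1 : ∑' k, a k * c (k + q) = ∑ k ∈ F, a k * c (k + q) :=
    tsum_eq_sum (fun k hk => by simp [ha k hk])
  have h2 : ∑' n, a (n - q) * c n = ∑ n ∈ F, a (n - q) * c n :=
    tsum_eq_sum (fun k hk => by simp [hc k hk])
  rw [← h1, ← h2, ← (Equiv.addRight q).tsum_eq (fun n => a (n - q) * c n)]
  simp

/-- The commutator of `W ∂ₓ` with a Fourier kernel `m`, living on the `q`-th diagonal, is bounded
in `ℓ²` as soon as the differences of `n m` along this diagonal are bounded. -/
theorem norm_commutator_le {κ : ℤ → ℝ} {u : ℤ → ℂ} {ε : ℝ} (h0 : ∀ p, 0 ≤ κ p) (hs : Summable κ)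
    (hu : ∀ p : ℤ, (1 + |(p : ℝ)|) * ‖u p‖ ≤ ε * κ p) (hherm : ∀ p, u (-p) = conj (u p))
    {m : ℤ → ℂ} {q : ℤ} {C : ℝ} (hC : 0 ≤ C)
    (hm : ∀ k p : ℤ, ‖((k : ℂ) + p + q) * m k - k * m (k + p)‖ ≤ C * (1 + |(p : ℝ)|))
    {F : Finset ℤ} {v z : ℤ → ℂ} (hv : ∀ n ∉ F, v n = 0) (hz : ∀ n ∉ F, z n = 0)
    (hε : 0 ≤ ε) :
    ‖∑ n ∈ F, m (n - q) * transport u v (n - q) * conj (z n) +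
      ∑ j ∈ F, m j * v j * conj (transport u z (j + q))‖ ≤
    C * ε * ((∑' p, κ p) / 2) * (∑ n ∈ F, ‖v n‖ ^ 2 + ∑ n ∈ F, ‖z n‖ ^ 2) := by
  have e1 : ∑ n ∈ F, m (n - q) * transport u v (n - q) * conj (z n) =
      ∑ n ∈ F, ∑ j ∈ F, m (n - q) * (u (n - q - j) * (Complex.I * j * v j)) * conj (z n) := by
    refine Finset.sum_congr rfl fun n _ => ?_
    rw [transport_eq_sum hv, Finset.mul_sum, Finset.sum_mul]
  have e2 : ∑ j ∈ F, m j * v j * conj (transport u z (j + q)) =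
      ∑ n ∈ F, ∑ j ∈ F, -(m j * v j * (u (n - q - j) * (Complex.I * n * conj (z n)))) := by
    rw [Finset.sum_comm]
    refine Finset.sum_congr rfl fun j _ => ?_
    rw [transport_eq_sum hz, map_sum, Finset.mul_sum]
    refine Finset.sum_congr rfl fun n _ => ?_
    have : conj (u (j + q - n)) = u (n - q - j) := by
      rw [← hherm]; congr 1; ring
    simp only [map_mul, this, Complex.conj_I, map_intCast]
    ring
  rw [e1, e2, ← Finset.sum_add_distrib]
  simp only [← Finset.sum_add_distrib]
  -- `u` being hermitian, both sums run over the same products `u v conj z`, and the weights combine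
  have key : ∀ n j : ℤ, ‖m (n - q) * (u (n - q - j) * (Complex.I * j * v j)) * conj (z n) +
      -(m j * v j * (u (n - q - j) * (Complex.I * n * conj (z n))))‖ ≤
      C * ε * (κ (n - q - j) * (‖z n‖ * ‖v j‖)) := by
    intro n j
    have e : m (n - q) * (u (n - q - j) * (Complex.I * j * v j)) * conj (z n) +
      -(m j * v j * (u (n - q - j) * (Complex.I * n * conj (z n)))) =
      -(Complex.I * u (n - q - j) * (v j * conj (z n)) *
        (((j : ℂ) + (n - q - j : ℤ) + q) * m j - j * m (j + (n - q - j)))) := by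
      have : j + (n - q - j) = n - q := by ring
      rw [this]
      push_cast
      ring
    rw [e, norm_neg, norm_mul, norm_mul, norm_mul, norm_mul, Complex.norm_I, one_mul,
      RCLike.norm_conj]
    calc ‖u (n - q - j)‖ * (‖v j‖ * ‖z n‖) * _
        ≤ ‖u (n - q - j)‖ * (‖v j‖ * ‖z n‖) * (C * (1 + |((n - q - j : ℤ) : ℝ)|)) := by
          gcongr; exact hm j _
      _ = C * (‖v j‖ * ‖z n‖) * ((1 + |((n - q - j : ℤ) : ℝ)|) * ‖u (n - q - j)‖) := by ring
      _ ≤ C * (‖v j‖ * ‖z n‖) * (ε * κ (n - q - j)) :=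
          mul_le_mul_of_nonneg_left (hu _) (by positivity)
      _ = _ := by ring
  calc _ ≤ ∑ n ∈ F, ∑ j ∈ F, C * ε * (κ (n - q - j) * (‖z n‖ * ‖v j‖)) :=
        norm_sum_le_of_le _ fun n _ => norm_sum_le_of_le _ fun j _ => key n j
    _ = C * ε * ∑ n ∈ F, ∑ j ∈ F, κ (n - q - j) * (‖z n‖ * ‖v j‖) := by
        simp only [Finset.mul_sum]
    _ ≤ C * ε * ((∑' p, κ p) / 2 * (∑ n ∈ F, ‖z n‖ ^ 2 + ∑ j ∈ F, ‖v j‖ ^ 2)) := by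
        gcongr
        exact schur_sum_le h0 hs F F _ _ q
    _ = _ := by rw [Finset.sum_add_distrib]; ring

/-- A sequence which is small in `ℓ²`, tested against the ball of radius `√B` only. -/
def PairsSmall (B δ : ℝ) (f : ℤ → ℂ) : Prop :=
  ∀ (F : Finset ℤ) (x : ℤ → ℝ), (∀ n, 0 ≤ x n) → ∑ n ∈ F, x n ^ 2 ≤ B →
    ∑ n ∈ F, ‖f n‖ * x n ≤ δ * B

/-- The rate of change of `∑ₖ m(k) v(k) conj z(k + q)`, for trigonometric polynomials `v` and `z`
which solve transport equations with dispersion relations `ℓ₁` and `ℓ₂`, up to a bounded error. -/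
theorem norm_rate_sub_le {κ : ℤ → ℝ} {u : ℤ → ℂ} {ε : ℝ} (h0 : ∀ p, 0 ≤ κ p) (hs : Summable κ)
    (hu : ∀ p : ℤ, (1 + |(p : ℝ)|) * ‖u p‖ ≤ ε * κ p) (hherm : ∀ p, u (-p) = conj (u p))
    {m : ℤ → ℂ} {q : ℤ} {C C' : ℝ} (hC : 0 ≤ C)
    (hm : ∀ k p : ℤ, ‖((k : ℂ) + p + q) * m k - k * m (k + p)‖ ≤ C * (1 + |(p : ℝ)|))
    (hC' : 0 ≤ C') (hm' : ∀ k, ‖m k‖ ≤ C')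
    {F : Finset ℤ} {v z v' z' f h : ℤ → ℂ} (hv : ∀ n ∉ F, v n = 0) (hz : ∀ n ∉ F, z n = 0)
    (hv' : ∀ n ∉ F, v' n = 0) (hε : 0 ≤ ε) {ℓ₁ ℓ₂ : ℤ → ℝ}
    (hve : ∀ n, v' n = -(transport u v n + Complex.I * ℓ₁ n * v n + f n))
    (hze : ∀ n, z' n = -(transport u z n + Complex.I * ℓ₂ n * z n + h n))
    {B δ : ℝ} (hf : PairsSmall B δ f) (hh : PairsSmall B δ h)
    (hvB : ∑ n ∈ F, ‖v n‖ ^ 2 ≤ B) (hzB : ∑ n ∈ F, ‖z n‖ ^ 2 ≤ B) :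
    ‖∑ k ∈ F, m k * (v' k * conj (z (k + q)) + v k * conj (z' (k + q))) -
      Complex.I * ∑ k ∈ F, m k * (ℓ₂ (k + q) - ℓ₁ k) * (v k * conj (z (k + q)))‖ ≤
    (C * (∑' p, κ p) * ε + 2 * C' * δ) * B := by
  have hS : 0 ≤ ∑' p, κ p := tsum_nonneg h0
  have hcz : ∀ n ∉ F, conj (z n) = 0 := fun n hn => by rw [hz n hn, map_zero]
  have s1 : ∑ k ∈ F, m k * v' k * conj (z (k + q)) = ∑ n ∈ F, m (n - q) * v' (n - q) * conj (z n) :=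
    sum_mul_shift (a := fun k => m k * v' k) (c := fun k => conj (z k))
      (fun n hn => by simp [hv' n hn]) hcz q
  have s2 : ∑ k ∈ F, m k * ℓ₁ k * v k * conj (z (k + q)) =
      ∑ n ∈ F, m (n - q) * ℓ₁ (n - q) * v (n - q) * conj (z n) :=
    sum_mul_shift (a := fun k => m k * ℓ₁ k * v k) (c := fun k => conj (z k))
      (fun n hn => by simp [hv n hn]) hcz q
  have split : ∑ k ∈ F, m k * (v' k * conj (z (k + q)) + v k * conj (z' (k + q))) -
      Complex.I * ∑ k ∈ F, m k * (ℓ₂ (k + q) - ℓ₁ k) * (v k * conj (z (k + q))) =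
      -(∑ n ∈ F, m (n - q) * transport u v (n - q) * conj (z n) +
        ∑ j ∈ F, m j * v j * conj (transport u z (j + q))) -
      ∑ n ∈ F, m (n - q) * f (n - q) * conj (z n) - ∑ j ∈ F, m j * v j * conj (h (j + q)) := by
    have t1 : ∑ k ∈ F, m k * (v' k * conj (z (k + q)) + v k * conj (z' (k + q))) =
        ∑ n ∈ F, m (n - q) * v' (n - q) * conj (z n) + ∑ k ∈ F, m k * v k * conj (z' (k + q)) := by
      rw [← s1, ← Finset.sum_add_distrib]
      exact Finset.sum_congr rfl fun k _ => by ring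
    have t2 : ∑ k ∈ F, m k * (ℓ₂ (k + q) - ℓ₁ k) * (v k * conj (z (k + q))) =
        ∑ k ∈ F, m k * ℓ₂ (k + q) * (v k * conj (z (k + q))) -
          ∑ n ∈ F, m (n - q) * ℓ₁ (n - q) * v (n - q) * conj (z n) := by
      rw [← s2, ← Finset.sum_sub_distrib]
      exact Finset.sum_congr rfl fun k _ => by ring
    rw [t1, t2, mul_sub, Finset.mul_sum, Finset.mul_sum, ← Finset.sum_add_distrib,
      ← Finset.sum_add_distrib, ← Finset.sum_sub_distrib, ← Finset.sum_sub_distrib,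
      ← Finset.sum_neg_distrib, ← Finset.sum_sub_distrib, ← Finset.sum_sub_distrib]
    refine Finset.sum_congr rfl fun k _ => ?_
    rw [hve, hze]
    simp only [map_neg, map_add, map_mul, Complex.conj_I, Complex.conj_ofReal]
    ring
  rw [split]
  have c1 := norm_commutator_le h0 hs hu hherm hC hm hv hz hε
  have c2 : ‖∑ n ∈ F, m (n - q) * f (n - q) * conj (z n)‖ ≤ C' * (δ * B) := by
    calc _ ≤ ∑ n ∈ F, C' * (‖f (n - q)‖ * ‖z n‖) := by
          refine norm_sum_le_of_le _ fun n _ => ?_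
          rw [norm_mul, norm_mul, RCLike.norm_conj, mul_assoc]
          gcongr
          exact hm' _
      _ = C' * ∑ n ∈ F, ‖f (n - q)‖ * ‖z n‖ := by rw [Finset.mul_sum]
      _ ≤ C' * (δ * B) := by
          gcongr
          have := hf (F.map (Equiv.subRight q).toEmbedding) (fun k => ‖z (k + q)‖)
            (fun _ => norm_nonneg _) (by simpa using hzB)
          simpa using this
  have c3 : ‖∑ j ∈ F, m j * v j * conj (h (j + q))‖ ≤ C' * (δ * B) := by
    calc _ ≤ ∑ n ∈ F, C' * (‖h (n + q)‖ * ‖v n‖) := by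
          refine norm_sum_le_of_le _ fun n _ => ?_
          rw [norm_mul, norm_mul, RCLike.norm_conj, mul_assoc, mul_comm ‖v n‖]
          gcongr
          exact hm' _
      _ = C' * ∑ n ∈ F, ‖h (n + q)‖ * ‖v n‖ := by rw [Finset.mul_sum]
      _ ≤ C' * (δ * B) := by
          gcongr
          have := hh (F.map (Equiv.addRight q).toEmbedding) (fun k => ‖v (k - q)‖)
            (fun _ => norm_nonneg _) (by simpa using hvB)
          simpa using this
  have c4 : C * ε * ((∑' p, κ p) / 2) * (∑ n ∈ F, ‖v n‖ ^ 2 + ∑ n ∈ F, ‖z n‖ ^ 2) ≤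
      C * ε * ((∑' p, κ p) / 2) * (B + B) := by gcongr
  calc _ ≤ _ := norm_sub_le _ _
    _ ≤ _ := add_le_add (norm_sub_le _ _) le_rfl
    _ ≤ C * ε * ((∑' p, κ p) / 2) * (B + B) + C' * (δ * B) + C' * (δ * B) := by
        rw [norm_neg]
        gcongr
        exact c1.trans c4
    _ = _ := by ring

/-! ### Truncation in frequency -/

/-- The tent-shaped cutoff `max (1 - |n| / N) 0`. -/
def tent (N : ℕ) (n : ℤ) : ℝ := max (1 - |(n : ℝ)| / N) 0

theorem tent_nonneg (N : ℕ) (n : ℤ) : 0 ≤ tent N n := le_max_right _ _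

theorem tent_le_one (N : ℕ) (n : ℤ) : tent N n ≤ 1 := by
  apply max_le _ zero_le_one
  have : 0 ≤ |(n : ℝ)| / N := by positivity
  linarith

theorem tent_eq_zero {N : ℕ} (hN : 0 < N) {n : ℤ} (hn : n ∉ Finset.Icc (-(N : ℤ)) N) :
    tent N n = 0 := by
  have h1 : (N : ℤ) ≤ |n| := by
    by_contra hcon
    push Not at hcon
    exact hn (Finset.mem_Icc.2 ⟨(abs_lt.1 hcon).1.le, (abs_lt.1 hcon).2.le⟩)
  have h2 : (N : ℝ) ≤ |(n : ℝ)| := by exact_mod_cast h1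
  have h3 : (0 : ℝ) < N := by exact_mod_cast hN
  have : 1 ≤ |(n : ℝ)| / N := by rwa [le_div_iff₀ h3, one_mul]
  exact max_eq_right (by linarith)

theorem tendsto_tent (n : ℤ) :
    Filter.Tendsto (fun N : ℕ => tent N n) Filter.atTop (nhds 1) := by
  have h1 : Filter.Tendsto (fun N : ℕ => 1 - |(n : ℝ)| / N) Filter.atTop (nhds (1 - 0)) :=
    tendsto_const_nhds.sub (tendsto_const_div_atTop_nhds_zero_nat _)
  have h2 := h1.max (tendsto_const_nhds (x := (0 : ℝ)))
  simpa [tent] using h2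

/-- The commutator of the cutoff with `∂ₓ` is bounded uniformly in `N`. -/
theorem abs_tent_sub_mul_le {N : ℕ} (hN : 0 < N) (n j : ℤ) :
    |tent N n - tent N j| * |(j : ℝ)| ≤ 2 * |(n : ℝ) - j| := by
  have h3 : (0 : ℝ) < N := by exact_mod_cast hN
  have lip : |tent N n - tent N j| ≤ |(n : ℝ) - j| / N := by
    calc |tent N n - tent N j| ≤ |(1 - |(n : ℝ)| / N) - (1 - |(j : ℝ)| / N)| :=
          abs_max_sub_max_le_abs _ _ _
      _ = |(|(n : ℝ)| - |(j : ℝ)|)| / N := by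
          rw [show (1 - |(n : ℝ)| / N) - (1 - |(j : ℝ)| / N) = -((|(n : ℝ)| - |(j : ℝ)|) / N) by
            ring, abs_neg, abs_div, abs_of_pos h3]
      _ ≤ _ := div_le_div_of_nonneg_right (abs_abs_sub_abs_le (n : ℝ) j) h3.le
  rcases le_or_gt |(j : ℝ)| (2 * N) with h | h
  · calc _ ≤ |(n : ℝ) - j| / N * (2 * N) := by gcongr
      _ = _ := by field_simp
  · -- now `tent N j = 0`, and either `tent N n = 0` too or `|n - j| ≥ |j| / 2`
    have tz : ∀ i : ℤ, (N : ℝ) < |(i : ℝ)| → tent N i = 0 := by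
      intro i hi
      have : 1 ≤ |(i : ℝ)| / N := by rw [le_div_iff₀ h3]; linarith
      exact max_eq_right (by linarith)
    have hj := tz j (by linarith)
    rcases le_or_gt |(n : ℝ)| N with hn | hn
    · rw [hj, sub_zero, abs_of_nonneg (tent_nonneg _ _)]
      have h4 : |(j : ℝ)| - |(n : ℝ)| ≤ |(n : ℝ) - j| := by
        rw [abs_sub_comm]; exact abs_sub_abs_le_abs_sub _ _
      have h5 := tent_le_one N n
      have h6 := abs_nonneg (j : ℝ)
      nlinarith
    · rw [hj, tz n hn]
      simp

theorem summable_conv_of_bounded {κ : ℤ → ℝ} (h0 : ∀ p, 0 ≤ κ p) (hs : Summable κ) {y : ℤ → ℝ}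
    {M : ℝ} (hy0 : ∀ n, 0 ≤ y n) (hy : ∀ n, y n ≤ M) (n : ℤ) :
    Summable fun j => κ (n - j) * y j := by
  have h := ((Equiv.subLeft n).summable_iff.2 hs).mul_right M
  refine Summable.of_nonneg_of_le (fun j => mul_nonneg (h0 _) (hy0 _)) (fun j => ?_) h
  exact mul_le_mul_of_nonneg_left (hy j) (h0 _)

theorem tsum_conv_le_of_bounded {κ : ℤ → ℝ} (h0 : ∀ p, 0 ≤ κ p) (hs : Summable κ) {y : ℤ → ℝ}
    {M : ℝ} (hy0 : ∀ n, 0 ≤ y n) (hy : ∀ n, y n ≤ M) (n : ℤ) :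
    ∑' j, κ (n - j) * y j ≤ (∑' p, κ p) * M := by
  have h := ((Equiv.subLeft n).summable_iff.2 hs).mul_right M
  have e := (Equiv.subLeft n).tsum_eq κ
  calc ∑' j, κ (n - j) * y j ≤ ∑' j, κ (n - j) * M := by
        refine (summable_conv_of_bounded h0 hs hy0 hy n).tsum_le_tsum (fun j => ?_) h
        exact mul_le_mul_of_nonneg_left (hy j) (h0 _)
    _ = (∑' p, κ p) * M := by rw [tsum_mul_right]; rw [← e]; rfl

theorem norm_le_sqrt_of_tsum_sq_le {a : ℤ → ℂ} (ha : Summable fun n => ‖a n‖ ^ 2) {B : ℝ}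
    (hB : ∑' n, ‖a n‖ ^ 2 ≤ B) (n : ℤ) : ‖a n‖ ≤ √B := by
  apply Real.le_sqrt_of_sq_le
  exact (ha.le_tsum n fun _ _ => by positivity).trans hB

/-- Schur's bound against an infinite sequence. -/
theorem sum_mul_tsum_conv_le {κ : ℤ → ℝ} (h0 : ∀ p, 0 ≤ κ p) (hs : Summable κ) {y : ℤ → ℝ}
    (hy0 : ∀ n, 0 ≤ y n) (hy : Summable fun n => y n ^ 2) {B : ℝ} (hB : ∑' n, y n ^ 2 ≤ B)
    (F : Finset ℤ) (x : ℤ → ℝ) (hxB : ∑ n ∈ F, x n ^ 2 ≤ B) :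
    ∑ n ∈ F, (∑' j, κ (n - j) * y j) * x n ≤ (∑' p, κ p) * B := by
  have hyM : ∀ n, y n ≤ √B := fun n => by
    apply Real.le_sqrt_of_sq_le
    exact (hy.le_tsum n fun _ _ => by positivity).trans hB
  have hsum : ∀ n, Summable fun j => κ (n - j) * y j := summable_conv_of_bounded h0 hs hy0 hyM
  have hS : 0 ≤ ∑' p, κ p := tsum_nonneg h0
  have e : ∑ n ∈ F, (∑' j, κ (n - j) * y j) * x n =
      ∑' j, ∑ n ∈ F, κ (n - j) * y j * x n := by
    rw [Summable.tsum_finsetSum fun n _ => (hsum n).mul_right _]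
    exact Finset.sum_congr rfl fun n _ => by rw [tsum_mul_right]
  rw [e]
  have hsum2 : Summable fun j => ∑ n ∈ F, κ (n - j) * y j * x n :=
    summable_sum fun n _ => (hsum n).mul_right _
  refine hsum2.tsum_le_of_sum_le fun G => ?_
  have := schur_sum_le h0 hs F G x y 0
  rw [Finset.sum_comm]
  simp only [sub_zero] at this
  calc ∑ n ∈ F, ∑ j ∈ G, κ (n - j) * y j * x n =
        ∑ n ∈ F, ∑ j ∈ G, κ (n - j) * (x n * y j) :=
        Finset.sum_congr rfl fun n _ => Finset.sum_congr rfl fun j _ => by ring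
    _ ≤ _ := this
    _ ≤ (∑' p, κ p) / 2 * (B + B) := by
        gcongr
        exact (hy.sum_le_tsum G fun _ _ => by positivity).trans hB
    _ = _ := by ring

/-- The derivative on `v` is shifted to `u` and to the weight `1 + |n|`. -/
theorem summable_transport {κ : ℤ → ℝ} {u : ℤ → ℂ} {ε : ℝ} (hε : 0 ≤ ε)
    (h0 : ∀ p, 0 ≤ κ p) (hs : Summable κ)
    (hu : ∀ p : ℤ, (1 + |(p : ℝ)|) * ‖u p‖ ≤ ε * κ p) {a : ℤ → ℂ} {M : ℝ}
    (ha : ∀ n, ‖a n‖ ≤ M) (n : ℤ) :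
    Summable (fun k : ℤ => u (n - k) * (Complex.I * k * a k)) ∧
    ‖transport u a n‖ ≤ (1 + |(n : ℝ)|) * (ε * ((∑' p, κ p) * M)) := by
  have hb : ∀ k : ℤ, ‖u (n - k) * (Complex.I * k * a k)‖ ≤
      (1 + |(n : ℝ)|) * (ε * (κ (n - k) * ‖a k‖)) := by
    intro k
    have h1 : |(k : ℝ)| ≤ (1 + |(n : ℝ)|) * (1 + |((n - k : ℤ) : ℝ)|) := by
      have := abs_sub (n : ℝ) (n - k)
      push_cast
      rw [sub_sub_cancel] at this
      nlinarith [abs_nonneg (n : ℝ), abs_nonneg ((n : ℝ) - k)]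
    rw [norm_mul, norm_mul, norm_mul, Complex.norm_I, one_mul, Complex.norm_intCast]
    calc ‖u (n - k)‖ * (|(k : ℝ)| * ‖a k‖)
        ≤ ‖u (n - k)‖ * ((1 + |(n : ℝ)|) * (1 + |((n - k : ℤ) : ℝ)|) * ‖a k‖) := by gcongr
      _ = (1 + |(n : ℝ)|) * ‖a k‖ * ((1 + |((n - k : ℤ) : ℝ)|) * ‖u (n - k)‖) := by ring
      _ ≤ (1 + |(n : ℝ)|) * ‖a k‖ * (ε * κ (n - k)) :=
          mul_le_mul_of_nonneg_left (hu _) (by positivity)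
      _ = _ := by ring
  have hsum := ((summable_conv_of_bounded h0 hs (fun k => norm_nonneg (a k)) ha n).mul_left
    ε).mul_left (1 + |(n : ℝ)|)
  refine ⟨Summable.of_norm_bounded hsum hb, ?_⟩
  refine (tsum_of_norm_bounded hsum.hasSum hb).trans ?_
  rw [tsum_mul_left, tsum_mul_left]
  gcongr
  exact tsum_conv_le_of_bounded h0 hs (fun k => norm_nonneg (a k)) ha n

/-- Truncating a solution with the tent-shaped cutoff leaves an error which is bounded in `ℓ²`,
uniformly in `N`. -/
theorem pairsSmall_truncation {κ : ℤ → ℝ} {u : ℤ → ℂ} {ε : ℝ} (hε : 0 < ε) (h0 : ∀ p, 0 ≤ κ p)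
    (hs : Summable κ) (hu : ∀ p : ℤ, (1 + |(p : ℝ)|) * ‖u p‖ ≤ ε * κ p) {a r : ℤ → ℂ} {B : ℝ}
    (ha : Summable fun n => ‖a n‖ ^ 2) (hB : ∑' n, ‖a n‖ ^ 2 ≤ B)
    (hr : Summable fun n => ‖r n‖ ^ 2) (hrB : ∑' n, ‖r n‖ ^ 2 ≤ ε ^ 2 * B) {N : ℕ} (hN : 0 < N) :
    PairsSmall B (ε * (2 * (∑' p, κ p) + 1)) fun n =>
      tent N n * (transport u a n + r n) - transport u (fun k => tent N k * a k) n := by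
  intro F x hx hxB
  have haM := norm_le_sqrt_of_tsum_sq_le ha hB
  have pt : ∀ n, ‖tent N n * (transport u a n + r n) - transport u (fun k => tent N k * a k) n‖ ≤
      2 * ε * (∑' j, κ (n - j) * ‖a j‖) + ‖r n‖ := by
    intro n
    have s1 := (summable_transport hε.le h0 hs hu haM n).1
    have htM : ∀ k, ‖(tent N k : ℂ) * a k‖ ≤ √B := by
      intro k
      rw [norm_mul, Complex.norm_real, Real.norm_of_nonneg (tent_nonneg _ _)]
      exact (mul_le_of_le_one_left (norm_nonneg _) (tent_le_one _ _)).trans (haM k)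
    have s2 := (summable_transport hε.le h0 hs hu htM n).1
    have e : tent N n * (transport u a n + r n) - transport u (fun k => tent N k * a k) n =
        (∑' k : ℤ, u (n - k) * (Complex.I * ((tent N n - tent N k : ℝ) * k) * a k)) +
          tent N n * r n := by
      have : ∑' k : ℤ, u (n - k) * (Complex.I * ((tent N n - tent N k : ℝ) * k) * a k) =
          tent N n * transport u a n - transport u (fun k => tent N k * a k) n := by
        unfold transport
        rw [← tsum_mul_left, ← (s1.mul_left _).tsum_sub s2]
        refine tsum_congr fun k => ?_
        push_cast
        ring
      rw [this]; ring
    rw [e]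
    refine (norm_add_le _ _).trans (add_le_add ?_ ?_)
    · have hsum := (summable_conv_of_bounded h0 hs (fun k => norm_nonneg (a k)) haM n).mul_left
        (2 * ε)
      rw [← tsum_mul_left]
      refine tsum_of_norm_bounded hsum.hasSum fun k => ?_
      have h1 := abs_tent_sub_mul_le hN n k
      rw [norm_mul, norm_mul, norm_mul, norm_mul, Complex.norm_I, one_mul, Complex.norm_intCast,
        Complex.norm_real, Real.norm_eq_abs]
      have h2 := hu (n - k)
      push_cast at h2
      calc ‖u (n - k)‖ * (|tent N n - tent N k| * |(k : ℝ)| * ‖a k‖)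
          ≤ ‖u (n - k)‖ * (2 * |(n : ℝ) - k| * ‖a k‖) := by gcongr
        _ ≤ 2 * ‖a k‖ * ((1 + |(n : ℝ) - k|) * ‖u (n - k)‖) := by
            have : 0 ≤ ‖a k‖ * ‖u (n - k)‖ := by positivity
            nlinarith
        _ ≤ 2 * ‖a k‖ * (ε * κ (n - k)) := by gcongr
        _ = _ := by ring
    · rw [norm_mul, Complex.norm_real, Real.norm_of_nonneg (tent_nonneg _ _)]
      exact mul_le_of_le_one_left (norm_nonneg _) (tent_le_one _ _)
  have hmain := sum_mul_tsum_conv_le h0 hs (fun k => norm_nonneg (a k)) ha hB F x hxB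
  have hrest : ∑ n ∈ F, ‖r n‖ * x n ≤ ε * B := by
    have h1 : ∀ n, ‖r n‖ * x n ≤ ‖r n‖ ^ 2 / (2 * ε) + ε / 2 * x n ^ 2 := by
      intro n
      have h := two_mul_le_add_sq (‖r n‖) (ε * x n)
      have : ‖r n‖ ^ 2 / (2 * ε) + ε / 2 * x n ^ 2 - ‖r n‖ * x n =
        (‖r n‖ ^ 2 + (ε * x n) ^ 2 - 2 * ‖r n‖ * (ε * x n)) / (2 * ε) := by
        field_simp
      have h2 : 0 ≤ (‖r n‖ ^ 2 + (ε * x n) ^ 2 - 2 * ‖r n‖ * (ε * x n)) / (2 * ε) :=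
        div_nonneg (by linarith) (by positivity)
      linarith
    calc ∑ n ∈ F, ‖r n‖ * x n ≤ ∑ n ∈ F, (‖r n‖ ^ 2 / (2 * ε) + ε / 2 * x n ^ 2) :=
          Finset.sum_le_sum fun n _ => h1 n
      _ = (∑ n ∈ F, ‖r n‖ ^ 2) / (2 * ε) + ε / 2 * ∑ n ∈ F, x n ^ 2 := by
          rw [Finset.sum_add_distrib, Finset.sum_div, Finset.mul_sum]
      _ ≤ (ε ^ 2 * B) / (2 * ε) + ε / 2 * B := by
          gcongr
          exact (hr.sum_le_tsum F fun _ _ => by positivity).trans hrB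
      _ = ε * B := by field_simp; ring
  calc ∑ n ∈ F, _ * x n ≤ ∑ n ∈ F, (2 * ε * (∑' j, κ (n - j) * ‖a j‖) + ‖r n‖) * x n := by
        gcongr with n _
        · exact hx n
        · exact pt n
    _ = 2 * ε * ∑ n ∈ F, (∑' j, κ (n - j) * ‖a j‖) * x n + ∑ n ∈ F, ‖r n‖ * x n := by
        rw [Finset.mul_sum, ← Finset.sum_add_distrib]
        exact Finset.sum_congr rfl fun n _ => by ring
    _ ≤ 2 * ε * ((∑' p, κ p) * B) + ε * B := by gcongr
    _ = _ := by ring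

/-! ### Sesquilinear forms on a diagonal -/

/-- The sesquilinear form `∑ₖ m(k) v(k) conj z(k + q)`. -/
def diagForm (m : ℤ → ℂ) (q : ℤ) (v z : ℤ → ℂ) : ℂ := ∑' k, m k * (v k * conj (z (k + q)))

theorem summable_sq_shift {z : ℤ → ℂ} (hz : Summable fun n => ‖z n‖ ^ 2) (q : ℤ) :
    Summable (fun n => ‖z (n + q)‖ ^ 2) ∧ ∑' n, ‖z (n + q)‖ ^ 2 = ∑' n, ‖z n‖ ^ 2 :=
  ⟨(Equiv.addRight q).summable_iff.2 hz, (Equiv.addRight q).tsum_eq fun n => ‖z n‖ ^ 2⟩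

theorem norm_diagForm_term_le {m : ℤ → ℂ} {C : ℝ} (hm : ∀ k, ‖m k‖ ≤ C) (q : ℤ) (v z : ℤ → ℂ)
    (k : ℤ) : ‖m k * (v k * conj (z (k + q)))‖ ≤ C * ((‖v k‖ ^ 2 + ‖z (k + q)‖ ^ 2) / 2) := by
  have hC : 0 ≤ C := (norm_nonneg _).trans (hm k)
  rw [norm_mul, norm_mul, RCLike.norm_conj]
  have := two_mul_le_add_sq ‖v k‖ ‖z (k + q)‖
  gcongr
  · exact hm k
  · linarith

theorem summable_diagForm_bound {v z : ℤ → ℂ} (hv : Summable fun n => ‖v n‖ ^ 2)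
    (hz : Summable fun n => ‖z n‖ ^ 2) (C : ℝ) (q : ℤ) :
    Summable fun k => C * ((‖v k‖ ^ 2 + ‖z (k + q)‖ ^ 2) / 2) :=
  ((hv.add (summable_sq_shift hz q).1).div_const 2).mul_left C

theorem summable_diagForm {m : ℤ → ℂ} {C : ℝ} (hm : ∀ k, ‖m k‖ ≤ C) (q : ℤ) {v z : ℤ → ℂ}
    (hv : Summable fun n => ‖v n‖ ^ 2) (hz : Summable fun n => ‖z n‖ ^ 2) :
    Summable fun k => m k * (v k * conj (z (k + q))) :=
  Summable.of_norm_bounded (summable_diagForm_bound hv hz C q) (norm_diagForm_term_le hm q v z)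

theorem norm_diagForm_le {m : ℤ → ℂ} {C : ℝ} (hm : ∀ k, ‖m k‖ ≤ C) (q : ℤ) {v z : ℤ → ℂ} {B : ℝ}
    (hv : Summable fun n => ‖v n‖ ^ 2) (hz : Summable fun n => ‖z n‖ ^ 2)
    (hvB : ∑' n, ‖v n‖ ^ 2 ≤ B) (hzB : ∑' n, ‖z n‖ ^ 2 ≤ B) :
    ‖diagForm m q v z‖ ≤ C * B := by
  have hC : 0 ≤ C := (norm_nonneg _).trans (hm 0)
  have h := summable_sq_shift hz q
  refine (tsum_of_norm_bounded (summable_diagForm_bound hv hz C q).hasSum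
    (norm_diagForm_term_le hm q v z)).trans ?_
  rw [tsum_mul_left, tsum_div_const, hv.tsum_add h.1, h.2]
  gcongr
  linarith

theorem norm_tent_mul_le (N : ℕ) (v : ℤ → ℂ) (n : ℤ) : ‖(tent N n : ℂ) * v n‖ ≤ ‖v n‖ := by
  rw [norm_mul, Complex.norm_real, Real.norm_of_nonneg (tent_nonneg _ _)]
  exact mul_le_of_le_one_left (norm_nonneg _) (tent_le_one _ _)

theorem summable_tent_mul {v : ℤ → ℂ} (hv : Summable fun n => ‖v n‖ ^ 2) (N : ℕ) :
    Summable fun n => ‖(tent N n : ℂ) * v n‖ ^ 2 :=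
  Summable.of_nonneg_of_le (fun _ => by positivity)
    (fun n => by gcongr; exact norm_tent_mul_le N v n) hv

theorem tendsto_diagForm_tent {m : ℤ → ℂ} {C : ℝ} (hm : ∀ k, ‖m k‖ ≤ C) (q : ℤ) {v z : ℤ → ℂ}
    (hv : Summable fun n => ‖v n‖ ^ 2) (hz : Summable fun n => ‖z n‖ ^ 2) :
    Filter.Tendsto (fun N : ℕ => diagForm m q (fun k => tent N k * v k) fun k => tent N k * z k)
      Filter.atTop (nhds (diagForm m q v z)) := by
  refine tendsto_tsum_of_dominated_convergence (summable_diagForm_bound hv hz C q) ?_ ?_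
  · intro k
    have h1 : ∀ n, Filter.Tendsto (fun N : ℕ => (tent N n : ℂ)) Filter.atTop (nhds 1) := by
      intro n
      have := (Complex.continuous_ofReal.tendsto 1).comp (tendsto_tent n)
      simpa [Function.comp_def] using this
    have h2 := (h1 k).mul_const (v k)
    have h3 := (h1 (k + q)).mul_const (z (k + q))
    rw [one_mul] at h2 h3
    have h4 : Filter.Tendsto (fun N : ℕ => conj ((tent N (k + q) : ℂ) * z (k + q))) Filter.atTop
        (nhds (conj (z (k + q)))) := (Complex.continuous_conj.tendsto _).comp h3
    exact (h2.mul h4).const_mul (m k)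
  · refine Filter.Eventually.of_forall fun N k => ?_
    refine (norm_diagForm_term_le hm q (fun k => tent N k * v k) (fun k => tent N k * z k)
      k).trans ?_
    have hC : 0 ≤ C := (norm_nonneg _).trans (hm k)
    have e1 := norm_tent_mul_le N v k
    have e2 := norm_tent_mul_le N z (k + q)
    have e3 := pow_le_pow_left₀ (norm_nonneg _) e1 2
    have e4 := pow_le_pow_left₀ (norm_nonneg _) e2 2
    exact mul_le_mul_of_nonneg_left (by linarith) hC

/-! ### Evolution of the Fourier coefficients -/

/-- The coefficients `a(t)` solve `∂ₜw + W ∂ₓw + iℓ(D)w + r = 0` on `[0, T]`, where the coefficients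
`u` of the real function `W` satisfy `(1 + |p|) |u(p)| ≤ ε κ(p)`, while `‖a‖² ≤ B` and
`‖r‖² ≤ ε² B` in `ℓ²`. -/
structure IsEvolution (κ : ℤ → ℝ) (ε B T : ℝ) (ℓ : ℤ → ℝ) (u r a : ℝ → ℤ → ℂ) : Prop where
  u_le : ∀ t ∈ Icc 0 T, ∀ p : ℤ, (1 + |(p : ℝ)|) * ‖u t p‖ ≤ ε * κ p
  u_neg : ∀ t ∈ Icc 0 T, ∀ p, u t (-p) = conj (u t p)
  summable_r : ∀ t ∈ Icc 0 T, Summable fun n => ‖r t n‖ ^ 2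
  r_le : ∀ t ∈ Icc 0 T, ∑' n, ‖r t n‖ ^ 2 ≤ ε ^ 2 * B
  summable_a : ∀ t ∈ Icc 0 T, Summable fun n => ‖a t n‖ ^ 2
  a_le : ∀ t ∈ Icc 0 T, ∑' n, ‖a t n‖ ^ 2 ≤ B
  deriv : ∀ n : ℤ, ∀ t ∈ Icc 0 T, HasDerivWithinAt (fun τ => a τ n)
    (-(transport (u t) (a t) n + Complex.I * ℓ n * a t n + r t n)) (Icc 0 T) t

theorem IsEvolution.continuousOn {κ : ℤ → ℝ} {ε B T : ℝ} {ℓ : ℤ → ℝ} {u r a : ℝ → ℤ → ℂ}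
    (h : IsEvolution κ ε B T ℓ u r a) (n : ℤ) : ContinuousOn (fun t => a t n) (Icc 0 T) :=
  fun t ht => (h.deriv n t ht).continuousWithinAt

theorem transport_conj {u a : ℤ → ℂ} (hu : ∀ p, u (-p) = conj (u p)) (n : ℤ) :
    transport u (fun k => conj (a (-k))) n = conj (transport u a (-n)) := by
  unfold transport
  rw [Complex.conj_tsum, ← (Equiv.neg ℤ).tsum_eq]
  refine tsum_congr fun k => ?_
  simp only [Equiv.neg_apply, map_mul, Complex.conj_I, map_intCast, ← hu]
  push_cast
  rw [show -(-n - k) = n - -k by ring]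
  ring_nf

/-- The complex conjugate of a solution solves the conjugate equation. -/
theorem IsEvolution.conj {κ : ℤ → ℝ} {ε B T : ℝ} {ℓ : ℤ → ℝ} {u r a : ℝ → ℤ → ℂ}
    (h : IsEvolution κ ε B T ℓ u r a) (hℓ : ∀ n, ℓ (-n) = ℓ n) :
    IsEvolution κ ε B T (fun n => -ℓ n) u (fun t n => conj (r t (-n)))
      (fun t n => conj (a t (-n))) where
  u_le := h.u_le
  u_neg := h.u_neg
  summable_r t ht := by
    have := (Equiv.neg ℤ).summable_iff.2 (h.summable_r t ht)
    simpa [Function.comp_def] using this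
  r_le t ht := by
    have e : ∑' n, ‖r t (-n)‖ ^ 2 = ∑' n, ‖r t n‖ ^ 2 :=
      (Equiv.neg ℤ).tsum_eq fun n => ‖r t n‖ ^ 2
    simp only [RCLike.norm_conj]
    rw [e]
    exact h.r_le t ht
  summable_a t ht := by
    have := (Equiv.neg ℤ).summable_iff.2 (h.summable_a t ht)
    simpa [Function.comp_def] using this
  a_le t ht := by
    have e : ∑' n, ‖a t (-n)‖ ^ 2 = ∑' n, ‖a t n‖ ^ 2 :=
      (Equiv.neg ℤ).tsum_eq fun n => ‖a t n‖ ^ 2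
    simp only [RCLike.norm_conj]
    rw [e]
    exact h.a_le t ht
  deriv n t ht := by
    have := (h.deriv (-n) t ht).star
    refine this.congr_deriv ?_
    rw [transport_conj (h.u_neg t ht), ← starRingEnd_apply]
    simp only [map_neg, map_add, map_mul, Complex.conj_I, Complex.conj_ofReal, hℓ]
    push_cast
    ring

theorem hasDerivWithinAt_integral_of_continuousOn {φ : ℝ → ℂ} {T : ℝ}
    (hφ : ContinuousOn φ (Icc 0 T)) {t : ℝ} (ht : t ∈ Icc 0 T) :
    HasDerivWithinAt (fun s => ∫ x in (0 : ℝ)..s, φ x) (φ t) (Icc 0 T) t := by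
  have hT : (0 : ℝ) ≤ T := ht.1.trans ht.2
  have hc : Continuous (IccExtend hT ((Icc 0 T).domRestrict φ)) :=
    (continuousOn_iff_continuous_domRestrict.1 hφ).Icc_extend'
  have h1 : HasDerivWithinAt (fun s => ∫ x in (0 : ℝ)..s, IccExtend hT ((Icc 0 T).domRestrict φ) x)
      (IccExtend hT ((Icc 0 T).domRestrict φ) t) (Icc 0 T) t :=
    (hc.integral_hasStrictDerivAt 0 t).hasDerivAt.hasDerivWithinAt
  have e : ∀ s ∈ Icc 0 T, IccExtend hT ((Icc 0 T).domRestrict φ) s = φ s := by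
    intro s hs
    rw [IccExtend_of_mem hT _ hs]
    rfl
  rw [e t ht] at h1
  refine h1.congr ?_ ?_
  · intro s hs
    refine intervalIntegral.integral_congr fun x hx => ?_
    rw [uIcc_of_le hs.1] at hx
    exact (e x ⟨hx.1, hx.2.trans hs.2⟩).symm
  · refine intervalIntegral.integral_congr fun x hx => ?_
    rw [uIcc_of_le ht.1] at hx
    exact (e x ⟨hx.1, hx.2.trans ht.2⟩).symm

section

variable {κ : ℤ → ℝ} {ε B T : ℝ} {ℓ₁ ℓ₂ : ℤ → ℝ} {u r s a b : ℝ → ℤ → ℂ} {m : ℤ → ℂ} {q : ℤ}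
  {C C' : ℝ}

theorem diagForm_tent_eq_sum (m : ℤ → ℂ) (q : ℤ) (v z : ℤ → ℂ) {N : ℕ} (hN : 0 < N) :
    diagForm m q (fun k => tent N k * v k) (fun k => tent N k * z k) =
      ∑ k ∈ Finset.Icc (-(N : ℤ)) N,
        m k * ((tent N k * v k) * conj ((tent N (k + q) : ℂ) * z (k + q))) := by
  apply tsum_eq_sum
  intro k hk
  simp [tent_eq_zero hN hk]

theorem continuousOn_diagForm_tent (ha : IsEvolution κ ε B T ℓ₁ u r a)
    (hb : IsEvolution κ ε B T ℓ₂ u s b) (m : ℤ → ℂ) (q : ℤ) {N : ℕ} (hN : 0 < N) :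
    ContinuousOn (fun x => diagForm m q (fun k => tent N k * a x k) (fun k => tent N k * b x k))
      (Icc 0 T) := by
  simp only [diagForm_tent_eq_sum m q _ _ hN]
  refine continuousOn_finsetSum _ fun k _ => ?_
  refine continuousOn_const.mul (ContinuousOn.mul ?_ ?_)
  · exact continuousOn_const.mul (ha.continuousOn k)
  · exact Complex.continuous_conj.comp_continuousOn
      (continuousOn_const.mul (hb.continuousOn (k + q)))

theorem norm_diagForm_tent_le (ha : IsEvolution κ ε B T ℓ₁ u r a)
    (hb : IsEvolution κ ε B T ℓ₂ u s b) (hm : ∀ k, ‖m k‖ ≤ C) (N : ℕ) {x : ℝ}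
    (hx : x ∈ Icc 0 T) :
    ‖diagForm m q (fun k => tent N k * a x k) (fun k => tent N k * b x k)‖ ≤ C * B := by
  have aux : ∀ v : ℤ → ℂ, (Summable fun n => ‖v n‖ ^ 2) → ∑' n, ‖v n‖ ^ 2 ≤ B →
      ∑' n, ‖(tent N n : ℂ) * v n‖ ^ 2 ≤ B := by
    intro v hv hvB
    refine le_trans ((summable_tent_mul hv N).tsum_le_tsum (fun n => ?_) hv) hvB
    gcongr
    exact norm_tent_mul_le _ _ _
  exact norm_diagForm_le hm q (summable_tent_mul (ha.summable_a x hx) N)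
    (summable_tent_mul (hb.summable_a x hx) N) (aux _ (ha.summable_a x hx) (ha.a_le x hx))
    (aux _ (hb.summable_a x hx) (hb.a_le x hx))

theorem intervalIntegrable_diagForm (ha : IsEvolution κ ε B T ℓ₁ u r a)
    (hb : IsEvolution κ ε B T ℓ₂ u s b) (hm : ∀ k, ‖m k‖ ≤ C) (q : ℤ) (hT : 0 ≤ T) :
    IntervalIntegrable (fun x => diagForm m q (a x) (b x)) volume 0 T := by
  rw [intervalIntegrable_iff_integrableOn_Ioc_of_le hT]
  refine Integrable.of_bound (C := C * B) ?_ ?_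
  · refine aestronglyMeasurable_of_tendsto_ae Filter.atTop (f := fun (N : ℕ) x =>
      diagForm m q (fun k => tent (N + 1) k * a x k) (fun k => tent (N + 1) k * b x k)) ?_ ?_
    · intro N
      exact ((continuousOn_diagForm_tent ha hb m q N.succ_pos).mono
        Ioc_subset_Icc_self).aestronglyMeasurable measurableSet_Ioc
    · filter_upwards [ae_restrict_mem measurableSet_Ioc] with x hx
      have hx' := Ioc_subset_Icc_self hx
      exact (tendsto_diagForm_tent hm q (ha.summable_a x hx') (hb.summable_a x hx')).comp
        (Filter.tendsto_add_atTop_nat 1)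
  · filter_upwards [ae_restrict_mem measurableSet_Ioc] with x hx
    have hx' := Ioc_subset_Icc_self hx
    exact norm_diagForm_le hm q (ha.summable_a x hx') (hb.summable_a x hx') (ha.a_le x hx')
      (hb.a_le x hx')

/-- The normal form identity for solutions truncated in frequency. -/
theorem norm_diagForm_tent_sub_le (h0 : ∀ p, 0 ≤ κ p) (hs : Summable κ) (hε : 0 < ε)
    (ha : IsEvolution κ ε B T ℓ₁ u r a) (hb : IsEvolution κ ε B T ℓ₂ u s b) (hC : 0 ≤ C)
    (hm : ∀ k p : ℤ, ‖((k : ℂ) + p + q) * m k - k * m (k + p)‖ ≤ C * (1 + |(p : ℝ)|))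
    (hC' : 0 ≤ C') (hm' : ∀ k, ‖m k‖ ≤ C') {N : ℕ} (hN : 0 < N) {t : ℝ} (ht : t ∈ Icc 0 T) :
    ‖diagForm m q (fun k => tent N k * a t k) (fun k => tent N k * b t k) -
      diagForm m q (fun k => tent N k * a 0 k) (fun k => tent N k * b 0 k) -
      Complex.I * ∫ x in (0 : ℝ)..t, diagForm (fun k => m k * (ℓ₂ (k + q) - ℓ₁ k)) q
        (fun k => tent N k * a x k) (fun k => tent N k * b x k)‖ ≤
    (C * (∑' p, κ p) + 2 * C' * (2 * (∑' p, κ p) + 1)) * ε * B * T := by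
  set F : Finset ℤ := Finset.Icc (-(N : ℤ)) N with hF
  have hS : 0 ≤ ∑' p, κ p := tsum_nonneg h0
  have hsupp : ∀ (v : ℤ → ℂ), ∀ n ∉ F, (tent N n : ℂ) * v n = 0 := by
    intro v n hn
    rw [tent_eq_zero hN hn]; simp
  have hcont := continuousOn_diagForm_tent ha hb (fun k => m k * (ℓ₂ (k + q) - ℓ₁ k)) q hN
  simp only [diagForm_tent_eq_sum _ _ _ _ hN, ← hF] at hcont ⊢
  have hda : ∀ x ∈ Icc 0 T, ∀ k, HasDerivWithinAt (fun y => (tent N k : ℂ) * a y k)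
      ((tent N k : ℂ) * -(transport (u x) (a x) k + Complex.I * ℓ₁ k * a x k + r x k))
      (Icc 0 T) x := fun x hx k => (ha.deriv k x hx).const_mul _
  have hdb : ∀ x ∈ Icc 0 T, ∀ k, HasDerivWithinAt (fun y => (tent N k : ℂ) * b y k)
      ((tent N k : ℂ) * -(transport (u x) (b x) k + Complex.I * ℓ₂ k * b x k + s x k))
      (Icc 0 T) x := fun x hx k => (hb.deriv k x hx).const_mul _
  have hT : (0 : ℝ) ≤ T := ht.1.trans ht.2
  -- the mean value inequality for `G` needs no regularity of the transport term in time
  set G : ℝ → ℂ := fun y => (∑ k ∈ F, m k * ((tent N k * a y k) *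
      conj ((tent N (k + q) : ℂ) * b y (k + q)))) -
    Complex.I * ∫ x in (0 : ℝ)..y, ∑ k ∈ F, m k * (ℓ₂ (k + q) - ℓ₁ k) *
      ((tent N k * a x k) * conj ((tent N (k + q) : ℂ) * b x (k + q))) with hG
  set a' : ℝ → ℤ → ℂ := fun x k =>
    (tent N k : ℂ) * -(transport (u x) (a x) k + Complex.I * ℓ₁ k * a x k + r x k) with ha'
  set b' : ℝ → ℤ → ℂ := fun x k =>
    (tent N k : ℂ) * -(transport (u x) (b x) k + Complex.I * ℓ₂ k * b x k + s x k) with hb'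
  have hGd : ∀ x ∈ Icc 0 T, HasDerivWithinAt G
      ((∑ k ∈ F, m k * (a' x k * conj ((tent N (k + q) : ℂ) * b x (k + q)) +
        (tent N k * a x k) * conj (b' x (k + q)))) -
      Complex.I * ∑ k ∈ F, m k * (ℓ₂ (k + q) - ℓ₁ k) *
        ((tent N k * a x k) * conj ((tent N (k + q) : ℂ) * b x (k + q)))) (Icc 0 T) x := by
    intro x hx
    refine HasDerivWithinAt.sub ?_
      ((hasDerivWithinAt_integral_of_continuousOn hcont hx).const_mul _)
    refine HasDerivWithinAt.fun_sum fun k _ => ?_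
    exact ((hda x hx k).mul (hdb x hx (k + q)).star).const_mul _
  have hGb : ∀ x ∈ Icc 0 T, ‖(∑ k ∈ F, m k * (a' x k * conj ((tent N (k + q) : ℂ) * b x (k + q)) +
        (tent N k * a x k) * conj (b' x (k + q)))) -
      Complex.I * ∑ k ∈ F, m k * (ℓ₂ (k + q) - ℓ₁ k) *
        ((tent N k * a x k) * conj ((tent N (k + q) : ℂ) * b x (k + q)))‖ ≤
      (C * (∑' p, κ p) + 2 * C' * (2 * (∑' p, κ p) + 1)) * ε * B := by
    intro x hx
    have fa := pairsSmall_truncation hε h0 hs (ha.u_le x hx) (ha.summable_a x hx) (ha.a_le x hx)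
      (ha.summable_r x hx) (ha.r_le x hx) hN
    have fb := pairsSmall_truncation hε h0 hs (hb.u_le x hx) (hb.summable_a x hx) (hb.a_le x hx)
      (hb.summable_r x hx) (hb.r_le x hx) hN
    have va : ∑ n ∈ F, ‖(tent N n : ℂ) * a x n‖ ^ 2 ≤ B := by
      refine le_trans ?_ (ha.a_le x hx)
      refine le_trans ?_ ((ha.summable_a x hx).sum_le_tsum F fun _ _ => by positivity)
      gcongr
      exact norm_tent_mul_le _ _ _
    have vb : ∑ n ∈ F, ‖(tent N n : ℂ) * b x n‖ ^ 2 ≤ B := by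
      refine le_trans ?_ (hb.a_le x hx)
      refine le_trans ?_ ((hb.summable_a x hx).sum_le_tsum F fun _ _ => by positivity)
      gcongr
      exact norm_tent_mul_le _ _ _
    have := norm_rate_sub_le h0 hs (ha.u_le x hx) (ha.u_neg x hx) hC hm hC' hm'
      (hsupp (a x)) (hsupp (b x)) (v' := a' x) (z' := b' x)
      (fun n hn => by simp only [ha', tent_eq_zero hN hn, Complex.ofReal_zero, zero_mul]) hε.le
      (ℓ₁ := ℓ₁) (ℓ₂ := ℓ₂)
      (fun n => by simp only [ha']; ring) (fun n => by simp only [hb']; ring) fa fb va vb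
    refine this.trans (le_of_eq ?_)
    ring
  have := (convex_Icc 0 T).norm_image_sub_le_of_norm_hasDerivWithin_le hGd hGb
    (left_mem_Icc.2 hT) ht
  have hG0 : G 0 = ∑ k ∈ F, m k * ((tent N k * a 0 k) *
      conj ((tent N (k + q) : ℂ) * b 0 (k + q))) := by simp [hG]
  rw [hG0] at this
  have hB : 0 ≤ B := (tsum_nonneg fun _ => by positivity).trans (ha.a_le t ht)
  calc _ = ‖G t - ∑ k ∈ F, m k * ((tent N k * a 0 k) *
      conj ((tent N (k + q) : ℂ) * b 0 (k + q)))‖ := by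
        simp only [hG]
        congr 1
        ring
    _ ≤ _ := this
    _ ≤ _ := by
        apply mul_le_mul_of_nonneg_left _ (by positivity)
        rw [sub_zero, Real.norm_of_nonneg ht.1]
        exact ht.2

/-- The normal form identity. Where `m(k) (ℓ₂(k + q) - ℓ₁(k)) = 1`, it says that the `q`-th diagonal
of a quadratic expression in two solutions is, up to `O(ε)`, `-i` times the time derivative of the
form with kernel `m`. -/
theorem norm_diagForm_sub_le (h0 : ∀ p, 0 ≤ κ p) (hs : Summable κ) (hε : 0 < ε)
    (ha : IsEvolution κ ε B T ℓ₁ u r a) (hb : IsEvolution κ ε B T ℓ₂ u s b) (hC : 0 ≤ C)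
    (hm : ∀ k p : ℤ, ‖((k : ℂ) + p + q) * m k - k * m (k + p)‖ ≤ C * (1 + |(p : ℝ)|))
    (hC' : 0 ≤ C') (hm' : ∀ k, ‖m k‖ ≤ C')
    (hΛ : ∀ k, ‖m k * (ℓ₂ (k + q) - ℓ₁ k)‖ ≤ 1) {t : ℝ} (ht : t ∈ Icc 0 T) :
    ‖diagForm m q (a t) (b t) - diagForm m q (a 0) (b 0) -
      Complex.I * ∫ x in (0 : ℝ)..t, diagForm (fun k => m k * (ℓ₂ (k + q) - ℓ₁ k)) q (a x) (b x)‖ ≤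
    (C * (∑' p, κ p) + 2 * C' * (2 * (∑' p, κ p) + 1)) * ε * B * T := by
  have hT : (0 : ℝ) ≤ T := ht.1.trans ht.2
  have hT0 : (0 : ℝ) ∈ Icc 0 T := left_mem_Icc.2 hT
  have l1 := tendsto_diagForm_tent hm' q (ha.summable_a t ht) (hb.summable_a t ht)
  have l2 := tendsto_diagForm_tent hm' q (ha.summable_a 0 hT0) (hb.summable_a 0 hT0)
  have hsub : uIoc 0 t ⊆ Icc 0 T := by
    rw [uIoc_of_le ht.1]
    exact fun x hx => ⟨hx.1.le, hx.2.trans ht.2⟩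
  have l3 : Filter.Tendsto (fun N : ℕ => ∫ x in (0 : ℝ)..t,
      diagForm (fun k => m k * (ℓ₂ (k + q) - ℓ₁ k)) q
        (fun k => tent N k * a x k) (fun k => tent N k * b x k)) Filter.atTop
      (nhds (∫ x in (0 : ℝ)..t, diagForm (fun k => m k * (ℓ₂ (k + q) - ℓ₁ k)) q (a x) (b x))) := by
    refine intervalIntegral.tendsto_integral_filter_of_dominated_convergence (fun _ => 1 * B)
      ?_ ?_ (by simp) ?_
    · filter_upwards [Filter.eventually_gt_atTop 0] with N hN
      exact ((continuousOn_diagForm_tent ha hb _ q hN).mono hsub).aestronglyMeasurable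
        measurableSet_uIoc
    · refine Filter.Eventually.of_forall fun N => Filter.Eventually.of_forall fun x hx => ?_
      exact norm_diagForm_tent_le ha hb hΛ N (hsub hx)
    · refine Filter.Eventually.of_forall fun x hx => ?_
      have hx' := hsub hx
      exact tendsto_diagForm_tent hΛ q (ha.summable_a x hx') (hb.summable_a x hx')
  have lim := ((l1.sub l2).sub (l3.const_mul Complex.I)).norm
  refine le_of_tendsto lim ?_
  filter_upwards [Filter.eventually_gt_atTop 0] with N hN
  exact norm_diagForm_tent_sub_le h0 hs hε ha hb hC hm hC' hm' hN ht

end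

/-- The `L²` norm of a solution is almost conserved: for the kernel `1` on the diagonal `q = 0` the
dispersive terms cancel. -/
theorem abs_tsum_sq_sub_le {κ : ℤ → ℝ} {ε B T : ℝ} {ℓ : ℤ → ℝ} {u r a : ℝ → ℤ → ℂ}
    (h0 : ∀ p, 0 ≤ κ p) (hs : Summable κ) (hε : 0 < ε)
    (ha : IsEvolution κ ε B T ℓ u r a) {t : ℝ} (ht : t ∈ Icc 0 T) :
    |∑' n, ‖a t n‖ ^ 2 - ∑' n, ‖a 0 n‖ ^ 2| ≤ (5 * (∑' p, κ p) + 2) * ε * B * T := by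
  have h := norm_diagForm_sub_le h0 hs hε ha ha (m := fun _ => 1) (q := 0) (C := 1) (C' := 1)
    zero_le_one (fun k p => by
      simp only [mul_one, Int.cast_zero, add_zero, add_sub_cancel_left, Complex.norm_intCast,
        one_mul]
      linarith) zero_le_one (fun k => by simp) (fun k => by simp) ht
  have e : ∀ t, diagForm (fun _ => 1) 0 (a t) (a t) = ((∑' n, ‖a t n‖ ^ 2 : ℝ) : ℂ) := by
    intro t
    rw [Complex.ofReal_tsum]
    refine tsum_congr fun k => ?_
    rw [one_mul, add_zero, Complex.mul_conj, Complex.normSq_eq_norm_sq]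
  have ez : ∀ x, diagForm (fun k => 1 * ((ℓ (k + 0) : ℂ) - ℓ k)) 0 (a x) (a x) = 0 := by
    intro x
    simp [diagForm]
  simp only [ez, e, intervalIntegral.integral_zero, mul_zero, sub_zero] at h
  rw [← Complex.ofReal_sub, Complex.norm_real, Real.norm_eq_abs] at h
  refine h.trans (le_of_eq ?_)
  ring

/-! ### High frequencies -/

/-- The energy of the frequencies at most `N`. -/
def lowEnergy (N : ℕ) (v : ℤ → ℂ) : ℝ := ∑ n ∈ Finset.Icc (-(N : ℤ)) N, ‖v n‖ ^ 2

theorem lowEnergy_conj (N : ℕ) (v : ℤ → ℂ) :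
    lowEnergy N (fun n => conj (v (-n))) = lowEnergy N v := by
  unfold lowEnergy
  refine Finset.sum_bij (fun n _ => -n) ?_ ?_ ?_ ?_
  · intro n hn
    rw [Finset.mem_Icc] at hn ⊢
    omega
  · intro n _ m _ h
    exact neg_injective h
  · intro n hn
    refine ⟨-n, ?_, neg_neg n⟩
    rw [Finset.mem_Icc] at hn ⊢
    omega
  · intro n _
    rw [RCLike.norm_conj]

/-- A form with a kernel which is small away from the low frequencies. -/
theorem norm_diagForm_le_add {m : ℤ → ℂ} {C η : ℝ} {N₀ N : ℕ} {q : ℤ} (hm : ∀ k, ‖m k‖ ≤ C)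
    (hη : ∀ k : ℤ, (N₀ : ℤ) ≤ |k| → ‖m k‖ ≤ η) (hη0 : 0 ≤ η) (hq : N₀ + |q| ≤ N) {v z : ℤ → ℂ}
    {B Λ : ℝ} (hv : Summable fun n => ‖v n‖ ^ 2) (hz : Summable fun n => ‖z n‖ ^ 2)
    (hvB : ∑' n, ‖v n‖ ^ 2 ≤ B) (hzB : ∑' n, ‖z n‖ ^ 2 ≤ B)
    (hvΛ : lowEnergy N v ≤ Λ) (hzΛ : lowEnergy N z ≤ Λ) :
    ‖diagForm m q v z‖ ≤ η * B + C * Λ := by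
  have hC : 0 ≤ C := (norm_nonneg _).trans (hm 0)
  set cut : (ℤ → ℂ) → ℤ → ℝ := fun v n => if n ∈ Finset.Icc (-(N : ℤ)) N then ‖v n‖ ^ 2 else 0
    with hcut
  have hcut0 : ∀ v n, 0 ≤ cut v n := by
    intro v n
    simp only [hcut]
    split_ifs <;> positivity
  have hcs : ∀ v, HasSum (cut v) (lowEnergy N v) := by
    intro v
    have : HasSum (cut v) (∑ n ∈ Finset.Icc (-(N : ℤ)) N, cut v n) :=
      hasSum_sum_of_ne_finset_zero fun n hn => by simp only [hcut]; rw [if_neg hn]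
    convert this using 1
    refine Finset.sum_congr rfl fun n hn => ?_
    simp only [hcut]
    rw [if_pos hn]
  have hcz := (Equiv.addRight q).hasSum_iff.2 (hcs z)
  have hzq := summable_sq_shift hz q
  have hsum := ((hv.hasSum.add hzq.1.hasSum).div_const 2).mul_left η
  have hsum2 := (((hcs v).add hcz).div_const 2).mul_left C
  refine (tsum_of_norm_bounded (hsum.add hsum2) fun k => ?_).trans ?_
  · rw [norm_mul, norm_mul, RCLike.norm_conj]
    have h1 := two_mul_le_add_sq ‖v k‖ ‖z (k + q)‖
    have h2 : ‖v k‖ * ‖z (k + q)‖ ≤ (‖v k‖ ^ 2 + ‖z (k + q)‖ ^ 2) / 2 := by linarith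
    simp only [Function.comp_apply, Equiv.coe_addRight]
    rcases le_or_gt (N₀ : ℤ) |k| with hk | hk
    · have h3 : 0 ≤ C * ((cut v k + cut z (k + q)) / 2) :=
        mul_nonneg hC (div_nonneg (add_nonneg (hcut0 _ _) (hcut0 _ _)) zero_le_two)
      have h4 : ‖m k‖ * (‖v k‖ * ‖z (k + q)‖) ≤ η * ((‖v k‖ ^ 2 + ‖z (k + q)‖ ^ 2) / 2) := by
        gcongr
        exact hη k hk
      linarith
    · have a1 := abs_lt.1 hk
      have a2 := abs_le.1 (le_refl |q|)
      have k1 : k ∈ Finset.Icc (-(N : ℤ)) N := by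
        rw [Finset.mem_Icc]; omega
      have k2 : k + q ∈ Finset.Icc (-(N : ℤ)) N := by
        rw [Finset.mem_Icc]; omega
      simp only [hcut, if_pos k1, if_pos k2]
      have h3 : 0 ≤ η * ((‖v k‖ ^ 2 + ‖z (k + q)‖ ^ 2) / 2) := by positivity
      have h4 : ‖m k‖ * (‖v k‖ * ‖z (k + q)‖) ≤ C * ((‖v k‖ ^ 2 + ‖z (k + q)‖ ^ 2) / 2) := by
        gcongr
        exact hm k
      linarith
  · rw [hzq.2]
    gcongr <;> linarith

section

variable {κ : ℤ → ℝ} {ε B T : ℝ} {ℓ₁ ℓ₂ : ℤ → ℝ} {u r s a b : ℝ → ℤ → ℂ} {m : ℤ → ℂ} {q : ℤ}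
  {C C' η Λ : ℝ} {N₀ N : ℕ}

/-- Removing the nonresonant part of a quadratic expression by a normal form. -/
theorem norm_integral_diagForm_sub_le (h0 : ∀ p, 0 ≤ κ p) (hs : Summable κ) (hε : 0 < ε)
    (hT : 0 ≤ T) (ha : IsEvolution κ ε B T ℓ₁ u r a) (hb : IsEvolution κ ε B T ℓ₂ u s b)
    (hC : 0 ≤ C)
    (hm : ∀ k p : ℤ, ‖((k : ℂ) + p + q) * m k - k * m (k + p)‖ ≤ C * (1 + |(p : ℝ)|))
    (hC' : 0 ≤ C') (hm' : ∀ k, ‖m k‖ ≤ C')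
    (hΛ : ∀ k, ‖m k * (ℓ₂ (k + q) - ℓ₁ k)‖ ≤ 1)
    (hη : ∀ k : ℤ, (N₀ : ℤ) ≤ |k| → ‖m k‖ ≤ η) (hη0 : 0 ≤ η) (hq : N₀ + |q| ≤ N)
    (haΛ : ∀ t ∈ Icc 0 T, lowEnergy N (a t) ≤ Λ) (hbΛ : ∀ t ∈ Icc 0 T, lowEnergy N (b t) ≤ Λ) :
    ‖(∫ x in (0 : ℝ)..T, diagForm (fun _ => 1) q (a x) (b x)) -
      ∫ x in (0 : ℝ)..T, diagForm (fun k => 1 - m k * (ℓ₂ (k + q) - ℓ₁ k)) q (a x) (b x)‖ ≤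
    2 * (η * B + C' * Λ) +
      (C * (∑' p, κ p) + 2 * C' * (2 * (∑' p, κ p) + 1)) * ε * B * T := by
  have i1 := intervalIntegrable_diagForm ha hb (m := fun _ => 1) (C := 1) (fun k => by simp) q hT
  have h2 : ∀ k, ‖1 - m k * (ℓ₂ (k + q) - ℓ₁ k)‖ ≤ 2 := fun k => by
    refine (norm_sub_le _ _).trans ?_
    have := hΛ k
    rw [norm_one]
    linarith
  have i2 := intervalIntegrable_diagForm ha hb h2 q hT
  rw [← intervalIntegral.integral_sub i1 i2]
  have e : ∀ x ∈ uIcc 0 T, diagForm (fun _ => 1) q (a x) (b x) -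
      diagForm (fun k => 1 - m k * (ℓ₂ (k + q) - ℓ₁ k)) q (a x) (b x) =
      diagForm (fun k => m k * (ℓ₂ (k + q) - ℓ₁ k)) q (a x) (b x) := by
    intro x hx
    rw [uIcc_of_le hT] at hx
    unfold diagForm
    rw [← (summable_diagForm (m := fun _ => 1) (C := 1) (fun k => by simp) q (ha.summable_a x hx)
      (hb.summable_a x hx)).tsum_sub
      (summable_diagForm h2 q (ha.summable_a x hx) (hb.summable_a x hx))]
    exact tsum_congr fun k => by ring
  rw [intervalIntegral.integral_congr e]
  have hT' : T ∈ Icc 0 T := right_mem_Icc.2 hT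
  have h0' : (0 : ℝ) ∈ Icc 0 T := left_mem_Icc.2 hT
  have main := norm_diagForm_sub_le h0 hs hε ha hb hC hm hC' hm' hΛ hT'
  have b1 := norm_diagForm_le_add hm' hη hη0 hq (ha.summable_a T hT') (hb.summable_a T hT')
    (ha.a_le T hT') (hb.a_le T hT') (haΛ T hT') (hbΛ T hT')
  have b2 := norm_diagForm_le_add hm' hη hη0 hq (ha.summable_a 0 h0') (hb.summable_a 0 h0')
    (ha.a_le 0 h0') (hb.a_le 0 h0') (haΛ 0 h0') (hbΛ 0 h0')
  set X := ∫ x in (0 : ℝ)..T, diagForm (fun k => m k * (ℓ₂ (k + q) - ℓ₁ k)) q (a x) (b x)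
  set E := diagForm m q (a T) (b T)
  set E₀ := diagForm m q (a 0) (b 0)
  have tri : ‖X‖ ≤ ‖E‖ + ‖E₀‖ + ‖E - E₀ - Complex.I * X‖ := by
    have e1 : ‖X‖ = ‖Complex.I * X‖ := by rw [norm_mul, Complex.norm_I, one_mul]
    have e2 : Complex.I * X = E - E₀ - (E - E₀ - Complex.I * X) := by ring
    rw [e1]
    calc ‖Complex.I * X‖ = ‖E - E₀ - (E - E₀ - Complex.I * X)‖ := by rw [← e2]
      _ ≤ ‖E - E₀‖ + ‖E - E₀ - Complex.I * X‖ := norm_sub_le _ _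
      _ ≤ _ := by gcongr; exact norm_sub_le _ _
  linarith

end

/-- The quadratic expressions `∑ₖ a(k) conj a(k + q)`, integrated in time, are negligible, except
for `q = 0`. -/
theorem exists_norm_integral_diagForm_le {g b : ℝ} (hg : 0 < g) (hb : 0 < b) {κ : ℤ → ℝ}
    (h0 : ∀ p, 0 ≤ κ p) (hs : Summable κ) {T : ℝ} (hT : 0 ≤ T) (D : ℕ) {η : ℝ} (hη : 0 < η) :
    ∃ (N : ℕ) (K : ℝ), 0 ≤ K ∧ ∀ (ε B Λ : ℝ) (u r a : ℝ → ℤ → ℂ), 0 < ε →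
      IsEvolution κ ε B T (disp g b) u r a → (∀ t ∈ Icc 0 T, lowEnergy N (a t) ≤ Λ) →
      ∀ q : ℤ, |q| ≤ D →
      ‖(∫ x in (0 : ℝ)..T, diagForm (fun _ => 1) q (a x) (a x)) -
        (if q = 0 then ((∫ x in (0 : ℝ)..T, ∑' n, ‖a x n‖ ^ 2 : ℝ) : ℂ) else 0)‖ ≤
        (η + K * ε) * B + K * Λ := by
  have hc := gapConst_pos hg hb
  obtain ⟨C, hC, hbr⟩ := exists_abs_bracket_invDiff_le hg hb D
  obtain ⟨N₀, hN₀⟩ := exists_abs_invDiff_le hg hb (half_pos hη)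
  have hS : 0 ≤ ∑' p, κ p := tsum_nonneg h0
  set C' := (gapConst g b)⁻¹ with hC'def
  have hC' : 0 ≤ C' := by positivity
  set K₁ := (C * (∑' p, κ p) + 2 * C' * (2 * (∑' p, κ p) + 1)) * T with hK₁
  have hK₁0 : 0 ≤ K₁ := by positivity
  refine ⟨N₀ + D + D, K₁ + 2 * C' + T, by positivity, ?_⟩
  intro ε B Λ u r a hε ha hΛ q hq
  have hΛ0 : 0 ≤ Λ := le_trans (Finset.sum_nonneg fun _ _ => by positivity)
    (hΛ 0 (left_mem_Icc.2 hT))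
  have hB : 0 ≤ B := (tsum_nonneg fun _ => by positivity).trans (ha.a_le 0 (left_mem_Icc.2 hT))
  set m : ℤ → ℂ := fun k => (invDiff g b (k + q) k : ℂ) with hm
  -- a resonance `|k + q| = |k|` with `q ≠ 0` forces `2k = -q`, which is a low frequency
  have hres : ∀ k : ℤ, m k * (disp g b (k + q) - disp g b k) = if |k + q| = |k| then 0 else 1 := by
    intro k
    simp only [hm, invDiff]
    split_ifs with h
    · rw [(disp_eq_disp_iff hg hb).2 h]; simp
    · rw [← Complex.ofReal_sub, ← Complex.ofReal_mul, inv_mul_cancel₀, Complex.ofReal_one]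
      rw [sub_ne_zero, Ne, disp_eq_disp_iff hg hb]; exact h
  have main := norm_integral_diagForm_sub_le h0 hs hε hT ha ha hC (m := m) (q := q) (C' := C')
    (η := η / 2) (Λ := Λ) (N₀ := N₀) (N := N₀ + D + D) (fun k p => by
      simp only [hm]
      have := hbr q k p hq
      rw [← Real.norm_eq_abs, ← Complex.norm_real] at this
      rw [show k + p + q = k + p + q from rfl] at this
      push_cast at this
      exact this) hC' (fun k => by
      simp only [hm, Complex.norm_real, Real.norm_eq_abs]
      exact abs_invDiff_le hg hb _ _) (fun k => by
      rw [hres]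
      split_ifs <;> simp) (fun k hk => by
      simp only [hm, Complex.norm_real, Real.norm_eq_abs]
      exact hN₀ _ _ hk) (by positivity) (by push_cast; omega) hΛ hΛ
  have hend : 2 * (η / 2 * B + C' * Λ) + K₁ * ε * B + T * Λ ≤
      (η + (K₁ + 2 * C' + T) * ε) * B + (K₁ + 2 * C' + T) * Λ := by
    have : 0 ≤ (2 * C' + T) * ε * B := by positivity
    have : 0 ≤ K₁ * Λ := by positivity
    nlinarith
  have hmain' : 2 * (η / 2 * B + C' * Λ) +
      (C * (∑' p, κ p) + 2 * C' * (2 * (∑' p, κ p) + 1)) * ε * B * T =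
      2 * (η / 2 * B + C' * Λ) + K₁ * ε * B := by rw [hK₁]; ring
  rw [hmain'] at main
  simp only [hres] at main
  split_ifs with hq0
  · subst hq0
    have e : ∀ x, diagForm (fun k => 1 - if |k + 0| = |k| then 0 else 1) 0 (a x) (a x) =
        ((∑' n, ‖a x n‖ ^ 2 : ℝ) : ℂ) := by
      intro x
      rw [Complex.ofReal_tsum]
      refine tsum_congr fun k => ?_
      change (1 - if |k + 0| = |k| then (0 : ℂ) else 1) * (a x k * conj (a x (k + 0))) = _
      rw [add_zero, if_pos rfl, sub_zero, one_mul, Complex.mul_conj, Complex.normSq_eq_norm_sq]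
    simp only [e, intervalIntegral.integral_ofReal] at main
    have : 0 ≤ T * Λ := by positivity
    linarith
  · have hb1 : ‖∫ x in (0 : ℝ)..T,
        diagForm (fun k => 1 - if |k + q| = |k| then 0 else 1) q (a x) (a x)‖ ≤ Λ * |T - 0| := by
      refine intervalIntegral.norm_integral_le_of_norm_le_const fun x hx => ?_
      rw [uIoc_of_le hT] at hx
      have hx' := Ioc_subset_Icc_self hx
      have := norm_diagForm_le_add (m := fun k : ℤ => 1 - if |k + q| = |k| then 0 else 1) (C := 1)
        (η := 0) (N₀ := D + N₀) (N := N₀ + D + D) (q := q) (fun k => by split_ifs <;> simp)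
        (fun k hk => by
          have hne : |k + q| ≠ |k| := by
            intro h
            have hkq : k + q = -k := by
              rcases abs_eq_abs.1 h with h | h
              · omega
              · exact h
            have h1 := abs_le.1 hq
            have h2 : |k| ≤ D / 2 + 0 := by rw [abs_le]; omega
            rcases eq_or_ne k 0 with h3 | h3
            · subst h3; omega
            · have := abs_pos.2 h3
              push_cast at hk
              omega
          simp [hne]) le_rfl (by push_cast; omega) (ha.summable_a x hx') (ha.summable_a x hx')
        (ha.a_le x hx') (ha.a_le x hx') (hΛ x hx') (hΛ x hx')
      linarith
    rw [sub_zero, abs_of_nonneg hT] at hb1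
    rw [sub_zero]
    have := norm_le_norm_add_norm_sub' (∫ x in (0 : ℝ)..T, diagForm (fun _ => 1) q (a x) (a x))
      (∫ x in (0 : ℝ)..T, diagForm (fun k => 1 - if |k + q| = |k| then 0 else 1) q (a x) (a x))
    linarith

/-- The quadratic expressions `∑ₖ a(k) a(-k - q)`, integrated in time, are negligible: the conjugate
wave has the dispersion relation `-ℓ`, so that sums of frequencies occur, and these vanish only at
`k = q = 0`. -/
theorem exists_norm_integral_diagForm_conj_le {g b : ℝ} (hg : 0 < g) (hb : 0 < b) {κ : ℤ → ℝ}
    (h0 : ∀ p, 0 ≤ κ p) (hs : Summable κ) {T : ℝ} (hT : 0 ≤ T) (D : ℕ) {η : ℝ} (hη : 0 < η) :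
    ∃ (N : ℕ) (K : ℝ), 0 ≤ K ∧ ∀ (ε B Λ : ℝ) (u r a : ℝ → ℤ → ℂ), 0 < ε →
      IsEvolution κ ε B T (disp g b) u r a → (∀ t ∈ Icc 0 T, lowEnergy N (a t) ≤ Λ) →
      ∀ q : ℤ, |q| ≤ D →
      ‖∫ x in (0 : ℝ)..T, diagForm (fun _ => 1) q (a x) (fun n => conj (a x (-n)))‖ ≤
        (η + K * ε) * B + K * Λ := by
  have hc := gapConst_pos hg hb
  obtain ⟨N₀, hN₀⟩ := exists_abs_invSum_le hg hb (half_pos hη)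
  have hS : 0 ≤ ∑' p, κ p := tsum_nonneg h0
  set C' := (gapConst g b)⁻¹ with hC'def
  have hC' : 0 ≤ C' := by positivity
  set K₁ := (2 * C' * (∑' p, κ p) + 2 * C' * (2 * (∑' p, κ p) + 1)) * T with hK₁
  have hK₁0 : 0 ≤ K₁ := by positivity
  refine ⟨N₀ + 1 + D, K₁ + 2 * C' + T, by positivity, ?_⟩
  intro ε B Λ u r a hε ha hΛ q hq
  have hΛ0 : 0 ≤ Λ := le_trans (Finset.sum_nonneg fun _ _ => by positivity)
    (hΛ 0 (left_mem_Icc.2 hT))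
  have hB : 0 ≤ B := (tsum_nonneg fun _ => by positivity).trans (ha.a_le 0 (left_mem_Icc.2 hT))
  have hac := ha.conj (disp_neg g b)
  have hΛc : ∀ t ∈ Icc 0 T, lowEnergy (N₀ + 1 + D) (fun n => conj (a t (-n))) ≤ Λ := by
    intro t ht
    rw [lowEnergy_conj]
    exact hΛ t ht
  set m : ℤ → ℂ := fun k => -(invSum g b (k + q) k : ℂ) with hm
  have hres : ∀ k : ℤ, m k * (((-disp g b (k + q) : ℝ) : ℂ) - disp g b k) =
      if k + q = 0 ∧ k = 0 then 0 else 1 := by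
    intro k
    have e : m k * (((-disp g b (k + q) : ℝ) : ℂ) - disp g b k) =
        ((invSum g b (k + q) k * (disp g b (k + q) + disp g b k) : ℝ) : ℂ) := by
      simp only [hm]; push_cast; ring
    rw [e, invSum]
    split_ifs with h
    · rw [h.1, h.2, disp_zero]; simp
    · rw [inv_mul_cancel₀, Complex.ofReal_one]
      have h1 := gapConst_mul_max_le_disp_add hg hb (k + q) k
      have h2 : (1 : ℝ) ≤ max |((k + q : ℤ) : ℝ)| |(k : ℝ)| := one_le_max_abs (by tauto)
      have h3 : 0 < √(max |((k + q : ℤ) : ℝ)| |(k : ℝ)|) := sqrt_pos.2 (by linarith)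
      have : 0 < gapConst g b * (max |((k + q : ℤ) : ℝ)| |(k : ℝ)| *
        √(max |((k + q : ℤ) : ℝ)| |(k : ℝ)|)) := by positivity
      linarith
  have main := norm_integral_diagForm_sub_le h0 hs hε hT ha hac (m := m) (q := q)
    (C := 2 * C') (C' := C')
    (η := η / 2) (Λ := Λ) (N₀ := N₀ + 1) (N := N₀ + 1 + D) (by positivity) (fun k p => by
      simp only [hm]
      have := abs_bracket_invSum_le hg hb q k p
      rw [← Real.norm_eq_abs, ← Complex.norm_real, ← norm_neg] at this
      push_cast at this
      refine le_trans (le_of_eq ?_) this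
      congr 1
      ring) hC' (fun k => by
      simp only [hm, norm_neg, Complex.norm_real, Real.norm_eq_abs]
      exact abs_invSum_le hg hb _ _) (fun k => by
      rw [hres]
      split_ifs <;> simp) (fun k hk => by
      simp only [hm, norm_neg, Complex.norm_real, Real.norm_eq_abs]
      exact hN₀ _ _ (by push_cast at hk; omega)) (by positivity) (by push_cast; omega) hΛ hΛc
  have hend : 2 * (η / 2 * B + C' * Λ) + K₁ * ε * B + T * Λ ≤
      (η + (K₁ + 2 * C' + T) * ε) * B + (K₁ + 2 * C' + T) * Λ := by
    have : 0 ≤ (2 * C' + T) * ε * B := by positivity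
    have : 0 ≤ K₁ * Λ := by positivity
    nlinarith
  have hmain' : 2 * (η / 2 * B + C' * Λ) +
      (2 * C' * (∑' p, κ p) + 2 * C' * (2 * (∑' p, κ p) + 1)) * ε * B * T =
      2 * (η / 2 * B + C' * Λ) + K₁ * ε * B := by rw [hK₁]; ring
  rw [hmain'] at main
  simp only [hres] at main
  have hb1 : ‖∫ x in (0 : ℝ)..T, diagForm (fun k => 1 - if k + q = 0 ∧ k = 0 then 0 else 1) q
      (a x) (fun n => conj (a x (-n)))‖ ≤ Λ * |T - 0| := by
    refine intervalIntegral.norm_integral_le_of_norm_le_const fun x hx => ?_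
    rw [uIoc_of_le hT] at hx
    have hx' := Ioc_subset_Icc_self hx
    have := norm_diagForm_le_add (m := fun k : ℤ => 1 - if k + q = 0 ∧ k = 0 then 0 else 1)
      (C := 1) (η := 0) (N₀ := N₀ + 1) (N := N₀ + 1 + D) (q := q)
      (fun k => by split_ifs <;> simp)
      (fun k hk => by
        have hne : ¬ (k + q = 0 ∧ k = 0) := by
          rintro ⟨-, rfl⟩
          push_cast at hk
          simp at hk
          omega
        simp [hne]) le_rfl (by push_cast; omega) (ha.summable_a x hx') (hac.summable_a x hx')
      (ha.a_le x hx') (hac.a_le x hx') (hΛ x hx') (hΛc x hx')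
    linarith
  rw [sub_zero, abs_of_nonneg hT] at hb1
  have := norm_le_norm_add_norm_sub'
    (∫ x in (0 : ℝ)..T, diagForm (fun _ => 1) q (a x) (fun n => conj (a x (-n))))
    (∫ x in (0 : ℝ)..T, diagForm (fun k => 1 - if k + q = 0 ∧ k = 0 then 0 else 1) q
      (a x) (fun n => conj (a x (-n))))
  linarith

/-! ### Nonharmonic Fourier series -/

/-- The almost periodic function `∑ₖ c(k) e^{-iλ(k)t}`. -/
def expSum (lam : ℤ → ℝ) (c : ℤ → ℂ) (t : ℝ) : ℂ :=
  ∑' k, c k * Complex.exp (-(Complex.I * (lam k * t : ℝ)))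

theorem norm_exp_neg_I_mul (x : ℝ) : ‖Complex.exp (-(Complex.I * (x : ℂ)))‖ = 1 := by
  rw [show -(Complex.I * (x : ℂ)) = ((-x : ℝ) : ℂ) * Complex.I by push_cast; ring]
  exact Complex.norm_exp_ofReal_mul_I _

theorem norm_expSum_term (lam : ℤ → ℝ) (c : ℤ → ℂ) (t : ℝ) (k : ℤ) :
    ‖c k * Complex.exp (-(Complex.I * (lam k * t : ℝ)))‖ = ‖c k‖ := by
  rw [norm_mul, norm_exp_neg_I_mul, mul_one]

theorem summable_expSum (lam : ℤ → ℝ) {c : ℤ → ℂ} (hc : Summable fun k => ‖c k‖) (t : ℝ) :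
    Summable fun k => c k * Complex.exp (-(Complex.I * (lam k * t : ℝ))) :=
  Summable.of_norm_bounded hc fun k => (norm_expSum_term lam c t k).le

theorem continuous_expSum (lam : ℤ → ℝ) {c : ℤ → ℂ} (hc : Summable fun k => ‖c k‖) :
    Continuous (expSum lam c) := by
  refine continuous_tsum (fun k => ?_) hc fun k t => (norm_expSum_term lam c t k).le
  fun_prop

/-- The Fourier transform of the weight `t (T - t)` on `[0, T]` decays quadratically. -/
theorem norm_integral_weight_le {T μ : ℝ} (hT : 0 ≤ T) (hμ : μ ≠ 0) :
    ‖∫ t in (0 : ℝ)..T, ((t * (T - t) : ℝ) : ℂ) * Complex.exp (Complex.I * (μ * t : ℝ))‖ ≤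
      4 * T / μ ^ 2 := by
  have hμ' : Complex.I * (μ : ℂ) ≠ 0 := mul_ne_zero Complex.I_ne_zero (by exact_mod_cast hμ)
  set ν : ℂ := Complex.I * μ with hν
  have hder : ∀ t : ℝ, HasDerivAt (fun t : ℝ => Complex.exp (ν * t) *
      ((t * (T - t) : ℂ) / ν - (T - 2 * t) / ν ^ 2 + (-2) / ν ^ 3))
      (((t * (T - t) : ℝ) : ℂ) * Complex.exp (Complex.I * (μ * t : ℝ))) t := by
    intro t
    have h1 : HasDerivAt (fun t : ℝ => (t : ℂ)) 1 t := Complex.ofRealCLM.hasDerivAt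
    have h2 : HasDerivAt (fun t : ℝ => Complex.exp (ν * t)) (Complex.exp (ν * t) * (ν * 1)) t :=
      (h1.const_mul ν).cexp
    have h3 : HasDerivAt (fun t : ℝ => (t * (T - t) : ℂ)) (1 * (T - t) + t * (-1)) t :=
      h1.mul (h1.const_sub (T : ℂ))
    have h4 : HasDerivAt (fun t : ℝ => (T - 2 * t : ℂ)) (-(2 * 1)) t :=
      (h1.const_mul 2).const_sub (T : ℂ)
    have h5 := h2.mul (((h3.div_const ν).sub (h4.div_const (ν ^ 2))).add_const ((-2) / ν ^ 3))
    refine h5.congr_deriv ?_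
    have : Complex.exp (Complex.I * (μ * t : ℝ)) = Complex.exp (ν * t) := by
      rw [hν]; push_cast; ring_nf
    rw [this]
    simp only [Pi.sub_apply]
    push_cast
    field_simp
    ring
  have hint := intervalIntegral.integral_eq_sub_of_hasDerivAt (a := 0) (b := T)
    (fun t _ => hder t) (Continuous.intervalIntegrable (by fun_prop) _ _)
  rw [hint]
  have e : Complex.exp (ν * (T : ℝ)) *
      (((T : ℝ) * (T - (T : ℝ)) : ℂ) / ν - (T - 2 * (T : ℝ)) / ν ^ 2 + (-2) / ν ^ 3) -
      Complex.exp (ν * (0 : ℝ)) *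
      (((0 : ℝ) * (T - (0 : ℝ)) : ℂ) / ν - (T - 2 * (0 : ℝ)) / ν ^ 2 + (-2) / ν ^ 3) =
      T * (Complex.exp (ν * T) + 1) / ν ^ 2 - 2 * (Complex.exp (ν * T) - 1) / ν ^ 3 := by
    simp only [Complex.ofReal_zero, mul_zero, Complex.exp_zero]
    field_simp
    ring
  rw [e]
  have hnν : ‖ν‖ = |μ| := by rw [hν, norm_mul, Complex.norm_I, one_mul, Complex.norm_real]; rfl
  have hνT : ν * T = Complex.I * ((μ * T : ℝ) : ℂ) := by rw [hν]; push_cast; ring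
  have hexp : ‖Complex.exp (ν * T)‖ = 1 := by
    rw [hνT, mul_comm]; exact Complex.norm_exp_ofReal_mul_I _
  have hexp1 : ‖Complex.exp (ν * T) - 1‖ ≤ |μ| * T := by
    rw [hνT]
    have := Real.norm_exp_I_mul_ofReal_sub_one_le (x := μ * T)
    rwa [Real.norm_eq_abs, abs_mul, abs_of_nonneg hT] at this
  have hμ0 : 0 < |μ| := abs_pos.2 hμ
  have b1 : ‖(T : ℂ) * (Complex.exp (ν * T) + 1) / ν ^ 2‖ ≤ T * 2 / |μ| ^ 2 := by
    rw [norm_div, norm_mul, norm_pow, hnν, Complex.norm_real, Real.norm_of_nonneg hT]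
    gcongr
    refine (norm_add_le _ _).trans ?_
    rw [hexp, norm_one]; norm_num
  have b2 : ‖2 * (Complex.exp (ν * T) - 1) / ν ^ 3‖ ≤ 2 * (|μ| * T) / |μ| ^ 3 := by
    rw [norm_div, norm_mul, norm_pow, hnν]
    have : ‖(2 : ℂ)‖ = 2 := by simp
    rw [this]
    gcongr
  refine (norm_sub_le _ _).trans ((add_le_add b1 b2).trans (le_of_eq ?_))
  rw [← sq_abs μ]
  field_simp
  ring

theorem integral_weight (T : ℝ) : ∫ t in (0 : ℝ)..T, t * (T - t) = T ^ 3 / 6 := by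
  have : ∀ t : ℝ, HasDerivAt (fun t : ℝ => T * t ^ 2 / 2 - t ^ 3 / 3) (t * (T - t)) t := by
    intro t
    have h1 := ((hasDerivAt_pow 2 t).const_mul T).div_const 2
    have h2 := (hasDerivAt_pow 3 t).div_const 3
    refine (h1.sub h2).congr_deriv ?_
    push_cast
    ring
  rw [intervalIntegral.integral_eq_sub_of_hasDerivAt (fun t _ => this t)
    (Continuous.intervalIntegrable (by fun_prop) _ _)]
  ring

theorem summable_inv_int_sq : Summable fun p : ℤ => ((p : ℝ) ^ 2)⁻¹ := by
  simpa using Real.summable_one_div_int_pow (p := 2).2 (by norm_num)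

/-- If the frequencies in use are well separated, the coefficients are controlled by the function,
since the Gram matrix for the weight `t (T - t)` is diagonally dominant. -/
theorem norm_coeff_le_of_gap {lam : ℤ → ℝ} {A : Set ℤ} {T γ : ℝ} (hT : 0 < T) (hγ : 0 < γ)
    (hgap : ∀ j ∈ A, ∀ k ∈ A, γ * |(j : ℝ) - k| ≤ |lam j - lam k|)
    (hbig : 4 * T * (∑' p : ℤ, ((p : ℝ) ^ 2)⁻¹) / γ ^ 2 ≤ T ^ 3 / 12)
    {c : ℤ → ℂ} (hc : Summable fun k => ‖c k‖) (hcA : ∀ k ∉ A, c k = 0) (k : ℤ) :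
    ‖c k‖ ≤ 12 / T * ∫ t in (0 : ℝ)..T, ‖expSum lam c t‖ := by
  set I₀ := ∫ t in (0 : ℝ)..T, ‖expSum lam c t‖ with hI₀
  have hI₀0 : 0 ≤ I₀ := intervalIntegral.integral_nonneg hT.le fun _ _ => norm_nonneg _
  have hbdd : BddAbove (range fun k => ‖c k‖) :=
    ⟨∑' k, ‖c k‖, by rintro _ ⟨k, rfl⟩; exact hc.le_tsum k fun _ _ => norm_nonneg _⟩
  set M := ⨆ k, ‖c k‖ with hM
  have hcM : ∀ k, ‖c k‖ ≤ M := fun k => le_ciSup hbdd k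
  have hM0 : 0 ≤ M := (norm_nonneg _).trans (hcM 0)
  -- the `k`-th row of the Gram system, solved for its diagonal term
  have row : ∀ k, ‖c k‖ ≤ 6 / T * I₀ + M / 2 := by
    intro k
    by_cases hk : k ∈ A
    swap
    · rw [hcA k hk, norm_zero]; positivity
    set h : ℤ → ℂ := fun j => ∫ t in (0 : ℝ)..T,
      ((t * (T - t) : ℝ) : ℂ) * Complex.exp (Complex.I * ((lam k - lam j) * t : ℝ)) with hh
    have hsum : HasSum (fun j => c j * h j) (∫ t in (0 : ℝ)..T,
        ((t * (T - t) : ℝ) : ℂ) * Complex.exp (Complex.I * (lam k * t : ℝ)) * expSum lam c t) := by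
      have := intervalIntegral.hasSum_integral_of_dominated_convergence (μ := volume)
        (a := 0) (b := T)
        (F := fun (j : ℤ) (t : ℝ) => ((t * (T - t) : ℝ) : ℂ) *
          Complex.exp (Complex.I * (lam k * t : ℝ)) *
          (c j * Complex.exp (-(Complex.I * (lam j * t : ℝ)))))
        (f := fun t => ((t * (T - t) : ℝ) : ℂ) * Complex.exp (Complex.I * (lam k * t : ℝ)) *
          expSum lam c t) (fun j t => T * T * ‖c j‖) ?_ ?_ ?_ ?_ ?_
      · have e : ∀ j, c j * h j = ∫ t in (0 : ℝ)..T, ((t * (T - t) : ℝ) : ℂ) *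
            Complex.exp (Complex.I * (lam k * t : ℝ)) *
            (c j * Complex.exp (-(Complex.I * (lam j * t : ℝ)))) := by
          intro j
          rw [hh, ← intervalIntegral.integral_const_mul]
          refine intervalIntegral.integral_congr fun t _ => ?_
          have : Complex.exp (Complex.I * ((lam k - lam j) * t : ℝ)) =
              Complex.exp (Complex.I * (lam k * t : ℝ)) *
                Complex.exp (-(Complex.I * (lam j * t : ℝ))) := by
            rw [← Complex.exp_add]; congr 1; push_cast; ring
          simp only [this]
          ring
        simpa only [e] using this
      · intro j
        exact Continuous.aestronglyMeasurable (by fun_prop)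
      · intro j
        refine Filter.Eventually.of_forall fun t ht => ?_
        rw [uIoc_of_le hT.le] at ht
        rw [norm_mul, norm_mul, norm_expSum_term, mul_comm Complex.I,
          Complex.norm_exp_ofReal_mul_I, mul_one, Complex.norm_real, Real.norm_of_nonneg
          (mul_nonneg ht.1.le (by linarith [ht.2]))]
        gcongr
        · linarith [ht.2]
        · exact ht.2
        · linarith [ht.1]
      · exact Filter.Eventually.of_forall fun t _ => hc.mul_left _
      · exact Continuous.intervalIntegrable continuous_const _ _
      · refine Filter.Eventually.of_forall fun t _ => ?_
        exact (summable_expSum lam hc t).hasSum.mul_left _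
    have hmom : ‖∫ t in (0 : ℝ)..T, ((t * (T - t) : ℝ) : ℂ) *
        Complex.exp (Complex.I * (lam k * t : ℝ)) * expSum lam c t‖ ≤ T ^ 2 * I₀ := by
      rw [hI₀, ← intervalIntegral.integral_const_mul]
      refine intervalIntegral.norm_integral_le_of_norm_le hT.le ?_
        (Continuous.intervalIntegrable (continuous_const.mul (continuous_expSum lam hc).norm) _ _)
      refine Filter.Eventually.of_forall fun t ht => ?_
      rw [norm_mul, norm_mul, mul_comm Complex.I,
          Complex.norm_exp_ofReal_mul_I, mul_one, Complex.norm_real, Real.norm_of_nonneg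
          (mul_nonneg ht.1.le (by linarith [ht.2]))]
      gcongr
      nlinarith [ht.1, ht.2]
    have hkk : h k = ((T ^ 3 / 6 : ℝ) : ℂ) := by
      rw [hh, ← integral_weight, ← intervalIntegral.integral_ofReal]
      simp
    have hoff : ∀ j, j ≠ k → ‖c j * h j‖ ≤ 4 * T / γ ^ 2 * M * (((j - k : ℤ) : ℝ) ^ 2)⁻¹ := by
      intro j hj
      by_cases hjA : j ∈ A
      swap
      · rw [hcA j hjA]; simp only [zero_mul, norm_zero]; positivity
      have h1 := hgap k hk j hjA
      have h2 : (0 : ℝ) < |(k : ℝ) - j| := by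
        rw [abs_pos, sub_ne_zero]; exact_mod_cast hj.symm
      have h3 : 0 < |lam k - lam j| := lt_of_lt_of_le (by positivity) h1
      have h4 := norm_integral_weight_le hT.le (abs_pos.1 h3)
      have h5 : (γ * |(k : ℝ) - j|) ^ 2 ≤ (lam k - lam j) ^ 2 := by
        rw [← sq_abs (lam k - lam j)]
        gcongr
      rw [norm_mul]
      calc ‖c j‖ * ‖h j‖ ≤ M * (4 * T / (lam k - lam j) ^ 2) := by
            gcongr
            exact hcM j
        _ ≤ M * (4 * T / (γ * |(k : ℝ) - j|) ^ 2) := by gcongr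
        _ = _ := by
            rw [mul_pow, sq_abs]
            push_cast
            rw [show ((j : ℝ) - k) ^ 2 = (k - j) ^ 2 by ring]
            have : (k : ℝ) - j ≠ 0 := abs_pos.1 h2
            field_simp
    -- separate the diagonal term
    have hsplit := hsum.summable.tsum_eq_add_tsum_ite k
    rw [hsum.tsum_eq, hkk] at hsplit
    have hrest : ‖∑' j, (if j = k then 0 else c j * h j)‖ ≤ T ^ 3 / 12 * M := by
      have hs2 : Summable fun j : ℤ => 4 * T / γ ^ 2 * M * (((j - k : ℤ) : ℝ) ^ 2)⁻¹ :=
        ((Equiv.subRight k).summable_iff.2 summable_inv_int_sq).mul_left _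
      refine (tsum_of_norm_bounded hs2.hasSum fun j => ?_).trans ?_
      · split_ifs with hj
        · rw [norm_zero]; positivity
        · exact hoff j hj
      · rw [tsum_mul_left]
        have : ∑' j : ℤ, (((j - k : ℤ) : ℝ) ^ 2)⁻¹ = ∑' p : ℤ, ((p : ℝ) ^ 2)⁻¹ :=
          (Equiv.subRight k).tsum_eq fun p : ℤ => ((p : ℝ) ^ 2)⁻¹
        rw [this]
        calc _ = 4 * T * (∑' p : ℤ, ((p : ℝ) ^ 2)⁻¹) / γ ^ 2 * M := by ring
          _ ≤ _ := by gcongr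
    have hfin : T ^ 3 / 6 * ‖c k‖ ≤ T ^ 2 * I₀ + T ^ 3 / 12 * M := by
      have e : c k * ((T ^ 3 / 6 : ℝ) : ℂ) = (∫ t in (0 : ℝ)..T, ((t * (T - t) : ℝ) : ℂ) *
        Complex.exp (Complex.I * (lam k * t : ℝ)) * expSum lam c t) -
        ∑' j, (if j = k then 0 else c j * h j) := by rw [hsplit]; ring
      have n1 : ‖c k * ((T ^ 3 / 6 : ℝ) : ℂ)‖ = T ^ 3 / 6 * ‖c k‖ := by
        rw [norm_mul, Complex.norm_real, Real.norm_of_nonneg (by positivity)]; ring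
      rw [← n1, e]
      exact (norm_sub_le _ _).trans (add_le_add hmom hrest)
    have hT3 : 0 < T ^ 3 / 6 := by positivity
    refine le_of_mul_le_mul_left (hfin.trans (le_of_eq ?_)) hT3
    field_simp
    ring
  have : M ≤ 6 / T * I₀ + M / 2 := ciSup_le row
  calc ‖c k‖ ≤ M := hcM k
    _ ≤ 2 * (6 / T * I₀) := by linarith
    _ = _ := by ring

/-- One frequency `λ(m)` can be added at the cost of an arbitrarily small amount of time: the
operator `f ↦ f(· + δ) - e^{-iλ(m)δ} f` kills it and keeps the frequency `λ(m₀)`. -/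
theorem exists_norm_coeff_le_insert {lam : ℤ → ℝ} {A : Set ℤ} {T₁ T₂ : ℝ} {m₀ m : ℤ}
    (hT : T₁ < T₂) (hT₁ : 0 ≤ T₁) (hne : lam m ≠ lam m₀)
    (h : ∃ K : ℝ, 0 ≤ K ∧ ∀ c : ℤ → ℂ, (Summable fun k => ‖c k‖) → (∀ k ∉ A, c k = 0) →
      ‖c m₀‖ ≤ K * ∫ t in (0 : ℝ)..T₁, ‖expSum lam c t‖) :
    ∃ K : ℝ, 0 ≤ K ∧ ∀ c : ℤ → ℂ, (Summable fun k => ‖c k‖) → (∀ k ∉ insert m A, c k = 0) →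
      ‖c m₀‖ ≤ K * ∫ t in (0 : ℝ)..T₂, ‖expSum lam c t‖ := by
  obtain ⟨K, hK, h⟩ := h
  have hd : 0 < |lam m₀ - lam m| := abs_pos.2 (sub_ne_zero.2 hne.symm)
  set δ := min (T₂ - T₁) (π / |lam m₀ - lam m|) with hδ
  have hδ0 : 0 < δ := lt_min (by linarith) (by positivity)
  have hδ1 : δ ≤ T₂ - T₁ := min_le_left _ _
  have hδ2 : |lam m₀ - lam m| * δ ≤ π := by
    calc _ ≤ |lam m₀ - lam m| * (π / |lam m₀ - lam m|) := by gcongr; exact min_le_right _ _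
      _ = π := by field_simp
  set z : ℤ → ℂ := fun k => Complex.exp (-(Complex.I * (lam k * δ : ℝ))) with hz
  have hz1 : ∀ k, ‖z k‖ = 1 := fun k => norm_exp_neg_I_mul _
  -- `δ` is so small that the two exponentials do not coincide at time `δ`
  have hzne : z m₀ - z m ≠ 0 := by
    rw [sub_ne_zero]
    intro he
    obtain ⟨n, hn⟩ := Complex.exp_eq_exp_iff_exists_int.1 he
    have h1 : (lam m₀ - lam m) * δ = -(n * (2 * π)) := by
      have h2 : Complex.I * (((lam m₀ - lam m) * δ : ℝ) : ℂ) =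
          Complex.I * ((-(n * (2 * π)) : ℝ) : ℂ) := by
        push_cast at hn ⊢
        linear_combination -hn
      exact_mod_cast mul_left_cancel₀ Complex.I_ne_zero h2
    have h3 : |(lam m₀ - lam m) * δ| = |(n : ℝ)| * (2 * π) := by
      rw [h1, abs_neg, abs_mul, abs_of_pos Real.two_pi_pos]
    rw [abs_mul, abs_of_pos hδ0] at h3
    have hn0 : n ≠ 0 := by
      rintro rfl
      simp only [Int.cast_zero, abs_zero, zero_mul] at h3
      have := mul_pos hd hδ0
      linarith
    have h4 : (1 : ℝ) ≤ |(n : ℝ)| := by exact_mod_cast Int.one_le_abs hn0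
    nlinarith [Real.pi_pos]
  refine ⟨‖z m₀ - z m‖⁻¹ * (K * 2), by positivity, fun c hc hcA => ?_⟩
  set c' : ℤ → ℂ := fun k => c k * (z k - z m) with hc'
  have hzb : ∀ k, ‖z k - z m‖ ≤ 2 := fun k => by
    refine (norm_sub_le _ _).trans ?_
    rw [hz1, hz1]; norm_num
  have hc's : Summable fun k => ‖c' k‖ := by
    refine Summable.of_nonneg_of_le (fun _ => norm_nonneg _) (fun k => ?_) (hc.mul_right 2)
    rw [hc', norm_mul]
    gcongr
    exact hzb k
  have hf : ∀ t, expSum lam c' t = expSum lam c (t + δ) - z m * expSum lam c t := by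
    intro t
    unfold expSum
    rw [← tsum_mul_left, ← (summable_expSum lam hc (t + δ)).tsum_sub
      ((summable_expSum lam hc t).mul_left _)]
    refine tsum_congr fun k => ?_
    have : Complex.exp (-(Complex.I * (lam k * (t + δ) : ℝ))) =
        z k * Complex.exp (-(Complex.I * (lam k * t : ℝ))) := by
      rw [hz, ← Complex.exp_add]; congr 1; push_cast; ring
    rw [this, hc']
    ring
  have hcont := (continuous_expSum lam hc).norm
  have key := h c' hc's fun k hk => by
    by_cases hkm : k = m
    · simp [hc', hkm]
    · simp [hc', hcA k (by simp [hk, hkm])]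
  have hint : ∫ t in (0 : ℝ)..T₁, ‖expSum lam c' t‖ ≤ 2 * ∫ t in (0 : ℝ)..T₂, ‖expSum lam c t‖ := by
    have hi : ∀ a b : ℝ, IntervalIntegrable (fun t => ‖expSum lam c t‖) volume a b :=
      fun a b => hcont.intervalIntegrable a b
    have m1 : ∫ t in (0 : ℝ)..T₁, ‖expSum lam c (t + δ)‖ ≤
        ∫ t in (0 : ℝ)..T₂, ‖expSum lam c t‖ := by
      rw [intervalIntegral.integral_comp_add_right (fun t => ‖expSum lam c t‖)]
      refine intervalIntegral.integral_mono_interval (by linarith) (by linarith) (by linarith)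
        (Filter.Eventually.of_forall fun _ => norm_nonneg _) (hi _ _)
    have m2 : ∫ t in (0 : ℝ)..T₁, ‖expSum lam c t‖ ≤ ∫ t in (0 : ℝ)..T₂, ‖expSum lam c t‖ :=
      intervalIntegral.integral_mono_interval le_rfl hT₁ hT.le
        (Filter.Eventually.of_forall fun _ => norm_nonneg _) (hi _ _)
    have c1 : Continuous fun t => ‖expSum lam c (t + δ)‖ := hcont.comp (by fun_prop)
    calc ∫ t in (0 : ℝ)..T₁, ‖expSum lam c' t‖
        ≤ ∫ t in (0 : ℝ)..T₁, (‖expSum lam c (t + δ)‖ + ‖expSum lam c t‖) := by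
          refine intervalIntegral.integral_mono hT₁
            ((continuous_expSum lam hc's).norm.intervalIntegrable _ _)
            ((c1.add hcont).intervalIntegrable _ _) fun t => ?_
          simp only [hf]
          refine (norm_sub_le _ _).trans ?_
          rw [norm_mul, hz1, one_mul]
      _ = _ := intervalIntegral.integral_add (c1.intervalIntegrable _ _) (hi _ _)
      _ ≤ _ := by linarith
  have hpos : 0 < ‖z m₀ - z m‖ := norm_pos_iff.2 hzne
  have e : ‖c' m₀‖ = ‖c m₀‖ * ‖z m₀ - z m‖ := norm_mul _ _
  rw [e] at key
  have key2 : ‖c m₀‖ * ‖z m₀ - z m‖ ≤ K * (2 * ∫ t in (0 : ℝ)..T₂, ‖expSum lam c t‖) :=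
    key.trans (by gcongr)
  calc ‖c m₀‖ = ‖z m₀ - z m‖⁻¹ * (‖c m₀‖ * ‖z m₀ - z m‖) := by field_simp
    _ ≤ ‖z m₀ - z m‖⁻¹ * (K * (2 * ∫ t in (0 : ℝ)..T₂, ‖expSum lam c t‖)) := by gcongr
    _ = _ := by ring

/-- If the gaps between the frequencies tend to infinity, each coefficient of a nonharmonic Fourier
series is controlled by the function on any time interval. -/
theorem exists_norm_coeff_le {lam : ℤ → ℝ} (hinj : Function.Injective lam)
    (hgap : ∀ γ : ℝ, ∃ K₀ : ℕ, ∀ j k : ℤ, (K₀ : ℤ) ≤ max |j| |k| →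
      γ * |(j : ℝ) - k| ≤ |lam j - lam k|) {T : ℝ} (hT : 0 < T) (m₀ : ℤ) :
    ∃ K : ℝ, 0 ≤ K ∧ ∀ c : ℤ → ℂ, (Summable fun k => ‖c k‖) →
      ‖c m₀‖ ≤ K * ∫ t in (0 : ℝ)..T, ‖expSum lam c t‖ := by
  set T₁ := T / 2 with hT₁
  have hT₁0 : 0 < T₁ := by positivity
  set Z := ∑' p : ℤ, ((p : ℝ) ^ 2)⁻¹ with hZ
  have hZ0 : 0 ≤ Z := tsum_nonneg fun _ => by positivity
  -- with this `γ` the Gram matrix on `[0, T / 2]` is diagonally dominant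
  set γ := √(48 * Z / T₁ ^ 2 + 1) with hγ
  have hγ0 : 0 < γ := sqrt_pos.2 (by positivity)
  have hbig : 4 * T₁ * Z / γ ^ 2 ≤ T₁ ^ 3 / 12 := by
    rw [hγ, Real.sq_sqrt (by positivity), div_le_iff₀ (by positivity)]
    have : T₁ ^ 3 / 12 * (48 * Z / T₁ ^ 2 + 1) = 4 * T₁ * Z + T₁ ^ 3 / 12 := by
      field_simp
      ring
    rw [this]
    have : 0 ≤ T₁ ^ 3 / 12 := by positivity
    linarith
  obtain ⟨K₀, hK₀⟩ := hgap γ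
  set A : Set ℤ := {k | (K₀ : ℤ) ≤ |k| ∨ k = m₀} with hA
  have hgapA : ∀ j ∈ A, ∀ k ∈ A, γ * |(j : ℝ) - k| ≤ |lam j - lam k| := by
    intro j hj k hk
    by_cases hjk : j = k
    · simp [hjk]
    · apply hK₀
      rcases hj with hj | hj
      · exact le_max_of_le_left hj
      · rcases hk with hk | hk
        · exact le_max_of_le_right hk
        · exact absurd (hj.trans hk.symm) hjk
  -- the low frequencies are added one by one, while the interval grows from `T / 2` to `T`
  have step : ∀ F : Finset ℤ, m₀ ∉ F → ∀ T₂ : ℝ, T₁ < T₂ → ∃ K : ℝ, 0 ≤ K ∧ ∀ c : ℤ → ℂ,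
      (Summable fun k => ‖c k‖) → (∀ k ∉ (F : Set ℤ) ∪ A, c k = 0) →
      ‖c m₀‖ ≤ K * ∫ t in (0 : ℝ)..T₂, ‖expSum lam c t‖ := by
    intro F
    induction F using Finset.induction_on with
    | empty =>
      intro _ T₂ hT₂
      refine ⟨12 / T₁, by positivity, fun c hc hcA => ?_⟩
      refine (norm_coeff_le_of_gap hT₁0 hγ0 hgapA hbig hc (by simpa using hcA) m₀).trans ?_
      gcongr
      exact intervalIntegral.integral_mono_interval le_rfl hT₁0.le hT₂.le
        (Filter.Eventually.of_forall fun _ => norm_nonneg _)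
        ((continuous_expSum lam hc).norm.intervalIntegrable _ _)
    | insert m F _ ih =>
      intro hm T₂ hT₂
      rw [Finset.mem_insert, not_or] at hm
      have := exists_norm_coeff_le_insert (lam := lam) (m := m) (T₁ := (T₁ + T₂) / 2) (T₂ := T₂)
        (by linarith) (by linarith) (fun h => hm.1 (hinj h).symm)
        (ih hm.2 ((T₁ + T₂) / 2) (by linarith))
      rwa [← Set.insert_union, ← Finset.coe_insert] at this
  obtain ⟨K, hK, h⟩ := step ((Finset.Icc (-(K₀ : ℤ)) K₀).erase m₀) (by simp) T (by
    rw [hT₁]; linarith)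
  refine ⟨K, hK, fun c hc => h c hc fun k hk => ?_⟩
  exfalso
  apply hk
  by_cases h1 : (K₀ : ℤ) ≤ |k|
  · exact Or.inr (Or.inl h1)
  · by_cases h2 : k = m₀
    · exact Or.inr (Or.inr h2)
    · left
      push Not at h1
      have := abs_lt.1 h1
      rw [Finset.mem_coe, Finset.mem_erase, Finset.mem_Icc]
      exact ⟨h2, by omega, by omega⟩

theorem freq_injective {g b : ℝ} (hg : 0 < g) (hb : 0 < b) : Function.Injective (freq g b) := by
  refine StrictMono.injective fun k n hkn => ?_
  have h := gapConst_mul_le_freq_sub hg hb hkn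
  have hc := gapConst_pos hg hb
  have h1 : (0 : ℝ) < (n : ℝ) - k := by
    rw [sub_pos]; exact_mod_cast hkn
  have h2 : (1 : ℝ) ≤ max |(n : ℝ)| |(k : ℝ)| := one_le_max_abs (by omega)
  have h3 : 0 < √(max |(n : ℝ)| |(k : ℝ)|) := sqrt_pos.2 (by linarith)
  have : 0 < gapConst g b / 2 * (((n : ℝ) - k) * √(max |(n : ℝ)| |(k : ℝ)|)) := by positivity
  linarith

theorem exists_gap_freq {g b : ℝ} (hg : 0 < g) (hb : 0 < b) (γ : ℝ) :
    ∃ K₀ : ℕ, ∀ j k : ℤ, (K₀ : ℤ) ≤ max |j| |k| →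
      γ * |(j : ℝ) - k| ≤ |freq g b j - freq g b k| := by
  have hc := gapConst_pos hg hb
  obtain ⟨K₀, hK₀⟩ := exists_nat_ge ((2 * γ / gapConst g b) ^ 2)
  have main : ∀ j k : ℤ, k < j → (K₀ : ℤ) ≤ max |j| |k| →
      γ * |(j : ℝ) - k| ≤ |freq g b j - freq g b k| := by
    intro j k hkj hmax
    have h := gapConst_mul_le_freq_sub hg hb hkj
    have h1 : (0 : ℝ) < (j : ℝ) - k := by rw [sub_pos]; exact_mod_cast hkj
    have h2 : (K₀ : ℝ) ≤ max |(j : ℝ)| |(k : ℝ)| := by exact_mod_cast hmax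
    have h3 : 2 * γ / gapConst g b ≤ √(max |(j : ℝ)| |(k : ℝ)|) := by
      apply Real.le_sqrt_of_sq_le
      linarith
    rw [abs_of_pos h1]
    refine le_trans ?_ (h.trans (le_abs_self _))
    calc γ * ((j : ℝ) - k) = gapConst g b / 2 * (((j : ℝ) - k) * (2 * γ / gapConst g b)) := by
          field_simp
      _ ≤ _ := by gcongr
  refine ⟨K₀, fun j k h => ?_⟩
  rcases lt_trichotomy j k with hjk | hjk | hjk
  · rw [abs_sub_comm, abs_sub_comm (freq g b j)]
    exact main k j hjk (by rwa [max_comm])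
  · simp [hjk]
  · exact main j k hjk h

/-! ### Low frequencies -/

/-- A solution stays close to the free solution with the same data, coefficient by coefficient. -/
theorem norm_sub_free_le {κ : ℤ → ℝ} {ε B T : ℝ} {ℓ : ℤ → ℝ} {u r a : ℝ → ℤ → ℂ}
    (h0 : ∀ p, 0 ≤ κ p) (hs : Summable κ) (hε : 0 < ε) (ha : IsEvolution κ ε B T ℓ u r a) {t : ℝ}
    (ht : t ∈ Icc 0 T) (n : ℤ) :
    ‖a t n - a 0 n * Complex.exp (-(Complex.I * (ℓ n * t : ℝ)))‖ ≤
      (1 + |(n : ℝ)|) * (ε * ((∑' p, κ p) + 1) * √B * T) := by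
  have hT : (0 : ℝ) ≤ T := ht.1.trans ht.2
  have hS : 0 ≤ ∑' p, κ p := tsum_nonneg h0
  have hB : 0 ≤ B := (tsum_nonneg fun _ => by positivity).trans (ha.a_le t ht)
  -- the integrating factor of the free equation
  set E : ℝ → ℂ := fun x => Complex.exp (Complex.I * (ℓ n * x : ℝ)) with hE
  have hEn : ∀ x, ‖E x‖ = 1 := fun x => by
    simp only [hE]; rw [mul_comm Complex.I]; exact Complex.norm_exp_ofReal_mul_I _
  have hEd : ∀ x, HasDerivAt E (E x * (Complex.I * ℓ n)) x := by
    intro x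
    have h1 : HasDerivAt (fun x : ℝ => Complex.I * ((ℓ n * x : ℝ) : ℂ)) (Complex.I * ℓ n) x := by
      have := ((hasDerivAt_id x).const_mul (ℓ n)).ofReal_comp.const_mul Complex.I
      simpa using this
    exact h1.cexp
  have hder : ∀ x ∈ Icc 0 T, HasDerivWithinAt (fun y => a y n * E y)
      (-(transport (u x) (a x) n + r x n) * E x) (Icc 0 T) x := by
    intro x hx
    refine ((ha.deriv n x hx).mul (hEd x).hasDerivWithinAt).congr_deriv ?_
    ring
  have hb : ∀ x ∈ Icc 0 T, ‖-(transport (u x) (a x) n + r x n) * E x‖ ≤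
      (1 + |(n : ℝ)|) * (ε * ((∑' p, κ p) + 1) * √B) := by
    intro x hx
    rw [norm_mul, hEn, mul_one, norm_neg]
    have h1 := (summable_transport hε.le h0 hs (ha.u_le x hx)
      (norm_le_sqrt_of_tsum_sq_le (ha.summable_a x hx) (ha.a_le x hx)) n).2
    have h2 := norm_le_sqrt_of_tsum_sq_le (ha.summable_r x hx) (ha.r_le x hx) n
    rw [Real.sqrt_mul (by positivity), Real.sqrt_sq hε.le] at h2
    have h3 : 0 ≤ |(n : ℝ)| * (ε * √B) := by positivity
    calc _ ≤ _ := norm_add_le _ _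
      _ ≤ (1 + |(n : ℝ)|) * (ε * ((∑' p, κ p) * √B)) + ε * √B := add_le_add h1 h2
      _ ≤ _ := by nlinarith
  have key := (convex_Icc 0 T).norm_image_sub_le_of_norm_hasDerivWithin_le hder hb
    (left_mem_Icc.2 hT) ht
  have hE0 : E 0 = 1 := by simp [hE]
  have hinv : Complex.exp (-(Complex.I * (ℓ n * t : ℝ))) * E t = 1 := by
    rw [hE, ← Complex.exp_add, neg_add_cancel, Complex.exp_zero]
  have e : a t n * E t - a 0 n * E 0 =
      (a t n - a 0 n * Complex.exp (-(Complex.I * (ℓ n * t : ℝ)))) * E t := by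
    rw [sub_mul, mul_assoc, hinv, hE0]
  rw [e, norm_mul, hEn, mul_one] at key
  refine key.trans ?_
  rw [sub_zero, Real.norm_of_nonneg ht.1]
  calc _ ≤ (1 + |(n : ℝ)|) * (ε * ((∑' p, κ p) + 1) * √B) * T := by
        gcongr
        exact ht.2
    _ = _ := by ring

/-- The value `∑ₙ (p(n) a(n) + p(-n) conj a(n)) / 2` of `∫ φ Re w`, where `p(n) = ∫ φ e^{inx}` and
`a` are the Fourier coefficients of `w`. -/
def realPairing (p a : ℤ → ℂ) : ℂ := ∑' n, (p n * a n + p (-n) * conj (a n)) / 2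

theorem summable_realPairing_bound {p : ℤ → ℂ} (hp : Summable fun n : ℤ => (1 + |(n : ℝ)|) * ‖p n‖)
    (M : ℝ) : Summable (fun n : ℤ => (‖p n‖ + ‖p (-n)‖) / 2 * ((1 + |(n : ℝ)|) * M)) ∧
    ∑' n : ℤ, (‖p n‖ + ‖p (-n)‖) / 2 * ((1 + |(n : ℝ)|) * M) =
      (∑' n : ℤ, (1 + |(n : ℝ)|) * ‖p n‖) * M := by
  have h2 : HasSum (fun n : ℤ => (1 + |(n : ℝ)|) * ‖p (-n)‖)
      (∑' n : ℤ, (1 + |(n : ℝ)|) * ‖p n‖) := by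
    have := (Equiv.neg ℤ).hasSum_iff.2 hp.hasSum
    simpa [Function.comp_def] using this
  have h := ((hp.hasSum.add h2).div_const 2).mul_right M
  have e : (fun n : ℤ => (‖p n‖ + ‖p (-n)‖) / 2 * ((1 + |(n : ℝ)|) * M)) =
      fun n : ℤ => ((1 + |(n : ℝ)|) * ‖p n‖ + (1 + |(n : ℝ)|) * ‖p (-n)‖) / 2 * M := by
    funext n; ring
  rw [e]
  refine ⟨h.summable, h.tsum_eq.trans ?_⟩
  ring

theorem norm_realPairing_term_le (p a : ℤ → ℂ) (n : ℤ) :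
    ‖(p n * a n + p (-n) * conj (a n)) / 2‖ ≤ (‖p n‖ + ‖p (-n)‖) / 2 * ‖a n‖ := by
  rw [norm_div, Complex.norm_ofNat]
  have := norm_add_le (p n * a n) (p (-n) * conj (a n))
  rw [norm_mul, norm_mul, RCLike.norm_conj] at this
  linarith

theorem le_one_add_abs_mul {M : ℝ} (hM : 0 ≤ M) (n : ℤ) : M ≤ (1 + |(n : ℝ)|) * M := by
  nlinarith [abs_nonneg (n : ℝ)]

theorem summable_realPairing {p a : ℤ → ℂ} (hp : Summable fun n : ℤ => (1 + |(n : ℝ)|) * ‖p n‖)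
    {M : ℝ} (ha : ∀ n, ‖a n‖ ≤ (1 + |(n : ℝ)|) * M) :
    Summable (fun n => (p n * a n + p (-n) * conj (a n)) / 2) ∧
    ‖realPairing p a‖ ≤ (∑' n : ℤ, (1 + |(n : ℝ)|) * ‖p n‖) * M := by
  obtain ⟨h1, h2⟩ := summable_realPairing_bound hp M
  have hb : ∀ n, ‖(p n * a n + p (-n) * conj (a n)) / 2‖ ≤
      (‖p n‖ + ‖p (-n)‖) / 2 * ((1 + |(n : ℝ)|) * M) := fun n =>
    (norm_realPairing_term_le p a n).trans (by gcongr; exact ha n)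
  refine ⟨Summable.of_norm_bounded h1 hb, ?_⟩
  rw [← h2]
  exact tsum_of_norm_bounded h1.hasSum hb

/-- The coefficients of `∫ φ Re w`, for a free wave `w` with data `α`, as an almost periodic
function with the frequencies `freq`. -/
def freqCoeff (p α : ℤ → ℂ) (n : ℤ) : ℂ :=
  if 0 < n then (p n * α n + p (-n) * α (-n)) / 2
  else if n < 0 then (p (-n) * conj (α n) + p n * conj (α (-n))) / 2
  else p 0 * (α 0).re

theorem summable_freqCoeff {p α : ℤ → ℂ} (hp : Summable fun n : ℤ => (1 + |(n : ℝ)|) * ‖p n‖)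
    {M : ℝ} (hα : ∀ n, ‖α n‖ ≤ M) : Summable fun n => ‖freqCoeff p α n‖ := by
  have hM : 0 ≤ M := (norm_nonneg _).trans (hα 0)
  refine Summable.of_nonneg_of_le (fun _ => norm_nonneg _) (fun n => ?_)
    ((summable_realPairing_bound hp (2 * M)).1)
  have h1 : M ≤ (1 + |(n : ℝ)|) * M := le_one_add_abs_mul hM n
  have hmain : ‖freqCoeff p α n‖ ≤ (‖p n‖ + ‖p (-n)‖) * M := by
    have aux : ∀ x y : ℂ, ‖x‖ ≤ M → ‖y‖ ≤ M → ∀ i j : ℤ,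
        ‖(p i * x + p j * y) / 2‖ ≤ (‖p i‖ + ‖p j‖) * M := by
      intro x y hx hy i j
      rw [norm_div, Complex.norm_ofNat]
      have h2 := norm_add_le (p i * x) (p j * y)
      rw [norm_mul, norm_mul] at h2
      have h3 : ‖p i‖ * ‖x‖ ≤ ‖p i‖ * M := by gcongr
      have h4 : ‖p j‖ * ‖y‖ ≤ ‖p j‖ * M := by gcongr
      have : 0 ≤ (‖p i‖ + ‖p j‖) * M := by positivity
      linarith
    unfold freqCoeff
    split_ifs with h2 h3
    · exact aux _ _ (hα _) (hα _) _ _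
    · rw [add_comm ‖p n‖]
      exact aux _ _ (by rw [RCLike.norm_conj]; exact hα _)
        (by rw [RCLike.norm_conj]; exact hα _) _ _
    · have : n = 0 := by omega
      subst this
      rw [norm_mul, Complex.norm_real, neg_zero]
      have h4 : ‖(α 0).re‖ ≤ M := (Complex.abs_re_le_norm _).trans (hα 0)
      have h5 : 0 ≤ ‖p 0‖ * M := by positivity
      have h6 : ‖p 0‖ * ‖(α 0).re‖ ≤ ‖p 0‖ * M := by gcongr
      linarith
  refine hmain.trans ?_
  have : 0 ≤ ‖p n‖ + ‖p (-n)‖ := by positivity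
  nlinarith

theorem tsum_int_eq_of_symm {F G : ℤ → ℂ} (hF : Summable F) (hG : Summable G)
    (h : ∀ n, 0 ≤ n → F n + F (-n) = G n + G (-n)) : ∑' n, F n = ∑' n, G n := by
  have hF' : HasSum (fun n => F (-n)) (∑' n, F n) := (Equiv.neg ℤ).hasSum_iff.2 hF.hasSum
  have hG' : HasSum (fun n => G (-n)) (∑' n, G n) := (Equiv.neg ℤ).hasSum_iff.2 hG.hasSum
  have e : (fun n => F n + F (-n)) = fun n => G n + G (-n) := by
    funext n
    rcases le_total 0 n with hn | hn
    · exact h n hn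
    · have := h (-n) (by omega)
      rw [neg_neg] at this
      rw [add_comm, this, add_comm]
  have h1 := hF.hasSum.add hF'
  have h2 := hG.hasSum.add hG'
  rw [e] at h1
  have h3 := h1.unique h2
  have h4 : (2 : ℂ) * ∑' n, F n = 2 * ∑' n, G n := by rw [two_mul, two_mul]; exact h3
  exact mul_left_cancel₀ two_ne_zero h4

/-- Along a free wave the pairing is almost periodic: the terms of `n` and `-n`, which oscillate
with both signs of `ℓ(n)`, are regrouped by their frequencies. -/
theorem realPairing_free {g b : ℝ} {p α : ℤ → ℂ}
    (hp : Summable fun n : ℤ => (1 + |(n : ℝ)|) * ‖p n‖) {M : ℝ} (hα : ∀ n, ‖α n‖ ≤ M) (t : ℝ) :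
    realPairing p (fun n => α n * Complex.exp (-(Complex.I * (disp g b n * t : ℝ)))) =
      expSum (freq g b) (freqCoeff p α) t := by
  have hM : 0 ≤ M := (norm_nonneg _).trans (hα 0)
  refine tsum_int_eq_of_symm (summable_realPairing hp (M := M) fun n => ?_).1
    (summable_expSum _ (summable_freqCoeff hp hα) t) ?_
  · rw [norm_mul, norm_exp_neg_I_mul, mul_one]
    exact (hα n).trans (le_one_add_abs_mul hM n)
  · intro n hn
    have hconj : ∀ x : ℝ, conj (Complex.exp (-(Complex.I * (x : ℂ)))) =
        Complex.exp (Complex.I * (x : ℂ)) := by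
      intro x
      rw [← Complex.exp_conj]
      simp
    simp only [map_mul, hconj, disp_neg, freq_neg, freq_of_nonneg g b hn, neg_neg]
    rcases hn.eq_or_lt with rfl | hpos
    · simp only [disp_zero, freqCoeff, neg_zero, lt_irrefl, if_false, zero_mul,
        Complex.ofReal_zero, mul_zero, Complex.exp_zero, mul_one]
      have : α 0 + conj (α 0) = 2 * ((α 0).re : ℂ) := by
        rw [Complex.add_conj]; push_cast; ring
      linear_combination p 0 * this
    · simp only [freqCoeff, if_pos hpos, show ¬ (0 < -n) by omega, if_false,
        if_pos (show -n < 0 by omega), neg_neg]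
      have e : Complex.exp (-(Complex.I * ((-disp g b n * t : ℝ) : ℂ))) =
          Complex.exp (Complex.I * ((disp g b n * t : ℝ) : ℂ)) := by
        congr 1; push_cast; ring
      rw [e]
      ring

theorem continuousOn_realPairing {κ : ℤ → ℝ} {ε B T : ℝ} {ℓ : ℤ → ℝ} {u r a : ℝ → ℤ → ℂ}
    (ha : IsEvolution κ ε B T ℓ u r a) {p : ℤ → ℂ}
    (hp : Summable fun n : ℤ => (1 + |(n : ℝ)|) * ‖p n‖) :
    ContinuousOn (fun t => realPairing p (a t)) (Icc 0 T) := by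
  refine continuousOn_tsum (fun n => ?_) (summable_realPairing_bound hp √B).1 fun n t ht => ?_
  · refine ContinuousOn.div_const (ContinuousOn.add ?_ ?_) _
    · exact continuousOn_const.mul (ha.continuousOn n)
    · exact continuousOn_const.mul (Complex.continuous_conj.comp_continuousOn (ha.continuousOn n))
  · refine (norm_realPairing_term_le p (a t) n).trans ?_
    gcongr
    exact (norm_le_sqrt_of_tsum_sq_le (ha.summable_a t ht) (ha.a_le t ht) n).trans
      (le_one_add_abs_mul (Real.sqrt_nonneg _) n)

/-- The coefficients of the trace of the free wave are controlled by the observation of a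
perturbed wave with the same data. -/
theorem exists_norm_freqCoeff_le {g b : ℝ} (hg : 0 < g) (hb : 0 < b) {κ : ℤ → ℝ}
    (h0 : ∀ p, 0 ≤ κ p) (hs : Summable κ) {T : ℝ} (hT : 0 < T) {p : ℤ → ℂ}
    (hp : Summable fun n : ℤ => (1 + |(n : ℝ)|) * ‖p n‖) (m : ℤ) :
    ∃ K : ℝ, 0 ≤ K ∧ ∀ (ε B : ℝ) (u r a : ℝ → ℤ → ℂ), 0 < ε →
      IsEvolution κ ε B T (disp g b) u r a →
      ‖freqCoeff p (a 0) m‖ ≤ K * ((∫ t in (0 : ℝ)..T, ‖realPairing p (a t)‖) + ε * √B) := by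
  obtain ⟨K, hK, h⟩ := exists_norm_coeff_le (freq_injective hg hb) (exists_gap_freq hg hb) hT m
  have hS : 0 ≤ ∑' p, κ p := tsum_nonneg h0
  set P := ∑' n : ℤ, (1 + |(n : ℝ)|) * ‖p n‖ with hP
  have hP0 : 0 ≤ P := tsum_nonneg fun _ => by positivity
  set K₁ := P * (((∑' p, κ p) + 1) * T) * T with hK₁
  have hK₁0 : 0 ≤ K₁ := by positivity
  refine ⟨K * (1 + K₁), by positivity, fun ε B u r a hε ha => ?_⟩
  have h0T : (0 : ℝ) ∈ Icc 0 T := left_mem_Icc.2 hT.le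
  have hα := norm_le_sqrt_of_tsum_sq_le (ha.summable_a 0 h0T) (ha.a_le 0 h0T)
  have hsum := summable_freqCoeff hp hα
  have hB := Real.sqrt_nonneg B
  have hcont := (continuousOn_realPairing ha hp).norm
  have hint : IntervalIntegrable (fun t => ‖realPairing p (a t)‖) volume 0 T :=
    ContinuousOn.intervalIntegrable (by rwa [uIcc_of_le hT.le])
  have pt : ∀ t ∈ Icc 0 T, ‖expSum (freq g b) (freqCoeff p (a 0)) t‖ ≤
      ‖realPairing p (a t)‖ + P * (ε * ((∑' p, κ p) + 1) * √B * T) := by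
    intro t ht
    rw [← realPairing_free hp hα]
    have d := (summable_realPairing hp (M := ε * ((∑' p, κ p) + 1) * √B * T)
      fun n => norm_sub_free_le h0 hs hε ha ht n).2
    have s1 := (summable_realPairing hp (M := √B) (a := a t) fun n =>
      (norm_le_sqrt_of_tsum_sq_le (ha.summable_a t ht) (ha.a_le t ht) n).trans
        (le_one_add_abs_mul hB n)).1
    have s2 := (summable_realPairing hp (M := √B)
      (a := fun n => a 0 n * Complex.exp (-(Complex.I * (disp g b n * t : ℝ)))) fun n => by
        rw [norm_mul, norm_exp_neg_I_mul, mul_one]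
        exact (hα n).trans (le_one_add_abs_mul hB n)).1
    have e : realPairing p (fun n => a t n -
        a 0 n * Complex.exp (-(Complex.I * (disp g b n * t : ℝ)))) = realPairing p (a t) -
        realPairing p fun n => a 0 n * Complex.exp (-(Complex.I * (disp g b n * t : ℝ))) := by
      unfold realPairing
      rw [← s1.tsum_sub s2]
      refine tsum_congr fun n => ?_
      rw [map_sub]
      ring
    rw [e, norm_sub_rev] at d
    have := norm_le_norm_add_norm_sub' (realPairing p fun n =>
      a 0 n * Complex.exp (-(Complex.I * (disp g b n * t : ℝ)))) (realPairing p (a t))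
    linarith
  have hI : ∫ t in (0 : ℝ)..T, ‖expSum (freq g b) (freqCoeff p (a 0)) t‖ ≤
      (∫ t in (0 : ℝ)..T, ‖realPairing p (a t)‖) + K₁ * (ε * √B) := by
    calc _ ≤ ∫ t in (0 : ℝ)..T,
          (‖realPairing p (a t)‖ + P * (ε * ((∑' p, κ p) + 1) * √B * T)) :=
          intervalIntegral.integral_mono_on hT.le
            ((continuous_expSum _ hsum).norm.intervalIntegrable _ _)
            (hint.add (continuous_const.intervalIntegrable _ _)) pt
      _ = _ := by
          rw [intervalIntegral.integral_add hint (continuous_const.intervalIntegrable _ _),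
            intervalIntegral.integral_const, smul_eq_mul, hK₁]
          ring
  have hI0 : 0 ≤ ∫ t in (0 : ℝ)..T, ‖realPairing p (a t)‖ :=
    intervalIntegral.integral_nonneg hT.le fun _ _ => norm_nonneg _
  calc _ ≤ K * ∫ t in (0 : ℝ)..T, ‖expSum (freq g b) (freqCoeff p (a 0)) t‖ := h _ hsum
    _ ≤ K * ((∫ t in (0 : ℝ)..T, ‖realPairing p (a t)‖) + K₁ * (ε * √B)) := by gcongr
    _ ≤ K * ((1 + K₁) * ((∫ t in (0 : ℝ)..T, ‖realPairing p (a t)‖) + ε * √B)) := by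
        gcongr
        have : 0 ≤ ε * √B := by positivity
        nlinarith [mul_nonneg hK₁0 hI0]
    _ = _ := by ring

/-! ### Fourier series on the torus -/

theorem fourier_eq_exp (n : ℤ) (x : ℝ) :
    fourier n (x : Torus) = Complex.exp (Complex.I * (n * x : ℝ)) := by
  rw [fourier_coe_apply]
  congr 1
  push_cast
  have : (π : ℂ) ≠ 0 := by exact_mod_cast Real.pi_ne_zero
  field_simp

theorem fourierCoeff_conj (f : Torus → ℂ) (n : ℤ) :
    fourierCoeff (fun x => conj (f x)) n = conj (fourierCoeff f (-n)) := by
  unfold fourierCoeff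
  rw [← integral_conj]
  refine integral_congr_ae (Filter.Eventually.of_forall fun x => ?_)
  simp only [smul_eq_mul, map_mul, neg_neg, ← fourier_neg]

theorem fourierCoeff_fourier_mul (f : Torus → ℂ) (q n : ℤ) :
    fourierCoeff (fun x => fourier q x * f x) n = fourierCoeff f (n - q) := by
  unfold fourierCoeff
  refine integral_congr_ae (Filter.Eventually.of_forall fun x => ?_)
  simp only [smul_eq_mul]
  rw [← mul_assoc, ← fourier_add]
  congr 2
  ring_nf

/-- Parseval's identity. -/
theorem hasSum_fourierCoeff_mul_conj {f h : Torus → ℂ}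
    (hf : MemLp f 2 (AddCircle.haarAddCircle (T := 2 * π)))
    (hh : MemLp h 2 (AddCircle.haarAddCircle (T := 2 * π))) :
    HasSum (fun n => fourierCoeff f n * conj (fourierCoeff h n))
      (((2 * π : ℝ) : ℂ)⁻¹ * ∫ x, f x * conj (h x)) := by
  have key := (fourierBasis (T := 2 * π)).hasSum_inner_mul_inner (hh.toLp h) (hf.toLp f)
  have e1 : ∀ n, inner ℂ (fourierBasis (T := 2 * π) n) (hf.toLp f) = fourierCoeff f n := by
    intro n
    rw [← HilbertBasis.repr_apply_apply, fourierBasis_repr]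
    exact congrFun (fourierCoeff_congr_ae hf.coeFn_toLp) n
  have e2 : ∀ n, inner ℂ (hh.toLp h) (fourierBasis (T := 2 * π) n) = conj (fourierCoeff h n) := by
    intro n
    rw [← inner_conj_symm, ← HilbertBasis.repr_apply_apply, fourierBasis_repr]
    rw [fourierCoeff_congr_ae hh.coeFn_toLp]
  have e3 : inner ℂ (hh.toLp h) (hf.toLp f) = ((2 * π : ℝ) : ℂ)⁻¹ * ∫ x, f x * conj (h x) := by
    rw [L2.inner_def]
    have : ∫ x, inner ℂ (hh.toLp h x) (hf.toLp f x) ∂AddCircle.haarAddCircle =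
        ∫ x, f x * conj (h x) ∂AddCircle.haarAddCircle := by
      refine integral_congr_ae ?_
      filter_upwards [hf.coeFn_toLp, hh.coeFn_toLp] with x hx hy
      rw [hx, hy, RCLike.inner_apply]
    rw [this, AddCircle.integral_haarAddCircle]
    rw [Complex.real_smul]
    push_cast
    rfl
  simp only [e1, e2, e3] at key
  simpa only [mul_comm] using key

theorem memLp_conj {f : Torus → ℂ} {μ : Measure Torus} (hf : MemLp f 2 μ) :
    MemLp (fun x => conj (f x)) 2 μ := hf.star

theorem memLp_fourier_mul {f : Torus → ℂ}
    (hf : MemLp f 2 (AddCircle.haarAddCircle (T := 2 * π))) (q : ℤ) :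
    MemLp (fun x => fourier q x * f x) 2 (AddCircle.haarAddCircle (T := 2 * π)) := by
  refine hf.of_le (((fourier q).continuous.aestronglyMeasurable).mul hf.1) ?_
  refine Filter.Eventually.of_forall fun x => ?_
  rw [norm_mul]
  have : ‖(fourier q x : ℂ)‖ = 1 := by rw [fourier_apply]; exact Circle.norm_coe _
  rw [this, one_mul]

theorem memLp_continuous {f : Torus → ℂ} (hf : Continuous f) :
    MemLp f 2 (AddCircle.haarAddCircle (T := 2 * π)) := by
  have := (BoundedContinuousFunction.mkOfCompact ⟨f, hf⟩).memLp_top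
    (μ := (AddCircle.haarAddCircle (T := 2 * π)))
  exact this.mono_exponent le_top

theorem hasSum_sq_fourierCoeff_LTwo (f : LTwo) :
    HasSum (fun n => ‖fourierCoeff f n‖ ^ 2) ((2 * π)⁻¹ * ∫ x, ‖f x‖ ^ 2) := by
  have h := hasSum_fourierCoeff_mul_conj (memLp_haar f) (memLp_haar f)
  have e1 : ∀ z : ℂ, z * conj z = ((‖z‖ ^ 2 : ℝ) : ℂ) := by
    intro z
    rw [Complex.mul_conj, Complex.normSq_eq_norm_sq]
  simp only [e1] at h
  rw [integral_complex_ofReal, ← Complex.ofReal_inv, ← Complex.ofReal_mul] at h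
  exact_mod_cast h

theorem integral_norm_sq (f : LTwo) : ∫ x, ‖f x‖ ^ 2 = ‖f‖ ^ 2 := by
  have h := congrArg RCLike.re (L2.inner_def (𝕜 := ℂ) f f)
  rw [inner_self_eq_norm_sq, ← integral_re (L2.integrable_inner f f)] at h
  rw [h]
  refine integral_congr_ae (Filter.Eventually.of_forall fun x => ?_)
  simp only [inner_self_eq_norm_sq]

theorem tsum_sq_fourierCoeff_LTwo (f : LTwo) :
    ∑' n, ‖fourierCoeff f n‖ ^ 2 = (2 * π)⁻¹ * ‖f‖ ^ 2 := by
  rw [(hasSum_sq_fourierCoeff_LTwo f).tsum_eq, integral_norm_sq]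

theorem summable_sq_fourierCoeff_LTwo (f : LTwo) : Summable fun n => ‖fourierCoeff f n‖ ^ 2 :=
  (hasSum_sq_fourierCoeff_LTwo f).summable

theorem mean_eq_fourierCoeff (f : LTwo) : mean f = fourierCoeff f 0 := by
  unfold mean fourierCoeff
  simp only [neg_zero, fourier_zero, one_smul]
  rw [AddCircle.integral_haarAddCircle, Complex.real_smul]
  push_cast
  rfl

/-- The Fourier coefficients of a real function are hermitian. -/
theorem fourierCoeff_neg_of_real {f : LTwo} (hf : ∀ᵐ x ∂(volume : Measure Torus), (f x).im = 0)
    (n : ℤ) : fourierCoeff f (-n) = conj (fourierCoeff f n) := by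
  have h : (fun x => conj (f x)) =ᵐ[AddCircle.haarAddCircle (T := 2 * π)] f := by
    filter_upwards [haar_absolutelyContinuous.ae_le hf] with x hx
    exact Complex.conj_eq_iff_im.2 hx
  have := fourierCoeff_conj f (-n)
  rw [neg_neg, fourierCoeff_congr_ae h] at this
  exact this

/-! ### Test functions supported in a small interval -/

theorem summable_two_div_one_add_sq : Summable fun p : ℤ => 2 / (1 + (p : ℝ) ^ 2) := by
  refine Summable.of_norm_bounded_eventually (summable_inv_int_sq.mul_left 2) ?_
  filter_upwards [(Set.finite_singleton (0 : ℤ)).compl_mem_cofinite] with p hp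
  have hp0 : (p : ℝ) ≠ 0 := by exact_mod_cast hp
  have : 0 < (p : ℝ) ^ 2 := by positivity
  rw [Real.norm_of_nonneg (by positivity), div_eq_mul_inv]
  gcongr
  linarith

theorem summable_fourier_of_smooth {φ : ℝ → ℂ} (hφ : ContDiff ℝ (⊤ : ℕ∞) φ)
    (hc : HasCompactSupport φ) :
    Summable fun n : ℤ =>
      (1 + |(n : ℝ)|) * ‖∫ x : ℝ, φ x * Complex.exp (Complex.I * (n * x : ℝ))‖ := by
  set F : SchwartzMap ℝ ℂ := hc.toSchwartzMap hφ with hF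
  obtain ⟨C₀, -, hC₀⟩ := (FourierTransform.fourier F).decay 0 0
  obtain ⟨C₃, -, hC₃⟩ := (FourierTransform.fourier F).decay 3 0
  have e : ∀ n : ℤ, ∫ x : ℝ, φ x * Complex.exp (Complex.I * (n * x : ℝ)) =
      (FourierTransform.fourier F) (-(n : ℝ) / (2 * π)) := by
    intro n
    rw [SchwartzMap.fourier_coe, Real.fourier_eq']
    refine integral_congr_ae (Filter.Eventually.of_forall fun x => ?_)
    have : (F : ℝ → ℂ) x = φ x := rfl
    simp only [smul_eq_mul, this]
    rw [mul_comm]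
    congr 2
    simp only [RCLike.inner_apply, conj_trivial]
    push_cast
    have : (π : ℂ) ≠ 0 := by exact_mod_cast Real.pi_ne_zero
    field_simp
  simp only [e]
  refine Summable.of_nonneg_of_le (fun _ => by positivity) (fun n => ?_)
    (summable_two_div_one_add_sq.mul_left (2 * (C₀ + (2 * π) ^ 3 * C₃)))
  have h0 := hC₀ (-(n : ℝ) / (2 * π))
  have h3 := hC₃ (-(n : ℝ) / (2 * π))
  simp only [pow_zero, one_mul, norm_iteratedFDeriv_zero] at h0 h3
  set A := ‖(FourierTransform.fourier F) (-(n : ℝ) / (2 * π))‖ with hA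
  have hA0 : 0 ≤ A := norm_nonneg _
  have h3' : |(n : ℝ)| ^ 3 * A ≤ (2 * π) ^ 3 * C₃ := by
    have : ‖-(n : ℝ) / (2 * π)‖ = |(n : ℝ)| / (2 * π) := by
      rw [norm_div, norm_neg, Real.norm_eq_abs, Real.norm_of_nonneg Real.two_pi_pos.le]
    rw [this] at h3
    have hp : 0 < (2 * π) ^ 3 := by have := Real.two_pi_pos; positivity
    calc |(n : ℝ)| ^ 3 * A = (2 * π) ^ 3 * ((|(n : ℝ)| / (2 * π)) ^ 3 * A) := by
          field_simp
      _ ≤ _ := by gcongr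
  set t := |(n : ℝ)| with ht
  have ht0 : 0 ≤ t := abs_nonneg _
  have hsq : (n : ℝ) ^ 2 = t ^ 2 := (sq_abs _).symm
  rw [hsq, ← mul_div_assoc, le_div_iff₀ (by positivity)]
  have hpoly : (1 + t) * (1 + t ^ 2) ≤ 4 * (1 + t ^ 3) := by
    nlinarith [mul_nonneg ht0 (sq_nonneg (t - 1)), sq_nonneg (t - 1), mul_nonneg ht0 ht0]
  calc (1 + t) * A * (1 + t ^ 2) = (1 + t) * (1 + t ^ 2) * A := by ring
    _ ≤ 4 * (1 + t ^ 3) * A := by gcongr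
    _ = 4 * A + 4 * (t ^ 3 * A) := by ring
    _ ≤ _ := by linarith

/-- A test function, supported in a given interval, which sees `e^{imx}` but not `e^{-imx}`. -/
theorem exists_test_function (x₀ : ℝ) {δ : ℝ} (hδ : 0 < δ) (m : ℤ) :
    ∃ φ : ℝ → ℂ, ContDiff ℝ (⊤ : ℕ∞) φ ∧ HasCompactSupport φ ∧
      (∀ x, δ ≤ |x - x₀| → φ x = 0) ∧
      (∫ x : ℝ, φ x * Complex.exp (Complex.I * (m * x : ℝ))) ≠ 0 ∧
      (m ≠ 0 → ∫ x : ℝ, φ x * Complex.exp (Complex.I * (((-m : ℤ) : ℝ) * x : ℝ)) = 0) := by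
  let β : ContDiffBump x₀ := ⟨δ / 4, δ / 2, by positivity, by linarith⟩
  set h : ℝ → ℂ := fun x => ((β x : ℝ) : ℂ) with hh
  have hsm : ContDiff ℝ (⊤ : ℕ∞) h := Complex.ofRealCLM.contDiff.comp (β.contDiff)
  have hcs : HasCompactSupport h := β.hasCompactSupport.comp_left Complex.ofReal_zero
  have hzero : ∀ x, δ ≤ |x - x₀| → x ∉ tsupport h := by
    intro x hx hmem
    have h1 : tsupport h ⊆ Metric.closedBall x₀ (δ / 2) := by
      refine closure_minimal ?_ Metric.isClosed_closedBall
      intro y hy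
      have hy' : β y ≠ 0 := fun h0 => hy (by simp [hh, h0])
      have : y ∈ Function.support β := hy'
      rw [β.support_eq] at this
      exact Metric.ball_subset_closedBall this
    have := h1 hmem
    rw [Metric.mem_closedBall, Real.dist_eq] at this
    linarith
  have hint : Integrable h := hsm.continuous.integrable_of_hasCompactSupport hcs
  have hpos : (∫ x, h x) ≠ 0 := by
    rw [hh, integral_complex_ofReal]
    have := β.integral_pos (μ := volume)
    exact_mod_cast this.ne'
  rcases eq_or_ne m 0 with rfl | hm
  · refine ⟨h, hsm, hcs, fun x hx => image_eq_zero_of_notMem_tsupport (hzero x hx), ?_,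
      fun h0 => absurd rfl h0⟩
    simpa using hpos
  · have hm' : (m : ℂ) ≠ 0 := by exact_mod_cast hm
    set h' : ℝ → ℂ := deriv h with hh'
    have hdiff : ∀ x, HasDerivAt h (h' x) x := fun x =>
      (hsm.differentiable (by simp) x).hasDerivAt
    have hsm' : ContDiff ℝ (⊤ : ℕ∞) h' := by
      exact (contDiff_infty_iff_deriv.1 hsm).2
    have hcs' : HasCompactSupport h' := hcs.deriv
    have hint' : Integrable h' := hsm'.continuous.integrable_of_hasCompactSupport hcs'
    have hexp : ContDiff ℝ (⊤ : ℕ∞) fun x : ℝ => Complex.exp (-(Complex.I * (m * x : ℝ))) :=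
      ((contDiff_const.mul (Complex.ofRealCLM.contDiff.comp
        (contDiff_const.mul contDiff_id))).neg).cexp
    -- the integral of `φ e^{imx}` is `-2im ∫ h`, while `φ e^{-imx}` is an exact derivative
    set φ : ℝ → ℂ := fun x => (h' x - 2 * Complex.I * m * h x) *
      Complex.exp (-(Complex.I * (m * x : ℝ))) with hφ
    have hφ1 : ContDiff ℝ (⊤ : ℕ∞) φ := (hsm'.sub (contDiff_const.mul hsm)).mul hexp
    have hz' : ∀ x, x ∉ tsupport h → h' x = 0 := fun x hx =>
      image_eq_zero_of_notMem_tsupport fun hx' => hx (tsupport_deriv_subset hx')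
    have hz : ∀ x, x ∉ tsupport h → φ x = 0 := by
      intro x hx
      simp [hφ, hz' x hx, image_eq_zero_of_notMem_tsupport hx]
    have e1 : ∀ x : ℝ, φ x * Complex.exp (Complex.I * (m * x : ℝ)) =
        h' x - 2 * Complex.I * m * h x := by
      intro x
      simp only [hφ]
      rw [mul_assoc, ← Complex.exp_add, neg_add_cancel, Complex.exp_zero, mul_one]
    refine ⟨φ, hφ1, HasCompactSupport.intro hcs.isCompact hz, fun x hx => hz x (hzero x hx), ?_,
      fun _ => ?_⟩
    · simp only [e1]
      rw [integral_sub hint' (hint.const_mul _), integral_const_mul,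
        integral_eq_zero_of_hasDerivAt_of_integrable hdiff hint' hint, zero_sub]
      exact neg_ne_zero.2 (mul_ne_zero (mul_ne_zero (mul_ne_zero two_ne_zero Complex.I_ne_zero)
        hm') hpos)
    · -- the integrand is the derivative of `h e^{-2imx}`
      have hd : ∀ x : ℝ, HasDerivAt (fun x : ℝ => h x * Complex.exp (-(2 * Complex.I * m) * x))
          (φ x * Complex.exp (Complex.I * (((-m : ℤ) : ℝ) * x : ℝ))) x := by
        intro x
        have h1 : HasDerivAt (fun x : ℝ => (x : ℂ)) 1 x := Complex.ofRealCLM.hasDerivAt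
        have h2 := (hdiff x).mul (h1.const_mul (-(2 * Complex.I * m))).cexp
        refine h2.congr_deriv ?_
        have e2 : Complex.exp (-(2 * Complex.I * m) * x) =
            Complex.exp (-(Complex.I * (m * x : ℝ))) *
            Complex.exp (Complex.I * (((-m : ℤ) : ℝ) * x : ℝ)) := by
          rw [← Complex.exp_add]; congr 1; push_cast; ring
        rw [e2]
        simp only [hφ]
        ring
      have c1 : HasCompactSupport fun x : ℝ =>
          φ x * Complex.exp (Complex.I * (((-m : ℤ) : ℝ) * x : ℝ)) :=
        (HasCompactSupport.intro hcs.isCompact hz).mul_right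
      have c2 : HasCompactSupport fun x : ℝ => h x * Complex.exp (-(2 * Complex.I * m) * x) :=
        hcs.mul_right
      refine integral_eq_zero_of_hasDerivAt_of_integrable hd ?_ ?_
      · refine Continuous.integrable_of_hasCompactSupport ?_ c1
        exact hφ1.continuous.mul (by fun_prop)
      · refine Continuous.integrable_of_hasCompactSupport ?_ c2
        exact hsm.continuous.mul (by fun_prop)

/-! ### Observation through a test function -/

/-- The observed quantity `∫_ω |Re f|²` of a single state `f`. -/
def obs (ω : Set Torus) (f : LTwo) : ℝ := ∫ x in ω, (f x).re ^ 2

theorem obs_nonneg (ω : Set Torus) (f : LTwo) : 0 ≤ obs ω f :=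
  integral_nonneg fun _ => sq_nonneg _

theorem integral_sq_real_Lp {X : Type*} [MeasurableSpace X] {μ : Measure X} (f : Lp ℝ 2 μ) :
    ∫ x, f x ^ 2 ∂μ = ‖f‖ ^ 2 := by
  have h := L2.inner_def (𝕜 := ℝ) f f
  rw [real_inner_self_eq_norm_sq] at h
  rw [h]
  refine integral_congr_ae (Filter.Eventually.of_forall fun x => ?_)
  simp [sq]

theorem continuous_obs (ω : Set Torus) : Continuous (obs ω) := by
  let A : LTwo →L[ℝ] Lp ℝ 2 ((volume : Measure Torus).restrict ω) :=
    (LpToLpRestrictCLM Torus ℝ ℝ volume 2 ω).comp (Complex.reCLM.compLpL 2 volume)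
  have e : obs ω = fun f => ‖A f‖ ^ 2 := by
    funext f
    rw [← integral_sq_real_Lp]
    refine integral_congr_ae ?_
    have h1 := LpToLpRestrictCLM_coeFn ℝ (p := 2) (μ := (volume : Measure Torus)) ω
      (Complex.reCLM.compLpL 2 volume f)
    have h2 := ae_restrict_of_ae (s := ω) (Complex.reCLM.coeFn_compLpL (p := 2) f)
    filter_upwards [h1, h2] with x h1 h2
    change _ = (LpToLpRestrictCLM Torus ℝ ℝ volume 2 ω (Complex.reCLM.compLpL 2 volume f)) x ^ 2
    rw [h1, h2]
    rfl
  rw [e]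
  exact (A.continuous.norm).pow 2

theorem integrable_re_sq (f : LTwo) : Integrable fun x => (f x).re ^ 2 := by
  have := (Lp.memLp f).re.integrable_sq
  exact this

/-- A continuous function on the torus, supported in `ω`, with rapidly decaying Fourier
coefficients, which sees `e^{imx}` but not `e^{-imx}`. -/
theorem exists_torus_test_function {ω : Set Torus} (hω : IsOpen ω) (hne : ω.Nonempty) (m : ℤ) :
    ∃ Φ : Torus → ℂ, Continuous Φ ∧ (∀ x ∉ ω, Φ x = 0) ∧
      (Summable fun n : ℤ => (1 + |(n : ℝ)|) * ‖2 * π * fourierCoeff Φ (-n)‖) ∧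
      2 * π * fourierCoeff Φ (-m) ≠ 0 ∧ (m ≠ 0 → 2 * π * fourierCoeff Φ (- -m) = 0) := by
  obtain ⟨y, hy⟩ := hne
  obtain ⟨x₀, rfl⟩ := QuotientAddGroup.mk_surjective y
  have hopen : IsOpen ((fun x : ℝ => (x : Torus)) ⁻¹' ω) :=
    hω.preimage (AddCircle.continuous_mk' _)
  obtain ⟨δ', hδ', hball⟩ := Metric.isOpen_iff.1 hopen x₀ hy
  have hπ := Real.pi_pos
  obtain ⟨φ, hsm, hcs, hz, hm, hm'⟩ := exists_test_function x₀ (lt_min hδ' hπ) m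
  set Φ : Torus → ℂ := AddCircle.liftIoc (2 * π) (x₀ - π) φ with hΦ
  have hend : x₀ - π + 2 * π = x₀ + π := by ring
  have z1 : φ (x₀ - π) = 0 := hz _ (by
    rw [sub_sub_cancel_left, abs_neg, abs_of_pos hπ]; exact min_le_right _ _)
  have z2 : φ (x₀ + π) = 0 := hz _ (by
    rw [add_sub_cancel_left, abs_of_pos hπ]; exact min_le_right _ _)
  have hcoef : ∀ n : ℤ, 2 * π * fourierCoeff Φ (-n) =
      ∫ x : ℝ, φ x * Complex.exp (Complex.I * (n * x : ℝ)) := by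
    intro n
    rw [hΦ, fourierCoeff_liftIoc_eq, fourierCoeffOn_eq_integral, neg_neg]
    rw [intervalIntegral.integral_eq_integral_of_support_subset]
    · rw [add_sub_cancel_left, Complex.real_smul]
      push_cast
      have : (π : ℂ) ≠ 0 := by exact_mod_cast hπ.ne'
      rw [← mul_assoc, mul_one_div_cancel (by simp [this]), one_mul]
      refine integral_congr_ae (Filter.Eventually.of_forall fun x => ?_)
      simp only [smul_eq_mul]
      rw [fourier_eq_exp, mul_comm]
      push_cast
      rfl
    · intro x hx
      by_contra hxI
      refine hx ?_
      have : φ x = 0 := by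
        refine hz x ((min_le_right _ _).trans ?_)
        rw [mem_Ioc, hend, not_and_or, not_lt, not_le] at hxI
        rcases hxI with h | h
        · rw [abs_of_nonpos (by linarith)]; linarith
        · rw [abs_of_nonneg (by linarith)]; linarith
      simp [this]
  refine ⟨Φ, ?_, ?_, ?_, ?_, fun h => ?_⟩
  · refine AddCircle.liftIoc_continuous ?_ hsm.continuous.continuousOn
    rw [hend, z1, z2]
  · intro x hx
    have hmem : x ∈ QuotientAddGroup.mk '' Ioc (x₀ - π) (x₀ - π + 2 * π) := by
      rw [AddCircle.coe_image_Ioc_eq (2 * π)]; trivial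
    obtain ⟨y, hy', rfl⟩ := hmem
    have : Φ (y : Torus) = φ y := AddCircle.liftIoc_coe_apply hy'
    refine this.trans (hz y ?_)
    by_contra hlt
    refine hx (hball ?_)
    rw [Metric.mem_ball, Real.dist_eq]
    exact (not_le.1 hlt).trans_le (min_le_left _ _)
  · simp only [hcoef]
    exact summable_fourier_of_smooth hsm hcs
  · rw [hcoef]
    exact hm
  · rw [hcoef]
    exact hm' h

theorem memLp_volume_continuous {f : Torus → ℂ} (hf : Continuous f) :
    MemLp f 2 (volume : Measure Torus) :=
  memLp_haarAddCircle_iff.1 (memLp_continuous hf)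

/-- `realPairing` is the integral of `Φ Re f`; note that `∫ Φ e^{inx} = 2π Φ̂(-n)`. -/
theorem realPairing_fourierCoeff {Φ : Torus → ℂ} (hΦ : Continuous Φ) (f : LTwo) :
    realPairing (fun n => 2 * π * fourierCoeff Φ (-n)) (fourierCoeff f) =
      ∫ x, Φ x * ((f x).re : ℂ) := by
  have hπ : (π : ℂ) ≠ 0 := by exact_mod_cast Real.pi_ne_zero
  have hc : Continuous fun x => conj (Φ x) := Complex.continuous_conj.comp hΦ
  have h1 := hasSum_fourierCoeff_mul_conj (memLp_haar f) (memLp_continuous hc)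
  have h2 := hasSum_fourierCoeff_mul_conj (memLp_continuous hΦ) (memLp_haar f)
  have h3 := (h1.add h2).mul_left (π : ℂ)
  have i1 : Integrable fun x => f x * conj (conj (Φ x)) :=
    (Lp.memLp f).integrable_mul (memLp_conj (memLp_volume_continuous hc))
  have i2 : Integrable fun x => Φ x * conj (f x) :=
    (memLp_volume_continuous hΦ).integrable_mul (memLp_conj (Lp.memLp f))
  rw [← mul_add, ← integral_add i1 i2] at h3
  have e : ∫ x, (f x * conj (conj (Φ x)) + Φ x * conj (f x)) =
      2 * ∫ x, Φ x * ((f x).re : ℂ) := by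
    rw [← integral_const_mul]
    refine integral_congr_ae (Filter.Eventually.of_forall fun x => ?_)
    simp only [Complex.conj_conj]
    have := Complex.add_conj (f x)
    push_cast at this
    linear_combination Φ x * this
  rw [e] at h3
  unfold realPairing
  have h4 : (π : ℂ) * (((2 * π : ℝ) : ℂ)⁻¹ * (2 * ∫ x, Φ x * ((f x).re : ℂ))) =
      ∫ x, Φ x * ((f x).re : ℂ) := by
    push_cast
    field_simp
  rw [h4] at h3
  rw [← h3.tsum_eq]
  refine tsum_congr fun n => ?_
  simp only [fourierCoeff_conj, Complex.conj_conj, neg_neg]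
  ring

/-- A linear form of the Cauchy–Schwarz inequality on `ω`; the free parameter `s` allows it to be
integrated in time before it is optimised by `sq_le_of_forall_le_add_div`. -/
theorem norm_integral_mul_re_le {ω : Set Torus} {Φ : Torus → ℂ}
    (hz : ∀ x ∉ ω, Φ x = 0) {A : ℝ} (hA : ∀ x, ‖Φ x‖ ≤ A) (f : LTwo) {s : ℝ} (hs : 0 < s) :
    ‖∫ x, Φ x * ((f x).re : ℂ)‖ ≤
      (s * obs ω f + A ^ 2 * (volume : Measure Torus).real ω / s) / 2 := by
  have e : ∫ x, Φ x * ((f x).re : ℂ) = ∫ x in ω, Φ x * ((f x).re : ℂ) := by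
    rw [setIntegral_eq_integral_of_forall_compl_eq_zero]
    intro x hx
    rw [hz x hx, zero_mul]
  rw [e]
  have hint : IntegrableOn (fun x => (s * (f x).re ^ 2 + A ^ 2 / s) / 2) ω :=
    ((((integrable_re_sq f).const_mul s).add (integrable_const _)).div_const 2).integrableOn
  calc ‖∫ x in ω, Φ x * ((f x).re : ℂ)‖ ≤ ∫ x in ω, (s * (f x).re ^ 2 + A ^ 2 / s) / 2 := by
        refine norm_integral_le_of_norm_le hint (Filter.Eventually.of_forall fun x => ?_)
        rw [norm_mul, Complex.norm_real, Real.norm_eq_abs]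
        have h1 : ‖Φ x‖ * |(f x).re| ≤ A * |(f x).re| := by gcongr; exact hA x
        refine h1.trans ?_
        rw [le_div_iff₀ two_pos, ← sq_abs (f x).re]
        have h2 : 0 ≤ (s * |(f x).re| - A) ^ 2 / s := by positivity
        have h3 : (s * |(f x).re| - A) ^ 2 / s =
            s * |(f x).re| ^ 2 + A ^ 2 / s - A * |(f x).re| * 2 := by
          field_simp
          ring
        linarith
    _ = _ := by
        rw [integral_div, integral_add ((integrable_re_sq f).const_mul s).integrableOn
          (integrable_const _), integral_const_mul, integral_const, measureReal_restrict_apply_univ]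
        simp only [obs, smul_eq_mul]
        ring

theorem sq_le_of_forall_le_add_div {X Y C : ℝ} (hX : 0 ≤ X) (hY : 0 ≤ Y) (hC : 0 ≤ C)
    (h : ∀ s, 0 < s → X ≤ (s * Y + C / s) / 2) : X ^ 2 ≤ C * Y := by
  rcases hX.eq_or_lt with rfl | hX
  · simpa using mul_nonneg hC hY
  rcases hY.eq_or_lt with rfl | hY
  · exfalso
    have := h ((C + X) / X) (by positivity)
    rw [mul_zero, zero_add, div_div_eq_mul_div, div_div, le_div_iff₀ (by positivity)] at this
    nlinarith
  · have := h (X / Y) (by positivity)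
    rw [div_mul_cancel₀ _ hY.ne', div_div_eq_mul_div] at this
    have h2 : X ≤ C * Y / X := by linarith
    rw [le_div_iff₀ hX] at h2
    rwa [sq]

/-! ### A trigonometric polynomial adapted to `ω` -/

theorem integral_fourier_haar (q : ℤ) :
    ∫ x : Torus, fourier q x ∂AddCircle.haarAddCircle = if q = 0 then 1 else 0 := by
  have h := orthonormal_iff_ite.1 (orthonormal_fourier (T := 2 * π)) 0 q
  rw [L2.inner_def] at h
  simp only [eq_comm (a := (0 : ℤ))] at h
  rw [← h]
  refine integral_congr_ae ?_
  filter_upwards [coeFn_fourierLp (T := 2 * π) 2 0, coeFn_fourierLp (T := 2 * π) 2 q] with x h0 h1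
  rw [h0, h1]
  simp

/-- There is a trigonometric polynomial with non-positive real part off `ω` and positive mean. -/
theorem exists_trig_polynomial {ω : Set Torus} (hω : IsOpen ω) (hne : ω.Nonempty) :
    ∃ (Q : Finset ℤ) (c : ℤ → ℂ), 0 ∈ Q ∧ 0 < (c 0).re ∧
      (∀ x : Torus, (∑ q ∈ Q, c q * fourier q x : ℂ).re ≤ 2) ∧
      ∀ x ∉ ω, (∑ q ∈ Q, c q * fourier q x : ℂ).re ≤ 0 := by
  obtain ⟨y, hy⟩ := hne
  obtain ⟨f, hf0, hf1, hf⟩ := exists_continuous_zero_one_of_isClosed hω.isClosed_compl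
    (isClosed_singleton (x := y)) (Set.disjoint_singleton_right.2 fun h => h hy)
  set I : ℝ := ∫ x, f x ∂AddCircle.haarAddCircle (T := 2 * π) with hI
  have hint : Integrable f (AddCircle.haarAddCircle (T := 2 * π)) :=
    f.continuous.integrable_of_hasCompactSupport (HasCompactSupport.of_compactSpace f)
  have hIpos : 0 < I := by
    refine f.continuous.integral_pos_of_hasCompactSupport_nonneg_nonzero
      (HasCompactSupport.of_compactSpace f) (fun x => (hf x).1) (x := y) ?_
    rw [hf1 rfl]
    exact one_ne_zero
  have hIle : I ≤ 1 := by
    have : I ≤ ∫ _x : Torus, (1 : ℝ) ∂AddCircle.haarAddCircle :=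
      integral_mono hint (integrable_const _) fun x => (hf x).2
    simpa using this
  let F : C(Torus, ℂ) := ⟨fun x => (f x : ℂ), Complex.continuous_ofReal.comp f.continuous⟩
  have hF : F ∈ (Submodule.span ℂ (Set.range (fourier (T := 2 * π)))).topologicalClosure := by
    rw [span_fourier_closure_eq_top]; trivial
  obtain ⟨P, hP, hdist⟩ := Metric.mem_closure_iff.1 hF (I / 4) (by positivity)
  obtain ⟨c, rfl⟩ := Finsupp.mem_span_range_iff_exists_finsupp.1 hP
  -- the approximation of the bump `f` up to `I / 4` is lowered by the constant `I / 2`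
  set Q : Finset ℤ := insert 0 c.support with hQ
  have hPval : ∀ x, (c.sum fun i a => a • fourier (T := 2 * π) i) x =
      ∑ q ∈ Q, c q * fourier q x := by
    intro x
    rw [Finsupp.sum, ContinuousMap.coe_sum, Finset.sum_apply]
    simp only [ContinuousMap.coe_smul, Pi.smul_apply, smul_eq_mul]
    refine Finset.sum_subset (Finset.subset_insert _ _) fun q _ hq => ?_
    rw [Finsupp.notMem_support_iff.1 hq, zero_mul]
  have hclose : ∀ x, |f x - (∑ q ∈ Q, c q * fourier q x : ℂ).re| ≤ I / 4 := by
    intro x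
    rw [← hPval]
    have h1 := (ContinuousMap.dist_apply_le_dist x).trans hdist.le
    rw [dist_eq_norm] at h1
    refine le_trans ?_ h1
    have := Complex.abs_re_le_norm (F x - (c.sum fun i a => a • fourier (T := 2 * π) i) x)
    simpa [F] using this
  have hmean : I - I / 4 ≤ (c 0).re := by
    have h1 : ∫ x : Torus, (∑ q ∈ Q, c q * fourier q x) ∂AddCircle.haarAddCircle = c 0 := by
      rw [integral_finsetSum]
      · simp only [integral_const_mul, integral_fourier_haar, mul_ite, mul_one, mul_zero]
        rw [Finset.sum_ite_eq' Q 0, if_pos (Finset.mem_insert_self _ _)]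
      · intro q _
        exact ((fourier q).continuous.integrable_of_hasCompactSupport
          (HasCompactSupport.of_compactSpace _)).const_mul _
    have hPint : Integrable (fun x : Torus => ∑ q ∈ Q, c q * fourier q x)
        AddCircle.haarAddCircle := by
      refine integrable_finsetSum _ fun q _ => ?_
      exact ((fourier q).continuous.integrable_of_hasCompactSupport
          (HasCompactSupport.of_compactSpace _)).const_mul _
    have h2 : ∫ x : Torus, (∑ q ∈ Q, c q * fourier q x : ℂ).re ∂AddCircle.haarAddCircle =
        (c 0).re := by
      rw [← h1]
      exact integral_re hPint
    have h3 : ∫ x : Torus, (f x - I / 4) ∂AddCircle.haarAddCircle ≤ (c 0).re := by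
      rw [← h2]
      refine integral_mono (hint.sub (integrable_const _)) hPint.re fun x => ?_
      have := (abs_le.1 (hclose x)).2
      change f x - I / 4 ≤ (∑ q ∈ Q, c q * fourier q x : ℂ).re
      linarith
    rw [integral_sub hint (integrable_const _)] at h3
    simpa using h3
  have hsum : ∀ x : Torus,
      (∑ q ∈ Q, (c q - if q = 0 then ((I / 2 : ℝ) : ℂ) else 0) * fourier q x : ℂ).re =
        (∑ q ∈ Q, c q * fourier q x : ℂ).re - I / 2 := by
    intro x
    simp only [sub_mul, Finset.sum_sub_distrib, ite_mul, zero_mul]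
    rw [Finset.sum_ite_eq' Q 0, if_pos (Finset.mem_insert_self _ _), fourier_zero, mul_one,
      Complex.sub_re, Complex.ofReal_re]
  refine ⟨Q, fun q => c q - if q = 0 then ((I / 2 : ℝ) : ℂ) else 0, Finset.mem_insert_self _ _,
    ?_, fun x => ?_, fun x hx => ?_⟩
  · simp only [if_pos, Complex.sub_re, Complex.ofReal_re]
    linarith
  · rw [hsum]
    have h1 := (abs_le.1 (hclose x)).1
    have h2 := (hf x).2
    linarith
  · rw [hsum]
    have h1 := (abs_le.1 (hclose x)).1
    have h2 : f x = 0 := hf0 hx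
    linarith

/-- Parseval's identity for `(Re f)² = (2|f|² + f² + conj f²) / 4`. -/
theorem integral_fourier_mul_re_sq (q : ℤ) (f : LTwo) :
    ∫ x, fourier q x * (((f x).re ^ 2 : ℝ) : ℂ) =
      (π / 2) * (2 * diagForm (fun _ => 1) q (fourierCoeff f) (fourierCoeff f)
        + diagForm (fun _ => 1) q (fourierCoeff f) (fun n => conj (fourierCoeff f (-n)))
        + conj (diagForm (fun _ => 1) (-q) (fourierCoeff f)
          (fun n => conj (fourierCoeff f (-n))))) := by
  have hπ : (π : ℂ) ≠ 0 := by exact_mod_cast Real.pi_ne_zero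
  have key : ∀ (q : ℤ) (h : Torus → ℂ) (hh : MemLp h 2 (AddCircle.haarAddCircle (T := 2 * π))),
      ∫ x, fourier q x * f x * conj (h x) =
        2 * π * diagForm (fun _ => 1) q (fourierCoeff f) (fourierCoeff h) := by
    intro q h hh
    have h1 := hasSum_fourierCoeff_mul_conj (memLp_fourier_mul (memLp_haar f) q) hh
    rw [← (Equiv.addRight q).hasSum_iff] at h1
    have h2 := h1.tsum_eq
    have h3 : diagForm (fun _ => 1) q (fourierCoeff f) (fourierCoeff h) =
        ((2 * π : ℝ) : ℂ)⁻¹ * ∫ x, fourier q x * f x * conj (h x) := by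
      rw [← h2]
      unfold diagForm
      refine tsum_congr fun k => ?_
      simp only [Function.comp, Equiv.coe_addRight]
      rw [fourierCoeff_fourier_mul, add_sub_cancel_right, one_mul]
    rw [h3]
    push_cast
    field_simp
  have k1 := key q f (memLp_haar f)
  have k2 := key q (fun x => conj (f x)) (memLp_conj (memLp_haar f))
  have k3 := congrArg conj (key (-q) (fun x => conj (f x)) (memLp_conj (memLp_haar f)))
  rw [← integral_conj] at k3
  have ec : fourierCoeff (fun x => conj (f x)) = fun n => conj (fourierCoeff f (-n)) :=
    funext (fourierCoeff_conj f)
  rw [ec] at k2 k3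
  have hL : ∀ (h₁ h₂ : Torus → ℂ), MemLp h₁ 2 (AddCircle.haarAddCircle (T := 2 * π)) →
      MemLp h₂ 2 (AddCircle.haarAddCircle (T := 2 * π)) →
      Integrable fun x => fourier q x * h₁ x * h₂ x := fun h₁ h₂ a b =>
    (memLp_haarAddCircle_iff.1 (memLp_fourier_mul a q)).integrable_mul
      (memLp_haarAddCircle_iff.1 b)
  have i1 := hL f (fun x => conj (f x)) (memLp_haar f) (memLp_conj (memLp_haar f))
  have i2 := hL f (fun x => conj (conj (f x))) (memLp_haar f)
    (memLp_conj (memLp_conj (memLp_haar f)))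
  have i3 : Integrable fun x => conj (fourier (-q) x * f x * conj (conj (f x))) := by
    have := hL (fun x => conj (f x)) (fun x => conj (f x)) (memLp_conj (memLp_haar f))
      (memLp_conj (memLp_haar f))
    refine this.congr (Filter.Eventually.of_forall fun x => ?_)
    simp
  have e : ∫ x, fourier q x * (((f x).re ^ 2 : ℝ) : ℂ) =
      4⁻¹ * (2 * (∫ x, fourier q x * f x * conj (f x))
        + (∫ x, fourier q x * f x * conj (conj (f x)))
        + ∫ x, conj (fourier (-q) x * f x * conj (conj (f x)))) := by
    rw [← integral_const_mul, ← integral_add (i1.const_mul 2) i2,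
      ← integral_add (f := fun x => 2 * (fourier q x * f x * conj (f x)) +
        fourier q x * f x * conj (conj (f x))) ((i1.const_mul 2).add i2) i3, ← integral_const_mul]
    refine integral_congr_ae (Filter.Eventually.of_forall fun x => ?_)
    simp only [map_mul, fourier_neg, Complex.conj_conj]
    have := Complex.add_conj (f x)
    push_cast at this
    have h2 : ((f x).re : ℂ) = (f x + conj (f x)) / 2 := by rw [this]; ring
    push_cast
    rw [h2]
    ring
  rw [e, k1, k2, k3]
  simp only [map_mul, Complex.conj_ofReal, map_ofNat]
  ring

/-! ### From solutions to evolutions of Fourier coefficients -/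

/-- The summable sequence which dominates `(1 + |p|) |Ŵ(p)|` for `W` in the unit ball of `H⁴`. -/
def majorant (p : ℤ) : ℝ := 2 / (1 + (p : ℝ) ^ 2)

theorem majorant_nonneg (p : ℤ) : 0 ≤ majorant p := by
  unfold majorant
  positivity

theorem summable_majorant : Summable majorant := summable_two_div_one_add_sq

theorem norm_fourierCoeff_le_of_sobolevENorm {f : LTwo} {ε : ℝ} (hε : 0 ≤ ε)
    (h : sobolevENorm 4 f ≤ ENNReal.ofReal ε) (p : ℤ) :
    (1 + |(p : ℝ)|) * ‖fourierCoeff f p‖ ≤ ε * majorant p := by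
  have h1 : weight 4 p * ‖fourierCoeff f p‖ ≤ ε := by
    have h2 : ENNReal.ofReal ((weight 4 p * ‖fourierCoeff f p‖) ^ 2) ^ (1 / 2 : ℝ) ≤
        ENNReal.ofReal ε :=
      (ENNReal.rpow_le_rpow (ENNReal.le_tsum p) (by norm_num)).trans h
    have h0 : 0 ≤ weight 4 p * ‖fourierCoeff f p‖ :=
      mul_nonneg (weight_pos 4 p).le (norm_nonneg _)
    rw [ENNReal.ofReal_rpow_of_nonneg (sq_nonneg _) (by norm_num), ← Real.sqrt_eq_rpow,
      Real.sqrt_sq h0] at h2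
    exact (ENNReal.ofReal_le_ofReal_iff hε).1 h2
  have hw : weight 4 p = (1 + (p : ℝ) ^ 2) ^ 2 := by
    unfold weight
    rw [show (4 : ℝ) / 2 = ((2 : ℕ) : ℝ) by norm_num, Real.rpow_natCast]
  rw [hw] at h1
  unfold majorant
  rw [← sq_abs (p : ℝ)] at h1 ⊢
  set t := |(p : ℝ)|
  have ht : 0 ≤ t := abs_nonneg _
  set A := ‖fourierCoeff f p‖
  have hA : 0 ≤ A := norm_nonneg _
  rw [← mul_div_assoc, le_div_iff₀ (by positivity)]
  have : 1 + t ≤ 2 * (1 + t ^ 2) := by nlinarith [sq_nonneg (t - 1)]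
  calc (1 + t) * A * (1 + t ^ 2) ≤ 2 * (1 + t ^ 2) * A * (1 + t ^ 2) := by gcongr
    _ = 2 * ((1 + t ^ 2) ^ 2 * A) := by ring
    _ ≤ ε * 2 := by linarith

theorem isEvolution_of_isSolution {g b T ε B : ℝ} {W : ℝ → LTwo} {R : ℝ → LTwo →L[ℝ] LTwo}
    {w : ℝ → LTwo} (hε : 0 ≤ ε) (hw : IsSolution g b T W R w)
    (hreal : ∀ t ∈ Icc 0 T, ∀ᵐ x ∂(volume : Measure Torus), (W t x).im = 0)
    (hW : ∀ t ∈ Icc 0 T, sobolevENorm 4 (W t) ≤ ENNReal.ofReal ε)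
    (hR : ∀ t ∈ Icc 0 T, ‖R t‖ ≤ ε)
    (hB : ∀ t ∈ Icc 0 T, ∑' n, ‖fourierCoeff (w t) n‖ ^ 2 ≤ B) :
    IsEvolution majorant ε B T (disp g b) (fun t => fourierCoeff (W t))
      (fun t => fourierCoeff (R t (w t))) (fun t => fourierCoeff (w t)) where
  u_le t ht p := norm_fourierCoeff_le_of_sobolevENorm hε (hW t ht) p
  u_neg t ht p := fourierCoeff_neg_of_real (hreal t ht) p
  summable_r t _ := summable_sq_fourierCoeff_LTwo _
  r_le t ht := by
    rw [tsum_sq_fourierCoeff_LTwo]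
    have h1 := hB t ht
    rw [tsum_sq_fourierCoeff_LTwo] at h1
    have h2 : ‖R t (w t)‖ ≤ ε * ‖w t‖ := (R t).le_of_opNorm_le (hR t ht) _
    calc (2 * π)⁻¹ * ‖R t (w t)‖ ^ 2 ≤ (2 * π)⁻¹ * (ε * ‖w t‖) ^ 2 := by
          have := Real.two_pi_pos
          gcongr
      _ = ε ^ 2 * ((2 * π)⁻¹ * ‖w t‖ ^ 2) := by ring
      _ ≤ ε ^ 2 * B := by gcongr
  summable_a t _ := summable_sq_fourierCoeff_LTwo _
  a_le := hB
  deriv n t ht := hw.equation n t ht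

/-! ### The observability inequality -/

/-- `∫₀ᵀ ∫_ω |Re w|²`. -/
def totalObs (T : ℝ) (ω : Set Torus) (w : ℝ → LTwo) : ℝ := ∫ t in (0 : ℝ)..T, obs ω (w t)

theorem totalObs_nonneg {T : ℝ} (hT : 0 ≤ T) (ω : Set Torus) (w : ℝ → LTwo) :
    0 ≤ totalObs T ω w :=
  intervalIntegral.integral_nonneg hT fun _ _ => obs_nonneg _ _

theorem intervalIntegrable_obs {T : ℝ} (hT : 0 ≤ T) (ω : Set Torus) {w : ℝ → LTwo}
    (hw : ContinuousOn w (Icc 0 T)) :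
    IntervalIntegrable (fun t => obs ω (w t)) volume 0 T :=
  ((continuous_obs ω).comp_continuousOn hw).intervalIntegrable_of_Icc hT

/-- The observation controls every coefficient of the almost periodic pairing of the free wave with
a test function supported in `ω`. -/
theorem exists_sq_norm_freqCoeff_le {g b T : ℝ} (hg : 0 < g) (hb : 0 < b) (hT : 0 < T)
    {ω : Set Torus} {Φ : Torus → ℂ} (hΦ : Continuous Φ)
    (hz : ∀ x ∉ ω, Φ x = 0)
    (hp : Summable fun n : ℤ => (1 + |(n : ℝ)|) * ‖2 * π * fourierCoeff Φ (-n)‖) (m : ℤ) :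
    ∃ K, 0 ≤ K ∧ ∀ (ε B : ℝ) (u r : ℝ → ℤ → ℂ) (w : ℝ → LTwo), 0 < ε →
      ContinuousOn w (Icc 0 T) →
      IsEvolution majorant ε B T (disp g b) u r (fun t => fourierCoeff (w t)) →
      ‖freqCoeff (fun n => 2 * π * fourierCoeff Φ (-n)) (fourierCoeff (w 0)) m‖ ^ 2 ≤
        K * (totalObs T ω w + ε ^ 2 * B) := by
  obtain ⟨K, hK, hmain⟩ := exists_norm_freqCoeff_le hg hb majorant_nonneg summable_majorant hT hp m
  obtain ⟨A, hA⟩ := (isCompact_univ.image hΦ.norm).bddAbove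
  have hA' : ∀ x, ‖Φ x‖ ≤ A := fun x => hA ⟨x, trivial, rfl⟩
  set V := (volume : Measure Torus).real ω with hV
  have hV0 : 0 ≤ V := measureReal_nonneg
  refine ⟨2 * K ^ 2 * (A ^ 2 * V * T + 1), by positivity, fun ε B u r w hε hw ha => ?_⟩
  have hB : 0 ≤ B := (tsum_nonneg fun _ => sq_nonneg _).trans (ha.a_le 0 ⟨le_rfl, hT.le⟩)
  set S := ∫ t in (0 : ℝ)..T, ‖realPairing (fun n => 2 * π * fourierCoeff Φ (-n))
    (fourierCoeff (w t))‖ with hS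
  have hS0 : 0 ≤ S := intervalIntegral.integral_nonneg hT.le fun _ _ => norm_nonneg _
  have hO := totalObs_nonneg hT.le ω w
  have hSO : S ^ 2 ≤ A ^ 2 * V * T * totalObs T ω w := by
    refine sq_le_of_forall_le_add_div hS0 hO (by positivity) fun s hs => ?_
    have hi := intervalIntegrable_obs hT.le ω hw
    have : S ≤ ∫ t in (0 : ℝ)..T, (s * obs ω (w t) + A ^ 2 * V / s) / 2 := by
      refine intervalIntegral.integral_mono_on hT.le
        ((continuousOn_realPairing ha hp).norm.intervalIntegrable_of_Icc hT.le)
        (((hi.const_mul s).add intervalIntegrable_const).div_const 2) fun t _ => ?_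
      rw [realPairing_fourierCoeff hΦ]
      exact norm_integral_mul_re_le hz hA' (w t) hs
    refine this.trans_eq ?_
    rw [intervalIntegral.integral_div, intervalIntegral.integral_add (hi.const_mul s)
      intervalIntegrable_const, intervalIntegral.integral_const_mul,
      intervalIntegral.integral_const, totalObs]
    simp only [sub_zero, smul_eq_mul]
    ring
  have h1 := hmain ε B u r _ hε ha
  have h2 : (S + ε * √B) ^ 2 ≤ 2 * (S ^ 2 + ε ^ 2 * B) := by
    have := Real.sq_sqrt hB
    nlinarith [sq_nonneg (S - ε * √B)]
  have hεB : 0 ≤ ε ^ 2 * B := by positivity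
  calc _ ≤ (K * (S + ε * √B)) ^ 2 := by gcongr
    _ = K ^ 2 * (S + ε * √B) ^ 2 := by ring
    _ ≤ K ^ 2 * (2 * (S ^ 2 + ε ^ 2 * B)) := by gcongr
    _ ≤ K ^ 2 * (2 * ((A ^ 2 * V * T + 1) * (totalObs T ω w + ε ^ 2 * B))) := by
        gcongr
        have : 0 ≤ A ^ 2 * V * T * (ε ^ 2 * B) := by positivity
        nlinarith
    _ = _ := by ring

/-- The observation controls each Fourier coefficient of non-zero frequency of the datum. -/
theorem exists_sq_norm_coeff_le {g b T : ℝ} (hg : 0 < g) (hb : 0 < b) (hT : 0 < T)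
    {ω : Set Torus} (hω : IsOpen ω) (hne : ω.Nonempty) {m : ℤ} (hm : m ≠ 0) :
    ∃ K, 0 ≤ K ∧ ∀ (ε B : ℝ) (u r : ℝ → ℤ → ℂ) (w : ℝ → LTwo), 0 < ε →
      ContinuousOn w (Icc 0 T) →
      IsEvolution majorant ε B T (disp g b) u r (fun t => fourierCoeff (w t)) →
      ‖fourierCoeff (w 0) m‖ ^ 2 ≤ K * (totalObs T ω w + ε ^ 2 * B) := by
  obtain ⟨Φ, hΦ, hz, hp, h1, h2⟩ := exists_torus_test_function hω hne m
  obtain ⟨K, hK, h⟩ := exists_sq_norm_freqCoeff_le hg hb hT hΦ hz hp |m|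
  set P := 2 * π * fourierCoeff Φ (-m) with hP
  have hP0 : 0 < ‖P‖ := norm_pos_iff.2 h1
  refine ⟨(2 / ‖P‖) ^ 2 * K, by positivity, fun ε B u r w hε hw ha => ?_⟩
  have h3 := h ε B u r w hε hw ha
  -- the frequency `ℓ(m)` carries the coefficients of `m` and `-m`, and `Φ` does not see the latter
  have h4 : freqCoeff (fun n => 2 * π * fourierCoeff Φ (-n)) (fourierCoeff (w 0)) |m| =
      P * fourierCoeff (w 0) m / 2 := by
    unfold freqCoeff
    rw [if_pos (abs_pos.2 hm)]
    rcases abs_choice m with e | e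
    · rw [e]
      have h5 := h2 hm
      beta_reduce
      rw [h5]; ring
    · rw [e]
      have h5 := h2 hm
      beta_reduce
      rw [h5, neg_neg m, zero_mul, zero_add]
  rw [h4, norm_div, norm_mul, Complex.norm_ofNat] at h3
  calc ‖fourierCoeff (w 0) m‖ ^ 2 = (2 / ‖P‖) ^ 2 * (‖P‖ * ‖fourierCoeff (w 0) m‖ / 2) ^ 2 := by
        field_simp
    _ ≤ (2 / ‖P‖) ^ 2 * (K * (totalObs T ω w + ε ^ 2 * B)) := by gcongr
    _ = _ := by ring

/-- Of the mean, which is constant along the free flow, the observation controls the real part. -/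
theorem exists_sq_re_coeff_zero_le {g b T : ℝ} (hg : 0 < g) (hb : 0 < b) (hT : 0 < T)
    {ω : Set Torus} (hω : IsOpen ω) (hne : ω.Nonempty) :
    ∃ K, 0 ≤ K ∧ ∀ (ε B : ℝ) (u r : ℝ → ℤ → ℂ) (w : ℝ → LTwo), 0 < ε →
      ContinuousOn w (Icc 0 T) →
      IsEvolution majorant ε B T (disp g b) u r (fun t => fourierCoeff (w t)) →
      (fourierCoeff (w 0) 0).re ^ 2 ≤ K * (totalObs T ω w + ε ^ 2 * B) := by
  obtain ⟨Φ, hΦ, hz, hp, h1, -⟩ := exists_torus_test_function hω hne 0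
  obtain ⟨K, hK, h⟩ := exists_sq_norm_freqCoeff_le hg hb hT hΦ hz hp 0
  set P := 2 * π * fourierCoeff Φ (-0) with hP
  have hP0 : 0 < ‖P‖ := norm_pos_iff.2 h1
  refine ⟨(1 / ‖P‖) ^ 2 * K, by positivity, fun ε B u r w hε hw ha => ?_⟩
  have h3 := h ε B u r w hε hw ha
  have h4 : freqCoeff (fun n => 2 * π * fourierCoeff Φ (-n)) (fourierCoeff (w 0)) 0 =
      P * (fourierCoeff (w 0) 0).re := by
    unfold freqCoeff
    rw [if_neg (lt_irrefl _), if_neg (lt_irrefl _)]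
  rw [h4, norm_mul, Complex.norm_real, mul_pow, Real.norm_eq_abs, sq_abs] at h3
  calc (fourierCoeff (w 0) 0).re ^ 2 =
        (1 / ‖P‖) ^ 2 * (‖P‖ ^ 2 * (fourierCoeff (w 0) 0).re ^ 2) := by
        field_simp
    _ ≤ (1 / ‖P‖) ^ 2 * (K * (totalObs T ω w + ε ^ 2 * B)) := by gcongr
    _ = _ := by ring

/-- Pointwise in time, the quadratic form of the trigonometric polynomial is dominated by the
observation. -/
theorem re_sum_form_le {ω : Set Torus} (hω : IsOpen ω) {Q : Finset ℤ} {c : ℤ → ℂ}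
    (hχ2 : ∀ x : Torus, (∑ q ∈ Q, c q * fourier q x : ℂ).re ≤ 2)
    (hχ0 : ∀ x ∉ ω, (∑ q ∈ Q, c q * fourier q x : ℂ).re ≤ 0) (f : LTwo) :
    (∑ q ∈ Q, c q * ∫ x, fourier q x * (((f x).re ^ 2 : ℝ) : ℂ)).re ≤ 2 * obs ω f := by
  have hI : ∀ q, Integrable fun x : Torus => fourier q x * (((f x).re ^ 2 : ℝ) : ℂ) := by
    intro q
    refine ((integrable_re_sq f).ofReal (𝕜 := ℂ)).bdd_mul (c := 1)
      (fourier q).continuous.aestronglyMeasurable (Filter.Eventually.of_forall fun x => ?_)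
    rw [fourier_apply]
    exact (Circle.norm_coe _).le
  have e : ∑ q ∈ Q, c q * ∫ x, fourier q x * (((f x).re ^ 2 : ℝ) : ℂ) =
      ∫ x, (∑ q ∈ Q, c q * fourier q x) * (((f x).re ^ 2 : ℝ) : ℂ) := by
    simp only [Finset.sum_mul, mul_assoc]
    rw [integral_finsetSum _ fun q _ => (hI q).const_mul (c q)]
    simp only [integral_const_mul]
  have hI' : Integrable fun x : Torus => (∑ q ∈ Q, c q * fourier q x) *
      (((f x).re ^ 2 : ℝ) : ℂ) := by
    simp only [Finset.sum_mul, mul_assoc]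
    exact integrable_finsetSum _ fun q _ => (hI q).const_mul (c q)
  have e2 : (∫ x, (∑ q ∈ Q, c q * fourier q x) * (((f x).re ^ 2 : ℝ) : ℂ)).re =
      ∫ x, ((∑ q ∈ Q, c q * fourier q x) * (((f x).re ^ 2 : ℝ) : ℂ)).re :=
    (integral_re hI').symm
  rw [e, e2, obs, ← integral_const_mul, ← integral_indicator hω.measurableSet]
  refine integral_mono hI'.re (((integrable_re_sq f).const_mul 2).indicator hω.measurableSet)
    fun x => ?_
  change ((∑ q ∈ Q, c q * fourier q x) * (((f x).re ^ 2 : ℝ) : ℂ)).re ≤ _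
  rw [Complex.re_mul_ofReal]
  by_cases hx : x ∈ ω
  · rw [indicator_of_mem hx]
    exact mul_le_mul_of_nonneg_right (hχ2 x) (sq_nonneg _)
  · rw [indicator_of_notMem hx]
    exact mul_nonpos_of_nonpos_of_nonneg (hχ0 x hx) (sq_nonneg _)

theorem lowEnergy_nonneg (N : ℕ) (v : ℤ → ℂ) : 0 ≤ lowEnergy N v :=
  Finset.sum_nonneg fun _ _ => sq_nonneg _

theorem lowEnergy_mono {N N' : ℕ} (h : N ≤ N') (v : ℤ → ℂ) : lowEnergy N v ≤ lowEnergy N' v := by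
  refine Finset.sum_le_sum_of_subset_of_nonneg (Finset.Icc_subset_Icc ?_ ?_)
    fun _ _ _ => sq_nonneg _ <;> omega

/-- Up to low frequencies and small errors, the observation controls the time integral of the
`L²` norm. -/
theorem exists_integral_tsum_sq_le {g b T : ℝ} (hg : 0 < g) (hb : 0 < b) (hT : 0 < T)
    {ω : Set Torus} (hω : IsOpen ω) (hne : ω.Nonempty) {η : ℝ} (hη : 0 < η) :
    ∃ (N : ℕ) (K : ℝ), 0 ≤ K ∧ ∀ (ε B Λ : ℝ) (u r : ℝ → ℤ → ℂ) (w : ℝ → LTwo), 0 < ε →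
      ContinuousOn w (Icc 0 T) →
      IsEvolution majorant ε B T (disp g b) u r (fun t => fourierCoeff (w t)) →
      (∀ t ∈ Icc 0 T, lowEnergy N (fourierCoeff (w t)) ≤ Λ) →
      ∫ t in (0 : ℝ)..T, ∑' n, ‖fourierCoeff (w t) n‖ ^ 2 ≤
        K * totalObs T ω w + (η + K * ε) * B + K * Λ := by
  obtain ⟨Q, c, h0Q, hc0, hχ2, hχ0⟩ := exists_trig_polynomial hω hne
  set D : ℕ := Q.sup Int.natAbs with hD
  have hQD : ∀ q ∈ Q, |q| ≤ D := by
    intro q hq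
    have := Finset.le_sup (f := Int.natAbs) hq
    rw [Int.abs_eq_natAbs]
    exact_mod_cast this
  set s : ℝ := ∑ q ∈ Q, ‖c q‖ with hs
  have hs0 : 0 ≤ s := Finset.sum_nonneg fun _ _ => norm_nonneg _
  set γ := (c 0).re with hγ
  have hη' : 0 < η * γ / (2 * (s + 1)) := by positivity
  obtain ⟨N₁, K₁, hK₁, h₁⟩ := exists_norm_integral_diagForm_le hg hb majorant_nonneg
    summable_majorant hT.le D hη'
  obtain ⟨N₂, K₂, hK₂, h₂⟩ := exists_norm_integral_diagForm_conj_le hg hb majorant_nonneg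
    summable_majorant hT.le D hη'
  refine ⟨max N₁ N₂, 2 / (π * γ) + 2 * s / γ * (K₁ + K₂), by positivity,
    fun ε B Λ u r w hε hw ha hΛ => ?_⟩
  have h0T : (0 : ℝ) ∈ Icc 0 T := ⟨le_rfl, hT.le⟩
  have hB : 0 ≤ B := (tsum_nonneg fun _ => sq_nonneg _).trans (ha.a_le 0 h0T)
  have hΛ0 : 0 ≤ Λ := (lowEnergy_nonneg _ _).trans (hΛ 0 h0T)
  set a : ℝ → ℤ → ℂ := fun t => fourierCoeff (w t) with hadef
  set I : ℝ := ∫ t in (0 : ℝ)..T, ∑' n, ‖a t n‖ ^ 2 with hI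
  set δ : ℝ := (η * γ / (2 * (s + 1)) + (K₁ + K₂) * ε) * B + (K₁ + K₂) * Λ with hδ
  set X : ℤ → ℂ := fun q => ∫ t in (0 : ℝ)..T, diagForm (fun _ => 1) q (a t) (a t) with hX
  set Y : ℤ → ℂ := fun q => ∫ t in (0 : ℝ)..T,
    diagForm (fun _ => 1) q (a t) (fun n => conj (a t (-n))) with hY
  have hXδ : ∀ q ∈ Q, ‖X q - if q = 0 then (I : ℂ) else 0‖ ≤ δ := by
    intro q hq
    refine (h₁ ε B Λ u r a hε ha (fun t ht => (lowEnergy_mono (le_max_left _ _) _).trans (hΛ t ht))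
      q (hQD q hq)).trans ?_
    rw [hδ]
    gcongr <;> linarith
  have hYδ : ∀ q : ℤ, |q| ≤ D → ‖Y q‖ ≤ δ := by
    intro q hq
    refine (h₂ ε B Λ u r a hε ha (fun t ht => (lowEnergy_mono (le_max_right _ _) _).trans (hΛ t ht))
      q hq).trans ?_
    rw [hδ]
    gcongr <;> linarith
  have ha' := ha.conj (disp_neg g b)
  have iX : ∀ q, IntervalIntegrable (fun t => diagForm (fun _ => 1) q (a t) (a t)) volume 0 T :=
    fun q => intervalIntegrable_diagForm ha ha (C := 1) (by simp) q hT.le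
  have iY : ∀ q, IntervalIntegrable (fun t => diagForm (fun _ => 1) q (a t)
      (fun n => conj (a t (-n)))) volume 0 T :=
    fun q => intervalIntegrable_diagForm ha ha' (C := 1) (by simp) q hT.le
  have iYc : ∀ q, IntervalIntegrable (fun t => conj (diagForm (fun _ => 1) q (a t)
      (fun n => conj (a t (-n))))) volume 0 T := fun q =>
    ⟨(Complex.conjCLE.toContinuousLinearMap.integrable_comp (iY q).1),
      (Complex.conjCLE.toContinuousLinearMap.integrable_comp (iY q).2)⟩
  have eYc : ∀ q, ∫ t in (0 : ℝ)..T, conj (diagForm (fun _ => 1) q (a t)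
      (fun n => conj (a t (-n)))) = conj (Y q) := by
    intro q
    exact intervalIntegral.intervalIntegral_conj
  -- the time integral of the quadratic form of the trigonometric polynomial
  set Z : ℝ → ℂ := fun t => ∑ q ∈ Q, c q * ∫ x, fourier q x * (((w t x).re ^ 2 : ℝ) : ℂ) with hZ
  have hZeq : Z = fun t => ∑ q ∈ Q, c q * ((π / 2) *
      (2 * diagForm (fun _ => 1) q (a t) (a t)
        + diagForm (fun _ => 1) q (a t) (fun n => conj (a t (-n)))
        + conj (diagForm (fun _ => 1) (-q) (a t) (fun n => conj (a t (-n)))))) := by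
    funext t
    simp only [hZ, integral_fourier_mul_re_sq, hadef]
  have iZq : ∀ q, IntervalIntegrable (fun t => c q * ((π / 2) *
      (2 * diagForm (fun _ => 1) q (a t) (a t)
        + diagForm (fun _ => 1) q (a t) (fun n => conj (a t (-n)))
        + conj (diagForm (fun _ => 1) (-q) (a t) (fun n => conj (a t (-n))))))) volume 0 T :=
    fun q => (((((iX q).const_mul 2).add (iY q)).add (iYc (-q))).const_mul _).const_mul _
  have iZ : IntervalIntegrable Z volume 0 T := by
    have := IntervalIntegrable.sum Q fun q _ => iZq q
    rw [hZeq]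
    simpa only [Finset.sum_fn] using this
  have eZ : ∫ t in (0 : ℝ)..T, Z t =
      ∑ q ∈ Q, c q * ((π / 2) * (2 * X q + Y q + conj (Y (-q)))) := by
    rw [hZeq, intervalIntegral.integral_finsetSum fun q _ => iZq q]
    refine Finset.sum_congr rfl fun q _ => ?_
    rw [intervalIntegral.integral_const_mul, intervalIntegral.integral_const_mul,
      intervalIntegral.integral_add (((iX q).const_mul 2).add (iY q)) (iYc (-q)),
      intervalIntegral.integral_add ((iX q).const_mul 2) (iY q),
      intervalIntegral.integral_const_mul, eYc]
  have hupper : (∫ t in (0 : ℝ)..T, Z t).re ≤ 2 * totalObs T ω w := by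
    have e : (∫ t in (0 : ℝ)..T, Z t).re = ∫ t in (0 : ℝ)..T, (Z t).re :=
      (Complex.reCLM.intervalIntegral_comp_comm iZ).symm
    rw [e, totalObs, ← intervalIntegral.integral_const_mul]
    refine intervalIntegral.integral_mono_on hT.le
      ⟨iZ.1.re, iZ.2.re⟩ ((intervalIntegrable_obs hT.le ω hw).const_mul 2) fun t _ => ?_
    exact re_sum_form_le hω hχ2 hχ0 (w t)
  have hlower : π * γ * I - 2 * π * s * δ ≤ (∫ t in (0 : ℝ)..T, Z t).re := by
    have e : (∫ t in (0 : ℝ)..T, Z t) - π * c 0 * I =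
        ∑ q ∈ Q, c q * ((π / 2) * (2 * (X q - if q = 0 then (I : ℂ) else 0) + Y q
          + conj (Y (-q)))) := by
      have : ∑ q ∈ Q, c q * (π * if q = 0 then (I : ℂ) else 0) = π * c 0 * I := by
        rw [Finset.sum_eq_single_of_mem 0 h0Q fun q _ hq => by rw [if_neg hq]; ring, if_pos rfl]
        ring
      rw [eZ, ← this, ← Finset.sum_sub_distrib]
      refine Finset.sum_congr rfl fun q _ => ?_
      ring
    have hn : ‖(∫ t in (0 : ℝ)..T, Z t) - π * c 0 * I‖ ≤ 2 * π * s * δ := by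
      rw [e]
      refine (norm_sum_le _ _).trans ?_
      rw [hs, Finset.mul_sum, Finset.sum_mul]
      refine Finset.sum_le_sum fun q hq => ?_
      have b1 := hXδ q hq
      have b2 := hYδ q (hQD q hq)
      have b3 := hYδ (-q) (by rw [abs_neg]; exact hQD q hq)
      rw [norm_mul, norm_mul, norm_div, Complex.norm_real, Complex.norm_ofNat,
        Real.norm_of_nonneg Real.pi_pos.le]
      have b4 : ‖2 * (X q - if q = 0 then (I : ℂ) else 0) + Y q + conj (Y (-q))‖ ≤ 4 * δ := by
        refine (norm_add₃_le).trans ?_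
        rw [norm_mul, Complex.norm_ofNat, RCLike.norm_conj]
        linarith
      calc ‖c q‖ * (π / 2 * ‖2 * (X q - if q = 0 then (I : ℂ) else 0) + Y q + conj (Y (-q))‖) ≤
            ‖c q‖ * (π / 2 * (4 * δ)) := by
            have := Real.pi_pos
            gcongr
        _ = 2 * π * ‖c q‖ * δ := by ring
    have h1 := (abs_le.1 ((Complex.abs_re_le_norm _).trans hn)).1
    rw [Complex.sub_re, Complex.re_mul_ofReal, Complex.re_ofReal_mul] at h1
    linarith
  have hmain : I ≤ 2 / (π * γ) * totalObs T ω w + 2 * s / γ * δ := by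
    have h1 : π * γ * I ≤ 2 * totalObs T ω w + 2 * π * s * δ := by linarith
    have hπ := Real.pi_pos
    have h2 : I ≤ (2 * totalObs T ω w + 2 * π * s * δ) / (π * γ) := by
      rw [le_div_iff₀ (by positivity)]
      linarith
    refine h2.trans_eq ?_
    field_simp
  refine hmain.trans ?_
  have hO := totalObs_nonneg hT.le ω w
  have hπ := Real.pi_pos
  have e1 : 2 * s / γ * (η * γ / (2 * (s + 1))) ≤ η := by
    have : 2 * s / γ * (η * γ / (2 * (s + 1))) = η * (s / (s + 1)) := by field_simp
    rw [this]
    exact mul_le_of_le_one_right hη.le (div_le_one_of_le₀ (by linarith) (by linarith))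
  have e2 : 2 * s / γ * δ = 2 * s / γ * (η * γ / (2 * (s + 1))) * B +
      2 * s / γ * (K₁ + K₂) * ε * B + 2 * s / γ * (K₁ + K₂) * Λ := by
    rw [hδ]; ring
  rw [e2]
  have p1 : 0 ≤ 2 / (π * γ) := by positivity
  have p2 : 0 ≤ 2 * s / γ * (K₁ + K₂) := by positivity
  have f1 := mul_le_mul_of_nonneg_right e1 hB
  have f2 := mul_nonneg p1 (mul_nonneg hε.le hB)
  have f3 := mul_nonneg p1 hΛ0
  have f4 := mul_nonneg p2 hO
  linarith

/-! ### Low frequencies and the conclusion -/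

/-- The low frequencies of a solution are controlled, at all times, by those of the datum. -/
theorem lowEnergy_le {κ : ℤ → ℝ} {ε B T : ℝ} {ℓ : ℤ → ℝ} {u r a : ℝ → ℤ → ℂ}
    (h0 : ∀ p, 0 ≤ κ p) (hs : Summable κ) (hε : 0 < ε) (ha : IsEvolution κ ε B T ℓ u r a)
    {t : ℝ} (ht : t ∈ Icc 0 T) (N : ℕ) :
    lowEnergy N (a t) ≤ 2 * lowEnergy N (a 0) + (∑ n ∈ Finset.Icc (-(N : ℤ)) N,
      2 * ((1 + |(n : ℝ)|) * ((∑' p, κ p) + 1) * T) ^ 2) * (ε ^ 2 * B) := by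
  have hB : 0 ≤ B := (tsum_nonneg fun _ => sq_nonneg _).trans (ha.a_le t ht)
  unfold lowEnergy
  rw [Finset.mul_sum, Finset.sum_mul, ← Finset.sum_add_distrib]
  refine Finset.sum_le_sum fun n _ => ?_
  have h1 := norm_sub_free_le h0 hs hε ha ht n
  have h2 : ‖a t n‖ ≤ ‖a 0 n‖ + (1 + |(n : ℝ)|) * (ε * ((∑' p, κ p) + 1) * √B * T) := by
    have h3 := norm_le_norm_add_norm_sub
      (a 0 n * Complex.exp (-(Complex.I * (ℓ n * t : ℝ)))) (a t n)
    rw [norm_sub_rev, norm_mul, ← mul_neg, ← Complex.ofReal_neg, Complex.norm_exp_I_mul_ofReal,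
      mul_one] at h3
    rw [← mul_neg, ← Complex.ofReal_neg] at h1
    linarith
  have h4 : ‖a t n‖ ^ 2 ≤ 2 * ‖a 0 n‖ ^ 2 +
      2 * ((1 + |(n : ℝ)|) * (ε * ((∑' p, κ p) + 1) * √B * T)) ^ 2 := by
    have h5 := pow_le_pow_left₀ (norm_nonneg _) h2 2
    nlinarith [sq_nonneg (‖a 0 n‖ - (1 + |(n : ℝ)|) * (ε * ((∑' p, κ p) + 1) * √B * T))]
  refine h4.trans_eq ?_
  have h6 := Real.sq_sqrt hB
  linear_combination 2 * ((1 + |(n : ℝ)|) * ((∑' p, κ p) + 1) * T) ^ 2 * ε ^ 2 * h6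

/-- The observation and the mean of the datum together control the maximal `L²` norm. -/
theorem exists_le_totalObs_add_mean {g b T : ℝ} (hg : 0 < g) (hb : 0 < b) (hT : 0 < T)
    {ω : Set Torus} (hω : IsOpen ω) (hne : ω.Nonempty) :
    ∃ ε₁ K : ℝ, 0 < ε₁ ∧ 0 ≤ K ∧ ∀ (ε M : ℝ) (u r : ℝ → ℤ → ℂ) (w : ℝ → LTwo), 0 < ε → ε ≤ ε₁ →
      ContinuousOn w (Icc 0 T) →
      IsEvolution majorant ε M T (disp g b) u r (fun t => fourierCoeff (w t)) →
      (∃ t ∈ Icc 0 T, ∑' n, ‖fourierCoeff (w t) n‖ ^ 2 = M) →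
      M ≤ K * (totalObs T ω w + ‖fourierCoeff (w 0) 0‖ ^ 2) := by
  obtain ⟨N, K, hK, hmain⟩ := exists_integral_tsum_sq_le hg hb hT hω hne
    (show 0 < T / 8 by positivity)
  -- the coefficients of non-zero frequency are observed, that of frequency zero is kept
  have hcoef : ∀ m : ℤ, ∃ k, 0 ≤ k ∧ ∀ (ε B : ℝ) (u r : ℝ → ℤ → ℂ) (w : ℝ → LTwo), 0 < ε →
      ContinuousOn w (Icc 0 T) →
      IsEvolution majorant ε B T (disp g b) u r (fun t => fourierCoeff (w t)) →
      ‖fourierCoeff (w 0) m‖ ^ 2 ≤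
        (if m = 0 then ‖fourierCoeff (w 0) 0‖ ^ 2 else 0) +
          k * (totalObs T ω w + ε ^ 2 * B) := by
    intro m
    rcases eq_or_ne m 0 with rfl | hm
    · exact ⟨0, le_rfl, fun ε B u r w _ _ _ => by simp⟩
    · obtain ⟨k, hk, h⟩ := exists_sq_norm_coeff_le hg hb hT hω hne hm
      refine ⟨k, hk, fun ε B u r w hε hw ha => ?_⟩
      rw [if_neg hm, zero_add]
      exact h ε B u r w hε hw ha
  choose k hk hcoef using hcoef
  set K' : ℝ := ∑ n ∈ Finset.Icc (-(N : ℤ)) N, k n with hK'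
  have hK'0 : 0 ≤ K' := Finset.sum_nonneg fun n _ => hk n
  set S : ℝ := ∑' p, majorant p with hS
  have hS0 : 0 ≤ S := tsum_nonneg majorant_nonneg
  set L : ℝ := ∑ n ∈ Finset.Icc (-(N : ℤ)) N, 2 * ((1 + |(n : ℝ)|) * (S + 1) * T) ^ 2 with hL
  have hL0 : 0 ≤ L := Finset.sum_nonneg fun n _ => by positivity
  refine ⟨min 1 (min (1 / (4 * (5 * S + 2) * T)) (T / (8 * (K + 2 * K * K' + K * L + 1)))),
    4 / T * (3 * K + 2 * K * K'), by positivity, by positivity,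
    fun ε M u r w hε hε₁ hw ha hmax => ?_⟩
  obtain ⟨t₀, ht₀, hM⟩ := hmax
  have hε1 : ε ≤ 1 := hε₁.trans (min_le_left _ _)
  have hε2 : ε * (4 * (5 * S + 2) * T) ≤ 1 := by
    have := hε₁.trans ((min_le_right _ _).trans (min_le_left _ _))
    rwa [le_div_iff₀ (by positivity)] at this
  have hε3 : ε * (8 * (K + 2 * K * K' + K * L + 1)) ≤ T := by
    have := hε₁.trans ((min_le_right _ _).trans (min_le_right _ _))
    rwa [le_div_iff₀ (by positivity)] at this
  have hM0 : 0 ≤ M := by rw [← hM]; exact tsum_nonneg fun _ => sq_nonneg _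
  have hO := totalObs_nonneg hT.le ω w
  set A := ‖fourierCoeff (w 0) 0‖ ^ 2 with hA
  have hA0 : 0 ≤ A := sq_nonneg _
  have hεM : ε ^ 2 * M ≤ ε * M := by
    have : ε ^ 2 ≤ ε := by nlinarith
    gcongr
  -- near conservation of the energy
  have hX : ∀ t ∈ Icc 0 T, M / 2 ≤ ∑' n, ‖fourierCoeff (w t) n‖ ^ 2 := by
    intro t ht
    have h1 := (abs_le.1 (abs_tsum_sq_sub_le majorant_nonneg summable_majorant hε ha ht)).1
    have h2 := (abs_le.1 (abs_tsum_sq_sub_le majorant_nonneg summable_majorant hε ha ht₀)).2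
    beta_reduce at h1 h2
    rw [hM] at h2
    have h3 := mul_le_mul_of_nonneg_right hε2 hM0
    linarith
  have hint : T * (M / 2) ≤ ∫ t in (0 : ℝ)..T, ∑' n, ‖fourierCoeff (w t) n‖ ^ 2 := by
    have h1 : ∫ _t in (0 : ℝ)..T, M / 2 ≤ ∫ t in (0 : ℝ)..T, ∑' n, ‖fourierCoeff (w t) n‖ ^ 2 := by
      refine intervalIntegral.integral_mono_on hT.le intervalIntegrable_const ?_ hX
      simp only [tsum_sq_fourierCoeff_LTwo]
      exact (ContinuousOn.mul continuousOn_const (hw.norm.pow 2)).intervalIntegrable_of_Icc hT.le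
    rwa [intervalIntegral.integral_const, sub_zero, smul_eq_mul] at h1
  have hlow0 : lowEnergy N (fourierCoeff (w 0)) ≤ A + K' * (totalObs T ω w + ε * M) := by
    have h1 : lowEnergy N (fourierCoeff (w 0)) ≤ ∑ m ∈ Finset.Icc (-(N : ℤ)) N,
        ((if m = 0 then A else 0) + k m * (totalObs T ω w + ε ^ 2 * M)) :=
      Finset.sum_le_sum fun m _ => hcoef m ε M u r w hε hw ha
    rw [Finset.sum_add_distrib, ← Finset.sum_mul, Finset.sum_ite_eq', if_pos (by simp)] at h1
    refine h1.trans ?_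
    gcongr
  have hlow : ∀ t ∈ Icc 0 T, lowEnergy N (fourierCoeff (w t)) ≤
      2 * (A + K' * (totalObs T ω w + ε * M)) + L * (ε * M) := by
    intro t ht
    refine (lowEnergy_le majorant_nonneg summable_majorant hε ha ht N).trans ?_
    gcongr
  have h := hint.trans (hmain ε M _ u r w hε hw ha hlow)
  have h5 := mul_le_mul_of_nonneg_right hε3 hM0
  have hfin : T / 4 * M ≤ (K + 2 * K * K') * totalObs T ω w + 2 * K * A := by
    have := mul_nonneg hε.le hM0
    linarith
  have : T / 4 * M ≤ (3 * K + 2 * K * K') * (totalObs T ω w + A) := by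
    have f1 := mul_nonneg hK hO
    have f2 := mul_nonneg hK hA0
    have f3 := mul_nonneg (mul_nonneg hK hK'0) hA0
    linarith
  calc M = 4 / T * (T / 4 * M) := by field_simp
    _ ≤ 4 / T * ((3 * K + 2 * K * K') * (totalObs T ω w + A)) := by gcongr
    _ = _ := by ring

/-- The observability inequality for the Fourier coefficients, under the condition on the mean of
the state at an arbitrary time `s`. -/
theorem exists_observability {g b T : ℝ} (hg : 0 < g) (hb : 0 < b) (hT : 0 < T)
    {ω : Set Torus} (hω : IsOpen ω) (hne : ω.Nonempty) {c : ℝ} (hc : 0 < c) (hc1 : c ≤ 1) :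
    ∃ ε₂ ε₃ K : ℝ, 0 < ε₂ ∧ 0 < ε₃ ∧ 0 < K ∧ ∀ (M : ℝ) (u r : ℝ → ℤ → ℂ) (w : ℝ → LTwo),
      ContinuousOn w (Icc 0 T) →
      IsEvolution majorant ε₂ M T (disp g b) u r (fun t => fourierCoeff (w t)) →
      (∃ t ∈ Icc 0 T, ∑' n, ‖fourierCoeff (w t) n‖ ^ 2 = M) →
      ∀ s ∈ Icc 0 T, c * ‖fourierCoeff (w s) 0‖ - ε₃ * ‖w s‖ ≤ |(fourierCoeff (w s) 0).re| →
        K * ‖w s‖ ^ 2 ≤ totalObs T ω w := by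
  obtain ⟨ε₁, K₁, hε₁, hK₁, hmain⟩ := exists_le_totalObs_add_mean hg hb hT hω hne
  obtain ⟨Kr, hKr, hre⟩ := exists_sq_re_coeff_zero_le hg hb hT hω hne
  set E : ℝ := ((∑' p, majorant p) + 1) * T with hE
  have hE0 : 0 ≤ E := by
    have : 0 ≤ ∑' p, majorant p := tsum_nonneg majorant_nonneg
    positivity
  set A : ℝ := K₁ * (3 / c ^ 2) with hA
  have hA0 : 0 ≤ A := by positivity
  have hπ := Real.pi_pos
  set ε₂ : ℝ := min ε₁ (min 1 (1 / (4 * A * (Kr + 4 * E ^ 2) + 1))) with hε₂def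
  set ε₃ : ℝ := min 1 (1 / (8 * π * A + 1)) with hε₃def
  have hε₂ : 0 < ε₂ := by positivity
  have hε₃ : 0 < ε₃ := by positivity
  refine ⟨ε₂, ε₃, 1 / (4 * π * (K₁ + A * Kr) + 1), hε₂, hε₃, by positivity,
    fun M u r w hw ha hmax s hs hmean => ?_⟩
  have hε₂1 : ε₂ ≤ 1 := (min_le_right _ _).trans (min_le_left _ _)
  have hε₂A : ε₂ * (4 * A * (Kr + 4 * E ^ 2) + 1) ≤ 1 := by
    have : ε₂ ≤ 1 / (4 * A * (Kr + 4 * E ^ 2) + 1) := (min_le_right _ _).trans (min_le_right _ _)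
    rwa [le_div_iff₀ (by positivity)] at this
  have hε₃1 : ε₃ ≤ 1 := min_le_left _ _
  have hε₃A : ε₃ * (8 * π * A + 1) ≤ 1 := by
    have : ε₃ ≤ 1 / (8 * π * A + 1) := min_le_right _ _
    rwa [le_div_iff₀ (by positivity)] at this
  have h1 := hmain ε₂ M u r w hε₂ (min_le_left _ _) hw ha hmax
  clear_value ε₂ ε₃ A E
  have h2 := hre ε₂ M u r w hε₂ hw ha
  have h0T : (0 : ℝ) ∈ Icc 0 T := ⟨le_rfl, hT.le⟩
  have hM0 : 0 ≤ M := (tsum_nonneg fun _ => sq_nonneg _).trans (ha.a_le 0 h0T)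
  have hO := totalObs_nonneg hT.le ω w
  have hws : ‖w s‖ ^ 2 ≤ 2 * π * M := by
    have h3 := ha.a_le s hs
    rw [tsum_sq_fourierCoeff_LTwo, inv_mul_le_iff₀ (by positivity)] at h3
    exact h3
  -- the mean is almost constant in time, since the symbol vanishes at the frequency zero
  have hd : ‖fourierCoeff (w s) 0 - fourierCoeff (w 0) 0‖ ≤ ε₂ * E * √M := by
    have h3 := norm_sub_free_le majorant_nonneg summable_majorant hε₂ ha hs 0
    simp only [disp_zero, zero_mul, Complex.ofReal_zero, mul_zero, neg_zero, Complex.exp_zero,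
      mul_one, Int.cast_zero, abs_zero, add_zero, one_mul] at h3
    refine h3.trans_eq ?_
    rw [hE]; ring
  set z := fourierCoeff (w s) 0 with hz
  set y := fourierCoeff (w 0) 0 with hy
  have hcy : c * ‖y‖ ≤ |y.re| + 2 * (ε₂ * E * √M) + ε₃ * ‖w s‖ := by
    have e1 : ‖y‖ ≤ ‖z‖ + ‖z - y‖ := by
      have := norm_sub_le z (z - y)
      rwa [sub_sub_cancel] at this
    have e2 : |z.re| ≤ |y.re| + ‖z - y‖ := by
      have h3 := Complex.abs_re_le_norm (z - y)
      rw [Complex.sub_re] at h3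
      have h4 := abs_sub_abs_le_abs_sub z.re y.re
      linarith
    have e3 : c * ‖y‖ ≤ c * ‖z‖ + ‖z - y‖ := by
      have h3 := mul_le_mul_of_nonneg_left e1 hc.le
      have h4 := mul_le_of_le_one_left (norm_nonneg (z - y)) hc1
      linarith
    linarith
  have hsq : c ^ 2 * ‖y‖ ^ 2 ≤
      3 * (Kr * totalObs T ω w + (ε₂ * (Kr + 4 * E ^ 2) + 2 * π * ε₃) * M) := by
    have h3 := pow_le_pow_left₀ (by positivity) hcy 2
    have h4 : (|y.re| + 2 * (ε₂ * E * √M) + ε₃ * ‖w s‖) ^ 2 ≤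
        3 * (y.re ^ 2 + 4 * (ε₂ ^ 2 * E ^ 2 * M) + ε₃ ^ 2 * ‖w s‖ ^ 2) := by
      have h5 := sq_abs y.re
      have h6 : (ε₂ * E * √M) ^ 2 = ε₂ ^ 2 * E ^ 2 * M := by
        rw [mul_pow, mul_pow, Real.sq_sqrt hM0]
      have h7 : ∀ p q r : ℝ, (p + q + r) ^ 2 ≤ 3 * (p ^ 2 + q ^ 2 + r ^ 2) := fun p q r => by
        linarith [sq_nonneg (p - q), sq_nonneg (p - r), sq_nonneg (q - r)]
      refine (h7 _ _ _).trans_eq ?_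
      rw [← h5, ← h6]
      ring
    have h7 : ε₂ ^ 2 ≤ ε₂ := by rw [sq]; exact mul_le_of_le_one_left hε₂.le hε₂1
    have h8 : ε₃ ^ 2 ≤ ε₃ := by rw [sq]; exact mul_le_of_le_one_left hε₃.le hε₃1
    have h9 : ε₃ ^ 2 * ‖w s‖ ^ 2 ≤ ε₃ * (2 * π * M) := by gcongr
    have h10 : ε₂ ^ 2 * E ^ 2 * M ≤ ε₂ * E ^ 2 * M := by gcongr
    have h11 : Kr * (ε₂ ^ 2 * M) ≤ Kr * (ε₂ * M) := by gcongr
    rw [mul_pow] at h3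
    linarith
  have hy2 : K₁ * ‖y‖ ^ 2 ≤
      A * (Kr * totalObs T ω w + (ε₂ * (Kr + 4 * E ^ 2) + 2 * π * ε₃) * M) := by
    calc K₁ * ‖y‖ ^ 2 = K₁ * (1 / c ^ 2) * (c ^ 2 * ‖y‖ ^ 2) := by field_simp
      _ ≤ K₁ * (1 / c ^ 2) *
          (3 * (Kr * totalObs T ω w + (ε₂ * (Kr + 4 * E ^ 2) + 2 * π * ε₃) * M)) := by gcongr
      _ = _ := by rw [hA]; ring
  have hM : M ≤ 2 * (K₁ + A * Kr) * totalObs T ω w := by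
    have f1 := mul_le_mul_of_nonneg_right hε₂A hM0
    have f2 := mul_le_mul_of_nonneg_right hε₃A hM0
    have f3 := mul_nonneg hε₂.le hM0
    have f4 := mul_nonneg hε₃.le hM0
    linarith
  -- `1` is added to the denominator of the constant only to keep it positive
  rw [one_div, inv_mul_le_iff₀ (by positivity)]
  have := mul_le_mul_of_nonneg_left hM (show 0 ≤ 2 * π by positivity)
  linarith

end WaveObs

end

theorem mainTheorem7 :
    ∃ r : ℝ, 0 < r ∧
      ∀ (g b : ℝ), 0 < g → 0 < b →
      ∀ (T : ℝ), 0 < T →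
      ∀ (ω : Set WaveObs.Torus), IsOpen ω → ω.Nonempty →
      ∀ (c : ℝ), 0 < c → c ≤ 1 →
      ∃ ε₂ ε₃ K : ℝ, 0 < ε₂ ∧ 0 < ε₃ ∧ 0 < K ∧
        ∀ (W : ℝ → WaveObs.Sobolev 1) (R : ℝ → WaveObs.LTwo →L[ℝ] WaveObs.LTwo),
          ContDiffOn ℝ 3 W (Set.Icc 0 T) →
          ContinuousOn R (Set.Icc 0 T) →
          (∀ t ∈ Set.Icc 0 T,
            ∀ᵐ x ∂(MeasureTheory.volume : MeasureTheory.Measure WaveObs.Torus),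
              ((W t).toLTwo x).im = 0) →
          (∀ t ∈ Set.Icc 0 T, WaveObs.mean (W t).toLTwo = 0) →
          (⨆ t ∈ Set.Icc 0 T, ∑ k ∈ Finset.Icc 1 3, ‖iteratedDerivWithin k W (Set.Icc 0 T) t‖ₑ)
              + (⨆ t ∈ Set.Icc 0 T, WaveObs.sobolevENorm r (W t).toLTwo)
              + (⨆ t ∈ Set.Icc 0 T, ‖R t‖ₑ) ≤ ENNReal.ofReal ε₂ →
          ∀ w₀ : WaveObs.LTwo,
            c * ‖WaveObs.mean w₀‖ - ε₃ * ‖w₀‖ ≤ |(WaveObs.mean w₀).re| →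
            ∀ w : ℝ → WaveObs.LTwo,
              WaveObs.IsSolution g b T (fun t => (W t).toLTwo) R w →
              (w 0 = w₀ →
                K * (∫ x, ‖w₀ x‖ ^ 2) ≤ ∫ t in (0 : ℝ)..T, ∫ x in ω, (w t x).re ^ 2) ∧
              (w T = w₀ →
                K * (∫ x, ‖w₀ x‖ ^ 2) ≤ ∫ t in (0 : ℝ)..T, ∫ x in ω, (w t x).re ^ 2) := by
  refine ⟨4, by norm_num, fun g b hg hb T hT ω hω hne c hc hc1 => ?_⟩
  obtain ⟨ε₂, ε₃, K, hε₂, hε₃, hK, hmain⟩ :=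
    WaveObs.exists_observability hg hb hT hω hne hc hc1
  refine ⟨ε₂, ε₃, K, hε₂, hε₃, hK, fun W R _ _ hreal _ hsmall w₀ hmean w hw => ?_⟩
  have hW : ∀ t ∈ Icc 0 T, WaveObs.sobolevENorm 4 (W t).toLTwo ≤ ENNReal.ofReal ε₂ :=
    fun t ht => (le_iSup₂ (f := fun t (_ : t ∈ Icc 0 T) =>
      WaveObs.sobolevENorm 4 (W t).toLTwo) t ht).trans
        ((le_add_self.trans le_self_add).trans hsmall)
  have hR : ∀ t ∈ Icc 0 T, ‖R t‖ ≤ ε₂ := by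
    intro t ht
    have h1 : ‖R t‖ₑ ≤ ENNReal.ofReal ε₂ :=
      (le_iSup₂ (f := fun t (_ : t ∈ Icc 0 T) => ‖R t‖ₑ) t ht).trans (le_add_self.trans hsmall)
    rw [← ofReal_norm] at h1
    exact (ENNReal.ofReal_le_ofReal_iff hε₂.le).1 h1
  obtain ⟨t₀, ht₀, hmax⟩ := isCompact_Icc.exists_isMaxOn (nonempty_Icc.2 hT.le)
    (hw.continuousOn.norm)
  have ha := WaveObs.isEvolution_of_isSolution hε₂.le hw hreal hW hR
    (B := ∑' n, ‖fourierCoeff (w t₀) n‖ ^ 2) (fun t ht => by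
      rw [WaveObs.tsum_sq_fourierCoeff_LTwo, WaveObs.tsum_sq_fourierCoeff_LTwo]
      have h1 : ‖w t‖ ≤ ‖w t₀‖ := hmax ht
      have := Real.two_pi_pos
      gcongr)
  have key : ∀ s ∈ Icc 0 T, w s = w₀ →
      K * (∫ x, ‖w₀ x‖ ^ 2) ≤ ∫ t in (0 : ℝ)..T, ∫ x in ω, (w t x).re ^ 2 := by
    rintro s hs rfl
    rw [WaveObs.integral_norm_sq]
    rw [WaveObs.mean_eq_fourierCoeff] at hmean
    exact hmain _ _ _ w hw.continuousOn ha ⟨t₀, ht₀, rfl⟩ s hs hmean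
  exact ⟨key 0 ⟨le_rfl, hT.le⟩, key T ⟨hT.le, le_rfl⟩⟩
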